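/- Let $\Gamma$ be a finite group acting linearly on $X=\mathbb C^n$ ($n\ge 0$), let $\mathcal O(X)$ be the algebra of polynomial functions on $X$ with the action $(g\cdot f)(x)=f(g^{-1}x)$, and let $\mathcal O(X)\rtimes\Gamma$ be the crossed product algebra, i.e. the space of sums $\sum_g f_g\,g$ with $g f=(g\cdot f)\,g$. For $\gamma\in\Gamma$ let $X^\gamma\subset X$ be the fixed point set, $\mathcal O(X^\gamma)$ its algebra of regular functions, $\Omega^q(X^\gamma)$ the space of algebraic $q$-forms on $X^\gamma$, $\Gamma_\gamma$ the centralizer of $\gamma$, $C_\gamma$ the cyclic subgroup generated by $\gamma$, and $C_\gamma^*=\operatorname{Hom}(C_\gamma,\mathbb C^*)$. Let $\mathrm{HH}_q$ denote Hochschild homology of complex algebras. For $\gamma\in\Gamma$ choose a representative $s(x)\in\Gamma$ of each coset $x\in\Gamma/C_\gamma$. For $\pi\in C_\gamma^*$ let $$\psi_{\gamma,\pi}:\mathcal O(X)\rtimes\Gamma\to M_{\Gamma/C_\gamma}(\mathcal O(X^\gamma))$$ be the algebra morphism sending $f g$ ($f\in\mathcal O(X)$, $g\in\Gamma$) to the matrix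 whose $(x,y)$ entry is $\pi\big(s(x)^{-1}g\,s(y)\big)\,(s(x)^{-1}\cdot f)|_{X^\gamma}$ if $x=gy$, and $0$ otherwise. Equivalently, $\psi_{\gamma,\pi}$ is the pullback of functions along the $\Gamma$-equivariant map $\Gamma\times_{C_\gamma}X^\gamma\to X$, $(h,x)\mapsto hx$, followed by $\mathcal O(\Gamma\times_{C_\gamma}X^\gamma)\rtimes\Gamma\simeq M_{\Gamma/C_\gamma}(\mathcal O(X^\gamma)\otimes\mathbb C[C_\gamma])$ and by the character $\pi$. Put $$\phi_\gamma=\sum_{\pi\in C_\gamma^*}\frac{\overline{\pi(\gamma)}}{\#C_\gamma}\,\mathrm{HH}_q(\psi_{\gamma,\pi}):\mathrm{HH}_q(\mathcal O(X)\rtimes\Gamma)\to\Omega^q(X^\gamma),$$ where $\mathrm{HH}_q(M_{\Gamma/C_\gamma}(\mathcal O(X^\gamma)))\simeq\mathrm{HH}_q(\mathcal O(X^\gamma))$ is given by the generalized trace and $\mathrm{HH}_q(\mathcal O(X^\gamma))\simeq\Omega^q(X^\gamma)$ by $b_0\otimes\cdots\otimes b_q\mapsto\frac1{q!}\,b_0\,db_1\wedge\cdots\wedge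 db_q$. Then, for every $q\ge 0$ and every choice of a representative $\gamma$ in each conjugacy class $\langle\gamma\rangle\in\langle\Gamma\rangle$ of $\Gamma$ and of the coset representatives, the map $\phi=\bigoplus_{\langle\gamma\rangle}\phi_\gamma$ takes its values in the $\Gamma_\gamma$-invariant forms and is an isomorphism of complex vector spaces $$\phi:\mathrm{HH}_q(\mathcal O(X)\rtimes\Gamma)\xrightarrow{\ \sim\ }\bigoplus_{\langle\gamma\rangle\in\langle\Gamma\rangle}\Omega^q(X^\gamma)^{\Gamma_\gamma}.$$ -/

import Mathlib

open scoped TensorProduct ComplexConjugate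

noncomputable section

namespace CrossedHH

/-! ### Hochschild homology of a unital complex algebra -/

section Hochschild

/-- Hochschild chains: `A ⊗ ⋯ ⊗ A` (`m` factors); degree `q` chains have `m = q + 1`. -/
abbrev TensorPow (A : Type*) [Ring A] [Algebra ℂ A] (m : ℕ) : Type _ := ⨂[ℂ] _ : Fin m, A

theorem contractNth_update {A : Type*} [Ring A] {m : ℕ} [DecidableEq (Fin (m + 1))] (j : Fin m) (a : Fin (m + 1) → A)
    (i : Fin (m + 1)) (z : A) :
    Fin.contractNth j.castSucc (· * ·) (Function.update a i z) =
      Function.update (Fin.contractNth j.castSucc (· * ·) a) (j.predAbove i)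
        (if i = j.castSucc then z * a j.succ else if i = j.succ then a j.castSucc * z else z) := by
  funext k
  have hval : (j.predAbove i : ℕ) = if (j : ℕ) < i then (i : ℕ) - 1 else i := by
    by_cases h : j.castSucc < i
    · rw [Fin.predAbove_of_castSucc_lt _ _ h]
      have : (j : ℕ) < i := by simpa [Fin.lt_def] using h
      simp [this]
    · rw [Fin.predAbove_of_le_castSucc _ _ (not_lt.1 h)]
      have : ¬ (j : ℕ) < i := by simpa [Fin.lt_def] using h
      simp [this]
  have hi := i.isLt
  have hj := j.isLt
  have hk := k.isLt
  by_cases hji : (j : ℕ) < i <;> simp only [hji, if_true, if_false] at hval <;>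
  simp only [Fin.contractNth, Function.update_apply, Fin.ext_iff, Fin.val_castSucc,
    Fin.val_succ, hval] <;>
  split_ifs <;> first | rfl | omega | skip
  all_goals
    congr 2
    all_goals first | rfl | (ext; simp; omega)

variable {A : Type*} [Ring A] [Algebra ℂ A]

/-- `a₀ ⊗ ⋯ ⊗ aₘ ↦ a₀ ⊗ ⋯ ⊗ aⱼ aⱼ₊₁ ⊗ ⋯ ⊗ aₘ`. -/
def contract (A : Type*) [Ring A] [Algebra ℂ A] {m : ℕ} (j : Fin m) :
    TensorPow A (m + 1) →ₗ[ℂ] TensorPow A m :=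
  PiTensorProduct.lift
    { toFun := fun a => PiTensorProduct.tprod ℂ (Fin.contractNth j.castSucc (· * ·) a)
      map_update_add' := by
        intro _ a i x y
        simp only [contractNth_update]
        rw [← MultilinearMap.map_update_add]
        split_ifs <;> simp [add_mul, mul_add]
      map_update_smul' := by
        intro _ a i c x
        simp only [contractNth_update]
        rw [← MultilinearMap.map_update_smul]
        split_ifs <;> simp }

@[simp] theorem contract_tprod {m : ℕ} (j : Fin m) (a : Fin (m + 1) → A) :
    contract A j (PiTensorProduct.tprod ℂ a) =
      PiTensorProduct.tprod ℂ (Fin.contractNth j.castSucc (· * ·) a) := by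
  simp [contract]

/-- The cyclic rotation `a₀ ⊗ ⋯ ⊗ aₘ₋₁ ↦ aₘ₋₁ ⊗ a₀ ⊗ ⋯ ⊗ aₘ₋₂`. -/
def rotate (A : Type*) [Ring A] [Algebra ℂ A] (m : ℕ) : TensorPow A m →ₗ[ℂ] TensorPow A m :=
  (PiTensorProduct.reindex ℂ (fun _ : Fin m => A) (finRotate m)).toLinearMap

@[simp] theorem rotate_tprod {m : ℕ} (a : Fin m → A) :
    rotate A m (PiTensorProduct.tprod ℂ a) =
      PiTensorProduct.tprod ℂ (fun k => a ((finRotate m).symm k)) := by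
  simp [rotate]

/-- The Hochschild differential `b : A^{⊗ (q+2)} → A^{⊗ (q+1)}`,
`b(a₀ ⊗ ⋯ ⊗ a_{q+1}) = ∑_{j ≤ q} (-1)^j a₀ ⊗ ⋯ ⊗ aⱼ aⱼ₊₁ ⊗ ⋯ ⊗ a_{q+1}
  + (-1)^{q+1} a_{q+1} a₀ ⊗ a₁ ⊗ ⋯ ⊗ a_q`. -/
def hochB (A : Type*) [Ring A] [Algebra ℂ A] (q : ℕ) :
    TensorPow A (q + 2) →ₗ[ℂ] TensorPow A (q + 1) :=
  (∑ j : Fin (q + 1), (-1 : ℂ) ^ (j : ℕ) • contract A j) +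
    (-1 : ℂ) ^ (q + 1) • (contract A (0 : Fin (q + 1)) ∘ₗ rotate A (q + 2))

/-- Hochschild cycles of degree `q`. -/
def cycles (A : Type*) [Ring A] [Algebra ℂ A] : (q : ℕ) → Submodule ℂ (TensorPow A (q + 1))
  | 0 => ⊤
  | q + 1 => LinearMap.ker (hochB A q)

/-- Hochschild boundaries of degree `q`. -/
def boundaries (A : Type*) [Ring A] [Algebra ℂ A] (q : ℕ) : Submodule ℂ (TensorPow A (q + 1)) :=
  LinearMap.range (hochB A q)

/-- The Hochschild homology group `HH_q(A)`: cycles modulo boundaries. -/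
abbrev HH (A : Type*) [Ring A] [Algebra ℂ A] (q : ℕ) : Type _ :=
  cycles A q ⧸ (boundaries A q).comap (cycles A q).subtype

variable {A' : Type*} [Ring A'] [Algebra ℂ A']

theorem cycles_map (F : ∀ m, TensorPow A m →ₗ[ℂ] TensorPow A' m)
    (hF : ∀ q, hochB A' q ∘ₗ F (q + 2) = F (q + 1) ∘ₗ hochB A q) (q : ℕ) :
    ∀ x ∈ cycles A q, F (q + 1) x ∈ cycles A' q := by
  intro x hx
  cases q with
  | zero => exact Submodule.mem_top
  | succ q =>
    have h : hochB A q x = 0 := hx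
    have := LinearMap.congr_fun (hF q) x
    simp only [LinearMap.comp_apply, h, map_zero] at this
    exact this

/-- The map induced on Hochschild homology by a map of Hochschild complexes. -/
def HHofChain (F : ∀ m, TensorPow A m →ₗ[ℂ] TensorPow A' m)
    (hF : ∀ q, hochB A' q ∘ₗ F (q + 2) = F (q + 1) ∘ₗ hochB A q) (q : ℕ) :
    HH A q →ₗ[ℂ] HH A' q :=
  Submodule.mapQ _ _ ((F (q + 1)).restrict (cycles_map F hF q)) (by
    rintro ⟨x, hx⟩ ⟨y, hy⟩
    refine ⟨F (q + 2) y, ?_⟩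
    have := LinearMap.congr_fun (hF q) y
    rw [LinearMap.comp_apply, LinearMap.comp_apply] at this
    rw [this, hy]
    rfl)

theorem hochB_comm_of_contract (F : ∀ m, TensorPow A m →ₗ[ℂ] TensorPow A' m)
    (hc : ∀ m (j : Fin m), contract A' j ∘ₗ F (m + 1) = F m ∘ₗ contract A j)
    (hr : ∀ m, rotate A' m ∘ₗ F m = F m ∘ₗ rotate A m) (q : ℕ) :
    hochB A' q ∘ₗ F (q + 2) = F (q + 1) ∘ₗ hochB A q := by
  have h0 : (contract A' (0 : Fin (q + 1)) ∘ₗ rotate A' (q + 2)) ∘ₗ F (q + 2) =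
      F (q + 1) ∘ₗ (contract A (0 : Fin (q + 1)) ∘ₗ rotate A (q + 2)) := by
    rw [LinearMap.comp_assoc, hr, ← LinearMap.comp_assoc, hc, LinearMap.comp_assoc]
  simp only [hochB, LinearMap.add_comp, LinearMap.comp_add, LinearMap.smul_comp,
    LinearMap.comp_smul, h0]
  congr 1
  ext a
  simp only [LinearMap.compMultilinearMap_apply, LinearMap.comp_apply, LinearMap.sum_apply,
    LinearMap.smul_apply, map_sum, map_smul]
  refine Finset.sum_congr rfl fun j _ => ?_
  have := LinearMap.congr_fun (hc (q + 1) j) (PiTensorProduct.tprod ℂ a)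
  simp only [LinearMap.comp_apply] at this
  rw [this]

/-- The tensor power `f ⊗ ⋯ ⊗ f` of an algebra morphism. -/
def tensorMap (f : A →ₐ[ℂ] A') (m : ℕ) : TensorPow A m →ₗ[ℂ] TensorPow A' m :=
  PiTensorProduct.map fun _ => f.toLinearMap

theorem tensorMap_hochB (f : A →ₐ[ℂ] A') (q : ℕ) :
    hochB A' q ∘ₗ tensorMap f (q + 2) = tensorMap f (q + 1) ∘ₗ hochB A q := by
  refine hochB_comm_of_contract (tensorMap f) (fun m j => ?_) (fun m => ?_) q
  · ext a
    simp only [tensorMap, LinearMap.compMultilinearMap_apply, LinearMap.comp_apply,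
      PiTensorProduct.map_tprod, contract_tprod, AlgHom.toLinearMap_apply]
    congr 1
    exact (Fin.comp_contractNth _ _ (fun x y => map_mul f x y) _ _).symm
  · ext a
    simp [tensorMap]

/-- The morphism `HH_q(f)` induced by an algebra morphism `f`. -/
def HHmap (f : A →ₐ[ℂ] A') (q : ℕ) : HH A q →ₗ[ℂ] HH A' q :=
  HHofChain (tensorMap f) (tensorMap_hochB f) q

end Hochschild

/-! ### The isomorphism `HH_q(M_ι(B)) ≃ HH_q(B)` is given by the generalized trace -/

section GeneralizedTrace

variable (ι : Type*) [Fintype ι] [DecidableEq ι] (B : Type*) [Ring B] [Algebra ℂ B]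

/-- `M₀ ⊗ ⋯ ⊗ Mₘ₋₁ ↦ ∑_{i₀, …, iₘ₋₁} (M₀)_{i₀ i₁} ⊗ (M₁)_{i₁ i₂} ⊗ ⋯ ⊗ (Mₘ₋₁)_{iₘ₋₁ i₀}`. -/
def genTrace (m : ℕ) : TensorPow (Matrix ι ι B) m →ₗ[ℂ] TensorPow B m :=
  ∑ i : Fin m → ι, PiTensorProduct.map fun k => Matrix.entryLinearMap ℂ B (i k) (i (finRotate m k))

variable {ι B}

theorem genTrace_tprod {m : ℕ} (M : Fin m → Matrix ι ι B) :
    genTrace ι B m (PiTensorProduct.tprod ℂ M) =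
      ∑ i : Fin m → ι, PiTensorProduct.tprod ℂ fun k => M k (i k) (i (finRotate m k)) := by
  simp [genTrace, LinearMap.sum_apply]

theorem genTrace_rotate (m : ℕ) :
    rotate B m ∘ₗ genTrace ι B m = genTrace ι B m ∘ₗ rotate (Matrix ι ι B) m := by
  refine PiTensorProduct.ext (MultilinearMap.ext fun M => ?_)
  simp only [LinearMap.compMultilinearMap_apply, LinearMap.comp_apply, genTrace_tprod,
    rotate_tprod, map_sum]
  refine Fintype.sum_equiv ((finRotate m).arrowCongr (Equiv.refl ι)) _ _ fun i => ?_
  congr 1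
  funext k
  have h : (finRotate m).symm ((finRotate m) k) = (finRotate m) ((finRotate m).symm k) := by
    rw [Equiv.symm_apply_apply, Equiv.apply_symm_apply]
  simp only [Equiv.arrowCongr, Equiv.coe_fn_mk, Function.comp_apply, Equiv.refl_apply, h]

theorem finRotate_val {m : ℕ} (k : Fin m) :
    (finRotate m k : ℕ) = if (k : ℕ) + 1 = m then 0 else (k : ℕ) + 1 := by
  cases m with
  | zero => exact k.elim0
  | succ m => rw [coe_finRotate]; simp [Fin.ext_iff]

theorem succAbove_val {m : ℕ} (p : Fin (m + 1)) (k : Fin m) :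
    (p.succAbove k : ℕ) = if (k : ℕ) < p then (k : ℕ) else (k : ℕ) + 1 := by
  simp only [Fin.succAbove, Fin.lt_def, Fin.val_castSucc]
  split_ifs <;> rfl

theorem finRotate_succAbove {m : ℕ} (j k : Fin m) (h : k ≠ j) :
    finRotate (m + 1) (j.succ.succAbove k) = j.succ.succAbove (finRotate m k) := by
  have hj := j.isLt
  have hk := k.isLt
  have h' : (k : ℕ) ≠ j := fun e => h (Fin.ext e)
  apply Fin.ext
  simp only [finRotate_val, succAbove_val, Fin.val_succ]
  split_ifs <;> omega

theorem genTrace_contract (m : ℕ) (j : Fin m) :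
    contract B j ∘ₗ genTrace ι B (m + 1) =
      genTrace ι B m ∘ₗ contract (Matrix ι ι B) j := by
  refine PiTensorProduct.ext (MultilinearMap.ext fun M => ?_)
  simp only [LinearMap.compMultilinearMap_apply, LinearMap.comp_apply, genTrace_tprod,
    contract_tprod, map_sum]
  rw [← (Fin.insertNthEquiv (fun _ => ι) j.succ).sum_comp, Fintype.sum_prod_type_right]
  refine Finset.sum_congr rfl fun i _ => ?_
  set v : Fin m → B := fun k =>
    Fin.contractNth j.castSucc (· * ·) M k (i k) (i (finRotate m k)) with hv
  have hvj : v = Function.update v j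
      (∑ l, M j.castSucc (i j) l * M j.succ l (i (finRotate m j))) := by
    rw [eq_comm, Function.update_eq_self_iff]
    simp [hv, Fin.contractNth, Matrix.mul_apply]
  rw [hvj, MultilinearMap.map_update_sum]
  refine Finset.sum_congr rfl fun l _ => ?_
  congr 1
  have hj1 : j.succ.succAbove j = j.castSucc := by
    apply Fin.ext; simp
  have hj2 : finRotate (m + 1) j.castSucc = j.succ := by
    have := j.isLt
    apply Fin.ext; simp only [finRotate_val, Fin.val_succ, Fin.val_castSucc]
    split_ifs <;> omega
  have hj3 : finRotate (m + 1) j.succ = j.succ.succAbove (finRotate m j) := by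
    have := j.isLt
    apply Fin.ext; simp only [finRotate_val, succAbove_val, Fin.val_succ]
    split_ifs <;> omega
  have hins : ∀ k, (Fin.insertNthEquiv (fun _ => ι) j.succ (l, i)) (j.succ.succAbove k) = i k :=
    fun k => by simp
  have hins' : (Fin.insertNthEquiv (fun _ => ι) j.succ (l, i)) j.succ = l := by simp
  funext k
  by_cases hk : k = j
  · subst hk
    rw [Fin.contractNth_apply_of_eq _ _ _ _ (by simp), Function.update_self, hj2, hj3, hins,
      hins']
    conv_lhs => rw [← hj1]
    rw [hins, hj1]
  · have hne : ((j.castSucc : Fin (m + 1)) : ℕ) ≠ k := fun e => hk (Fin.ext (by simpa using e.symm))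
    have hsa : j.castSucc.succAbove k = j.succ.succAbove k := by
      apply Fin.ext
      simp only [succAbove_val, Fin.val_succ, Fin.val_castSucc] at hne ⊢
      split_ifs <;> omega
    rw [Fin.contractNth_apply_of_ne _ _ _ _ hne, Function.update_of_ne hk, hsa,
      finRotate_succAbove j k hk, hins, hins, hv]
    simp only [Fin.contractNth_apply_of_ne _ _ _ _ hne, hsa]

theorem genTrace_hochB (q : ℕ) :
    hochB B q ∘ₗ genTrace ι B (q + 2) = genTrace ι B (q + 1) ∘ₗ hochB (Matrix ι ι B) q :=
  hochB_comm_of_contract (genTrace ι B) genTrace_contract genTrace_rotate q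

variable (ι B) in
/-- The map `HH_q(M_ι(B)) → HH_q(B)` induced by the generalized trace. -/
def HHtrace (q : ℕ) : HH (Matrix ι ι B) q →ₗ[ℂ] HH B q :=
  HHofChain (genTrace ι B) genTrace_hochB q

end GeneralizedTrace

/-! ### Algebraic differential forms and the Hochschild–Kostant–Rosenberg map -/

section Forms

/-- Algebraic `q`-forms `Ω^q` of a commutative complex algebra `B`: the `q`-th exterior power
over `B` of the Kähler differentials. -/
abbrev Forms (B : Type*) [CommRing B] [Algebra ℂ B] (q : ℕ) : Type _ := ⋀[B]^q (Ω[B⁄ℂ])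

/-- Pullback of forms `b₀ db₁ ∧ ⋯ ∧ db_q ↦ f(b₀) df(b₁) ∧ ⋯ ∧ df(b_q)`, for an algebra structure
`B → B'`. -/
def formsMapAux (B B' : Type*) [CommRing B] [Algebra ℂ B] [CommRing B'] [Algebra ℂ B']
    [Algebra B B'] [IsScalarTower ℂ B B'] (q : ℕ) : Forms B q →ₗ[B] Forms B' q :=
  exteriorPower.alternatingMapLinearEquiv
    { toFun := fun v =>
        exteriorPower.ιMulti B' q (fun i => KaehlerDifferential.map ℂ ℂ B B' (v i))
      map_update_add' := by
        intro _ v i x y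
        have h : ∀ z, (fun k => KaehlerDifferential.map ℂ ℂ B B' (Function.update v i z k)) =
            Function.update (fun k => KaehlerDifferential.map ℂ ℂ B B' (v k)) i
              (KaehlerDifferential.map ℂ ℂ B B' z) := fun z => by
          funext k; by_cases hk : k = i
          · subst hk; simp
          · simp [hk]
        simp only [h, map_add, AlternatingMap.map_update_add]
      map_update_smul' := by
        intro _ v i c x
        have h : ∀ z, (fun k => KaehlerDifferential.map ℂ ℂ B B' (Function.update v i z k)) =
            Function.update (fun k => KaehlerDifferential.map ℂ ℂ B B' (v k)) i
              (KaehlerDifferential.map ℂ ℂ B B' z) := fun z => by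
          funext k; by_cases hk : k = i
          · subst hk; simp
          · simp [hk]
        simp only [h, map_smul]
        rw [← algebraMap_smul B' c, AlternatingMap.map_update_smul, algebraMap_smul]
      map_eq_zero_of_eq' := by
        intro v i j hv hij
        exact AlternatingMap.map_eq_zero_of_eq _ _ (by simp only [hv]) hij }

/-- The map `Ω^q(f) : Ω^q(B) → Ω^q(B')` induced by an algebra morphism `f : B → B'`. -/
def formsMap {B B' : Type*} [CommRing B] [Algebra ℂ B] [CommRing B'] [Algebra ℂ B']
    (f : B →ₐ[ℂ] B') (q : ℕ) : Forms B q →ₗ[ℂ] Forms B' q :=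
  letI : Algebra B B' := f.toRingHom.toAlgebra
  haveI : IsScalarTower ℂ B B' := IsScalarTower.of_algebraMap_eq fun r => (f.commutes r).symm
  { toFun := formsMapAux B B' q
    map_add' := fun x y => map_add _ x y
    map_smul' := fun r x => by
      rw [← algebraMap_smul B r x, map_smul, ← algebraMap_smul B' (algebraMap ℂ B r),
        ← IsScalarTower.algebraMap_apply, algebraMap_smul]
      rfl }

variable (B : Type*) [CommRing B] [Algebra ℂ B]

variable {B} in
theorem D_update_succ {q : ℕ} [DecidableEq (Fin (q + 1))] (b : Fin (q + 1) → B) (i : Fin q)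
    (z : B) :
    (fun k : Fin q => KaehlerDifferential.D ℂ B (Function.update b i.succ z k.succ)) =
      Function.update (fun k : Fin q => KaehlerDifferential.D ℂ B (b k.succ)) i
        (KaehlerDifferential.D ℂ B z) := by
  funext k
  by_cases hk : k = i
  · subst hk; simp
  · rw [Function.update_of_ne hk, Function.update_of_ne (fun e => hk (Fin.succ_injective _ e))]

theorem update_succ_zero {B : Type*} {q : ℕ} [DecidableEq (Fin (q + 1))] (b : Fin (q + 1) → B) (i : Fin q)
    (z : B) : Function.update b i.succ z 0 = b 0 :=
  Function.update_of_ne (Fin.succ_ne_zero i).symm _ _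

/-- `b₀ ⊗ ⋯ ⊗ b_q ↦ b₀ db₁ ∧ ⋯ ∧ db_q`. -/
def formChain (q : ℕ) : TensorPow B (q + 1) →ₗ[ℂ] Forms B q :=
  PiTensorProduct.lift
    { toFun := fun b => b 0 • exteriorPower.ιMulti B q
        (fun i => KaehlerDifferential.D ℂ B (b i.succ))
      map_update_add' := by
        intro _ b i x y
        refine Fin.cases ?_ (fun i => ?_) i
        · simp [add_smul]
        · simp only [update_succ_zero, D_update_succ, map_add, AlternatingMap.map_update_add,
            smul_add]
      map_update_smul' := by
        intro _ b i c x
        refine Fin.cases ?_ (fun i => ?_) i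
        · simp
        · simp only [update_succ_zero, D_update_succ, Derivation.map_smul]
          rw [← algebraMap_smul B c, AlternatingMap.map_update_smul, algebraMap_smul, smul_comm] }

theorem formChain_tprod (q : ℕ) (b : Fin (q + 1) → B) :
    formChain B q (PiTensorProduct.tprod ℂ b) = b 0 • exteriorPower.ιMulti B q
        (fun i => KaehlerDifferential.D ℂ B (b i.succ)) := by
  simp [formChain]

theorem telescope {M : Type*} [AddCommGroup M] [Module ℂ M] (q : ℕ) (P : Fin (q + 1) → M) :
    P 0 + ∑ j : Fin q, (-1 : ℂ) ^ ((j : ℕ) + 1) • (P j.castSucc + P j.succ) +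
      (-1 : ℂ) ^ (q + 1) • P (Fin.last q) = 0 := by
  induction q with
  | zero => simp
  | succ q ih =>
    have := ih (fun k => P k.castSucc)
    rw [Fin.sum_univ_castSucc]
    simp only [Fin.castSucc_zero, Fin.val_castSucc, Fin.val_last, Fin.succ_last,
      Fin.succ_castSucc] at this ⊢
    rw [← sub_eq_zero, sub_zero, ← this, pow_succ (-1 : ℂ) (q + 1)]
    simp only [smul_add, mul_neg, mul_one, neg_smul]
    abel

theorem formChain_hochB (q : ℕ) : formChain B q ∘ₗ hochB B q = 0 := by
  refine PiTensorProduct.ext (MultilinearMap.ext fun a => ?_)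
  set P : Fin (q + 1) → Forms B q := fun k => (a 0 * a k.succ) • exteriorPower.ιMulti B q
    (fun i => KaehlerDifferential.D ℂ B (a (k.succAbove i).succ)) with hP
  have h0 : formChain B q (contract B (0 : Fin (q + 1)) (PiTensorProduct.tprod ℂ a)) = P 0 := by
    rw [contract_tprod, formChain_tprod, hP]
    simp [Fin.contractNth]
  have h1 : ∀ j : Fin q, formChain B q (contract B j.succ (PiTensorProduct.tprod ℂ a)) =
      P j.castSucc + P j.succ := by
    intro j
    rw [contract_tprod, formChain_tprod]
    have hz : Fin.contractNth j.succ.castSucc (· * ·) a (0 : Fin (q + 1)) = a 0 := by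
      simp [Fin.contractNth]
    rw [hz]
    set v : Fin q → Ω[B⁄ℂ] := fun i =>
      KaehlerDifferential.D ℂ B (Fin.contractNth j.succ.castSucc (· * ·) a i.succ) with hv
    have hvj : v = Function.update v j
        (a j.castSucc.succ • KaehlerDifferential.D ℂ B (a j.succ.succ) +
          a j.succ.succ • KaehlerDifferential.D ℂ B (a j.castSucc.succ)) := by
      rw [eq_comm, Function.update_eq_self_iff]
      simp [hv, Fin.contractNth]
    have hlt : ∀ i : Fin q, i ≠ j → v i =
        KaehlerDifferential.D ℂ B (a (j.castSucc.succAbove i).succ) ∧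
        j.castSucc.succAbove i = j.succ.succAbove i := by
      intro i hi
      have hne : ((j.succ.castSucc : Fin (q + 2)) : ℕ) ≠ i.succ := fun e =>
        hi (Fin.ext (by simpa using e.symm))
      refine ⟨?_, ?_⟩
      · simp only [hv]
        rw [Fin.contractNth_apply_of_ne _ _ _ _ hne]
        congr 2
        apply Fin.ext
        simp only [succAbove_val, Fin.val_succ, Fin.val_castSucc]
        split_ifs <;> omega
      · apply Fin.ext
        simp only [succAbove_val, Fin.val_succ, Fin.val_castSucc] at hne ⊢
        split_ifs <;> omega
    have hu1 : Function.update v j (KaehlerDifferential.D ℂ B (a j.succ.succ)) =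
        fun i => KaehlerDifferential.D ℂ B (a (j.castSucc.succAbove i).succ) := by
      funext i
      by_cases hi : i = j
      · subst hi
        have : i.castSucc.succAbove i = i.succ := by apply Fin.ext; simp
        rw [Function.update_self, this]
      · rw [Function.update_of_ne hi, (hlt i hi).1]
    have hu2 : Function.update v j (KaehlerDifferential.D ℂ B (a j.castSucc.succ)) =
        fun i => KaehlerDifferential.D ℂ B (a (j.succ.succAbove i).succ) := by
      funext i
      by_cases hi : i = j
      · subst hi
        have : i.succ.succAbove i = i.castSucc := by apply Fin.ext; simp
        rw [Function.update_self, this]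
      · rw [Function.update_of_ne hi, (hlt i hi).1, (hlt i hi).2]
    rw [hvj, AlternatingMap.map_update_add, AlternatingMap.map_update_smul,
      AlternatingMap.map_update_smul, hu1, hu2, smul_add, smul_smul, smul_smul]
  have h2 : formChain B q (contract B (0 : Fin (q + 1))
      (rotate B (q + 2) (PiTensorProduct.tprod ℂ a))) = P (Fin.last q) := by
    have hr0 : (finRotate (q + 2)).symm 0 = Fin.last (q + 1) := by
      rw [Equiv.symm_apply_eq, finRotate_last]
    have hr : ∀ k : Fin (q + 1), (finRotate (q + 2)).symm k.succ = k.castSucc := fun k => by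
      have := k.isLt
      rw [Equiv.symm_apply_eq]
      apply Fin.ext
      simp only [finRotate_val, Fin.val_succ, Fin.val_castSucc]
      split_ifs <;> omega
    rw [rotate_tprod, contract_tprod, formChain_tprod, hP]
    have e0 : Fin.contractNth (0 : Fin (q + 1)).castSucc (· * ·)
        (fun k => a ((finRotate (q + 2)).symm k)) 0 = a 0 * a (Fin.last q).succ := by
      rw [Fin.contractNth_apply_of_eq _ _ _ _ (by simp), Fin.castSucc_zero, hr0, hr,
        Fin.castSucc_zero, Fin.succ_last, mul_comm]
    have e1 : ∀ i : Fin q, Fin.contractNth (0 : Fin (q + 1)).castSucc (· * ·)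
        (fun k => a ((finRotate (q + 2)).symm k)) i.succ =
          a ((Fin.last q).succAbove i).succ := fun i => by
      rw [Fin.contractNth_apply_of_gt _ _ _ _ (by simp), hr, Fin.succAbove_last,
        Fin.succ_castSucc]
    simp only [e0, e1]
  have hb : hochB B q (PiTensorProduct.tprod ℂ a) =
      contract B (0 : Fin (q + 1)) (PiTensorProduct.tprod ℂ a) +
      ∑ j : Fin q, (-1 : ℂ) ^ ((j : ℕ) + 1) • contract B j.succ (PiTensorProduct.tprod ℂ a) +
      (-1 : ℂ) ^ (q + 1) • contract B (0 : Fin (q + 1))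
        (rotate B (q + 2) (PiTensorProduct.tprod ℂ a)) := by
    simp only [hochB, Fin.sum_univ_succ, LinearMap.add_apply, LinearMap.sum_apply,
      LinearMap.smul_apply, LinearMap.comp_apply]
    simp
  simp only [LinearMap.compMultilinearMap_apply, LinearMap.comp_apply, hb, map_add, map_sum,
    map_smul, h0, h1, h2]
  exact telescope q P

/-- The Hochschild–Kostant–Rosenberg map `HH_q(B) → Ω^q(B)`, induced by
`b₀ ⊗ ⋯ ⊗ b_q ↦ (1/q!) b₀ db₁ ∧ ⋯ ∧ db_q`. -/
def HKR (q : ℕ) : HH B q →ₗ[ℂ] Forms B q :=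
  Submodule.liftQ _ ((1 / (q.factorial : ℂ)) • (formChain B q ∘ₗ (cycles B q).subtype)) (by
    rintro ⟨x, hx⟩ ⟨y, hy⟩
    have := LinearMap.congr_fun (formChain_hochB B q) y
    simp only [LinearMap.comp_apply, LinearMap.zero_apply] at this
    have hy' : hochB B q y = x := hy
    simp [← hy', this])

end Forms

/-! ### A finite group acting linearly on `ℂⁿ` -/

section Action

variable {Γ : Type*} [Group Γ] {n : ℕ}

/-- The algebra `O(ℂⁿ)` of regular functions on `ℂⁿ`, carrying the action of `Γ` induced
by the linear action `ρ` of `Γ` on `ℂⁿ`. -/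
def RegFun (_ρ : Representation ℂ Γ (Fin n → ℂ)) : Type := MvPolynomial (Fin n) ℂ

variable (ρ : Representation ℂ Γ (Fin n → ℂ))

instance : CommRing (RegFun ρ) := inferInstanceAs (CommRing (MvPolynomial (Fin n) ℂ))

instance : Algebra ℂ (RegFun ρ) := inferInstanceAs (Algebra ℂ (MvPolynomial (Fin n) ℂ))

/-- The value of a regular function at a point. -/
def evalAt (x : Fin n → ℂ) : RegFun ρ →ₐ[ℂ] ℂ :=
  (MvPolynomial.aeval x : MvPolynomial (Fin n) ℂ →ₐ[ℂ] ℂ)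

variable {ρ} in
theorem RegFun.ext {f f' : RegFun ρ} (h : ∀ x, evalAt ρ x f = evalAt ρ x f') : f = f' :=
  MvPolynomial.funext fun x => by
    have := h x
    simp only [evalAt] at this
    exact this

/-- Composition of a regular function with the linear map `ρ g⁻¹`: the `i`-th coordinate function
is sent to `x ↦ (ρ g⁻¹ x) i`. -/
def actHom (g : Γ) : RegFun ρ →ₐ[ℂ] RegFun ρ :=
  (MvPolynomial.aeval (fun i : Fin n => ∑ j : Fin n,
    ρ g⁻¹ (Pi.single j 1) i • (MvPolynomial.X j : MvPolynomial (Fin n) ℂ)) :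
    MvPolynomial (Fin n) ℂ →ₐ[ℂ] MvPolynomial (Fin n) ℂ)

theorem evalAt_actHom (g : Γ) (x : Fin n → ℂ) (f : RegFun ρ) :
    evalAt ρ x (actHom ρ g f) = evalAt ρ (ρ g⁻¹ x) f := by
  have key : (evalAt ρ x).comp (actHom ρ g) = evalAt ρ (ρ g⁻¹ x) := by
    refine MvPolynomial.algHom_ext (A := ℂ) (R := ℂ) (σ := Fin n) fun i => ?_
    change MvPolynomial.aeval x (MvPolynomial.aeval _ (MvPolynomial.X i)) =
      MvPolynomial.aeval (ρ g⁻¹ x) (MvPolynomial.X i)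
    rw [MvPolynomial.aeval_X, MvPolynomial.aeval_X]
    have hx : x = ∑ j, x j • (Pi.single j 1 : Fin n → ℂ) := by
      funext k; simp [Finset.sum_apply, Pi.single_apply]
    conv_rhs => rw [hx, map_sum, Finset.sum_apply]
    simp [mul_comm]
  exact DFunLike.congr_fun key f

/-- The action `(g • f)(x) = f(g⁻¹ x)` of `Γ` on `O(ℂⁿ)`. -/
instance : MulSemiringAction Γ (RegFun ρ) where
  smul g f := actHom ρ g f
  one_smul f := RegFun.ext fun x => by
    change evalAt ρ x (actHom ρ 1 f) = _
    simp [evalAt_actHom]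
  mul_smul g h f := RegFun.ext fun x => by
    change evalAt ρ x (actHom ρ (g * h) f) = evalAt ρ x (actHom ρ g (actHom ρ h f))
    simp [evalAt_actHom]
  smul_zero g := map_zero (actHom ρ g)
  smul_add g := map_add (actHom ρ g)
  smul_one g := map_one (actHom ρ g)
  smul_mul g := map_mul (actHom ρ g)

theorem evalAt_smul (g : Γ) (x : Fin n → ℂ) (f : RegFun ρ) :
    evalAt ρ x (g • f) = evalAt ρ (ρ g⁻¹ x) f :=
  evalAt_actHom ρ g x f

instance : SMulCommClass Γ ℂ (RegFun ρ) where
  smul_comm g c f := map_smul (actHom ρ g) c f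

/-- The crossed product algebra `O(ℂⁿ) ⋊ Γ`, spanned by the products `f g` with `f ∈ O(ℂⁿ)` and
`g ∈ Γ` (written `single g f`), with `g f = (g • f) g`. -/
abbrev CrossedProduct : Type _ := SkewMonoidAlgebra (RegFun ρ) Γ

/-- The fixed point set `X^γ`. -/
def fixedPts (γ : Γ) : Set (Fin n → ℂ) := {x | ρ γ x = x}

/-- The ideal of the regular functions that vanish on `X^γ`. -/
def fixedIdeal (γ : Γ) : Ideal (RegFun ρ) :=
  (MvPolynomial.vanishingIdeal ℂ (fixedPts ρ γ) : Ideal (MvPolynomial (Fin n) ℂ))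

theorem mem_fixedIdeal {γ : Γ} {f : RegFun ρ} :
    f ∈ fixedIdeal ρ γ ↔ ∀ x ∈ fixedPts ρ γ, evalAt ρ x f = 0 := Iff.rfl

/-- The algebra `O(X^γ)` of regular functions on `X^γ`. -/
abbrev FixedFun (γ : Γ) : Type := RegFun ρ ⧸ fixedIdeal ρ γ

/-- Restriction of functions `O(X) → O(X^γ)`. -/
def res (γ : Γ) : RegFun ρ →ₐ[ℂ] FixedFun ρ γ := Ideal.Quotient.mkₐ ℂ (fixedIdeal ρ γ)

theorem res_eq_res {γ : Γ} {f f' : RegFun ρ} (h : ∀ x ∈ fixedPts ρ γ, evalAt ρ x f = evalAt ρ x f') :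
    res ρ γ f = res ρ γ f' :=
  Ideal.Quotient.eq.2 fun x hx => by
    have := h x hx
    change evalAt ρ x (f - f') = 0
    rw [map_sub, this, sub_self]

theorem fixedPts_centralizer {γ g : Γ} (hg : g ∈ Subgroup.centralizer {γ}) {x : Fin n → ℂ}
    (hx : x ∈ fixedPts ρ γ) : ρ g⁻¹ x ∈ fixedPts ρ γ := by
  have hc : γ * g⁻¹ = g⁻¹ * γ := by
    have := Subgroup.mem_centralizer_singleton_iff.1 (inv_mem hg)
    exact this.symm
  have hx' : ρ γ x = x := hx
  change ρ γ (ρ g⁻¹ x) = ρ g⁻¹ x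
  rw [← Module.End.mul_apply, ← map_mul, hc, map_mul, Module.End.mul_apply, hx']

theorem fixedPts_zpowers {γ c : Γ} (hc : c ∈ Subgroup.zpowers γ) {x : Fin n → ℂ}
    (hx : x ∈ fixedPts ρ γ) : ρ c x = x := by
  have hx' : ρ γ x = x := hx
  have hs : ∀ k : ℕ, ρ (γ ^ k) x = x := fun k => by
    induction k with
    | zero => simp
    | succ k ih => rw [pow_succ, map_mul, Module.End.mul_apply, hx', ih]
  obtain ⟨k, rfl⟩ := Subgroup.mem_zpowers_iff.1 hc
  obtain ⟨m, rfl | rfl⟩ := k.eq_nat_or_neg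
  · rw [zpow_natCast, hs]
  · conv_lhs => rw [← hs m, ← Module.End.mul_apply, ← map_mul, zpow_neg, zpow_natCast]
    simp

/-- The action `(g • f)(x) = f(g⁻¹ x)` of `g ∈ Γ_γ` on `O(X^γ)`. -/
def fixedAct (γ : Γ) (g : Subgroup.centralizer {γ}) : FixedFun ρ γ →ₐ[ℂ] FixedFun ρ γ :=
  Ideal.quotientMapₐ (fixedIdeal ρ γ) (actHom ρ (g : Γ)) fun f hf x hx => by
    exact (evalAt_actHom ρ (g : Γ) x f).trans (hf _ (fixedPts_centralizer ρ g.2 hx))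

/-- The space `Ω^q(X^γ)^{Γ_γ}` of forms on `X^γ` that are invariant under the centralizer. -/
def invForms (γ : Γ) (q : ℕ) : Submodule ℂ (Forms (FixedFun ρ γ) q) :=
  ⨅ g : Subgroup.centralizer {γ}, LinearMap.eqLocus (formsMap (fixedAct ρ γ g) q) LinearMap.id

/-- A choice of a representative in `Γ` of every coset in `Γ / C_γ`, where `C_γ` is the cyclic
subgroup generated by `γ`. -/
abbrev CosetReps (γ : Γ) : Type _ :=
  {s : Γ ⧸ Subgroup.zpowers γ → Γ // ∀ x, (QuotientGroup.mk (s x) : Γ ⧸ Subgroup.zpowers γ) = x}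

variable {ρ}

theorem CosetReps.mem {γ : Γ} (s : CosetReps γ) {g : Γ} {x y : Γ ⧸ Subgroup.zpowers γ}
    (h : g • y = x) : (s.1 x)⁻¹ * g * s.1 y ∈ Subgroup.zpowers γ := by
  rw [mul_assoc]
  refine QuotientGroup.eq.1 ?_
  rw [s.2 x, ← h]
  conv_lhs => rw [← s.2 y]
  rfl

theorem res_zpowers {γ c : Γ} (hc : c ∈ Subgroup.zpowers γ) (f : RegFun ρ) :
    res ρ γ (c • f) = res ρ γ f :=
  res_eq_res ρ fun x hx => by
    rw [evalAt_smul, fixedPts_zpowers ρ (inv_mem hc) hx]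

/-- The index set `Γ / C_γ` is finite. -/
instance fintypeCosets [Finite Γ] (γ : Γ) : Fintype (Γ ⧸ Subgroup.zpowers γ) := Fintype.ofFinite _

instance decidableEqCosets (γ : Γ) : DecidableEq (Γ ⧸ Subgroup.zpowers γ) := Classical.decEq _

variable [Finite Γ]

variable (ρ) in
/-- The diagonal matrix of the function `f`, with entry `(s(x)⁻¹ • f)|_{X^γ}` at `x ∈ Γ / C_γ`. -/
def psiFun (γ : Γ) (s : CosetReps γ) : RegFun ρ →ₐ[ℂ]
    Matrix (Γ ⧸ Subgroup.zpowers γ) (Γ ⧸ Subgroup.zpowers γ) (FixedFun ρ γ) :=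
  (Matrix.diagonalAlgHom ℂ).comp
    (AlgHom.pi fun x => (res ρ γ).comp (actHom ρ (s.1 x)⁻¹))

variable (ρ) in
/-- The monomial matrix of the group element `g`, with entry `π(s(x)⁻¹ g s(y))` at `(x, y)`
if `x = g y`, and `0` otherwise. -/
def psiGrp (γ : Γ) (s : CosetReps γ) (π : Subgroup.zpowers γ →* ℂˣ) :
    Γ →* Matrix (Γ ⧸ Subgroup.zpowers γ) (Γ ⧸ Subgroup.zpowers γ) (FixedFun ρ γ) where
  toFun g := Matrix.of fun x y =>
    if h : g • y = x then
      algebraMap ℂ (FixedFun ρ γ) (π ⟨(s.1 x)⁻¹ * g * s.1 y, s.mem h⟩ : ℂˣ)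
    else 0
  map_one' := by
    ext x y
    by_cases h : y = x
    · subst h
      have : (⟨(s.1 y)⁻¹ * 1 * s.1 y, s.mem (one_smul Γ y)⟩ : Subgroup.zpowers γ) = 1 :=
        Subtype.ext (by simp)
      rw [Matrix.of_apply, dif_pos (one_smul Γ y), this]
      simp
    · simp [h, Ne.symm h]
  map_mul' g g' := by
    ext x z
    rw [Matrix.mul_apply, Finset.sum_eq_single (g' • z)]
    · by_cases h : g • g' • z = x
      · have h' : (g * g') • z = x := by rw [mul_smul, h]
        simp only [Matrix.of_apply, h, h', dif_pos]
        rw [← map_mul, ← Units.val_mul, ← map_mul]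
        congr 4
        simp only
        group
      · have h' : ¬ (g * g') • z = x := by rwa [mul_smul]
        simp [h, h']
    · intro y _ hy
      simp [Ne.symm hy]
    · simp

theorem psiFun_eq (γ : Γ) (s : CosetReps γ) (f : RegFun ρ) :
    psiFun ρ γ s f = Matrix.diagonal fun x => res ρ γ ((s.1 x)⁻¹ • f) := rfl

theorem psiGrp_of_eq (γ : Γ) (s : CosetReps γ) (π : Subgroup.zpowers γ →* ℂˣ) {g : Γ}
    {x y : Γ ⧸ Subgroup.zpowers γ} (h : g • y = x) :
    psiGrp ρ γ s π g x y =
      algebraMap ℂ (FixedFun ρ γ) (π ⟨(s.1 x)⁻¹ * g * s.1 y, s.mem h⟩ : ℂˣ) := dif_pos h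

theorem psiGrp_of_ne (γ : Γ) (s : CosetReps γ) (π : Subgroup.zpowers γ →* ℂˣ) {g : Γ}
    {x y : Γ ⧸ Subgroup.zpowers γ} (h : ¬ g • y = x) : psiGrp ρ γ s π g x y = 0 := dif_neg h

theorem psi_comm (γ : Γ) (s : CosetReps γ) (π : Subgroup.zpowers γ →* ℂˣ) (f : RegFun ρ) (g : Γ) :
    psiFun ρ γ s (g • f) * psiGrp ρ γ s π g = psiGrp ρ γ s π g * psiFun ρ γ s f := by
  ext x y
  rw [psiFun_eq, psiFun_eq, Matrix.diagonal_mul, Matrix.mul_diagonal]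
  by_cases h : g • y = x
  · have key : res ρ γ ((s.1 x)⁻¹ • g • f) = res ρ γ ((s.1 y)⁻¹ • f) := by
      have hg : (s.1 x)⁻¹ * g = ((s.1 x)⁻¹ * g * s.1 y) * (s.1 y)⁻¹ := by group
      rw [← res_zpowers (s.mem h) ((s.1 y)⁻¹ • f), ← mul_smul, ← mul_smul, ← hg]
    rw [key, mul_comm]
  · rw [psiGrp_of_ne γ s π h, mul_zero, zero_mul]

variable (ρ) in
/-- The morphism `ψ_{γ, π} : O(X) ⋊ Γ → M_{Γ / C_γ}(O(X^γ))`. It sends `f g` to the matrix whose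
entry at `(x, y)` is `π(s(x)⁻¹ g s(y)) (s(x)⁻¹ • f)|_{X^γ}` if `x = g y`, and `0` otherwise.

It is the composition of the pullback of functions along the `Γ`-equivariant map
`Γ ×_{C_γ} X^γ → X`, `(h, x) ↦ h x` (whose source is a union of copies of `X^γ`, indexed by
`Γ / C_γ`), of the identification of the crossed product of the functions on `Γ ×_{C_γ} X^γ` by
`Γ` with `M_{Γ / C_γ}(O(X^γ) ⊗ ℂ[C_γ])`, and of the character `π` of `C_γ`. -/
def psi (γ : Γ) (s : CosetReps γ) (π : Subgroup.zpowers γ →* ℂˣ) :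
    CrossedProduct ρ →ₐ[ℂ]
      Matrix (Γ ⧸ Subgroup.zpowers γ) (Γ ⧸ Subgroup.zpowers γ) (FixedFun ρ γ) :=
  SkewMonoidAlgebra.liftNCAlgHom (psiFun ρ γ s) (psiGrp ρ γ s π)
    fun {f g} => psi_comm γ s π f g

theorem psi_single_apply (γ : Γ) (s : CosetReps γ) (π : Subgroup.zpowers γ →* ℂˣ)
    (g : Γ) (f : RegFun ρ) (x y : Γ ⧸ Subgroup.zpowers γ) :
    psi ρ γ s π (SkewMonoidAlgebra.single g f) x y =
      if h : g • y = x then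
        (π ⟨(s.1 x)⁻¹ * g * s.1 y, s.mem h⟩ : ℂ) • res ρ γ ((s.1 x)⁻¹ • f)
      else 0 := by
  have e : psi ρ γ s π (SkewMonoidAlgebra.single g f) = psiFun ρ γ s f * psiGrp ρ γ s π g :=
    SkewMonoidAlgebra.liftNC_single _ _ _ _
  rw [e, psiFun_eq, Matrix.diagonal_mul]
  by_cases h : g • y = x
  · rw [psiGrp_of_eq γ s π h, dif_pos h, Algebra.smul_def, mul_comm]
  · rw [psiGrp_of_ne γ s π h, dif_neg h, mul_zero]

instance fintypeChars (γ : Γ) : Fintype (Subgroup.zpowers γ →* ℂˣ) := Fintype.ofFinite _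

variable (ρ) in
/-- The map `φ_γ = ∑_π (conj π(γ) / #C_γ) HH_q(ψ_{γ, π}) : HH_q(O(X) ⋊ Γ) → Ω^q(X^γ)`, where `π`
runs through the characters of `C_γ`, and where `HH_q(M_m(O(X^γ)))` is identified with
`HH_q(O(X^γ))` and with `Ω^q(X^γ)` by the generalized trace and by the
Hochschild–Kostant–Rosenberg map. -/
def phi (γ : Γ) (s : CosetReps γ) (q : ℕ) :
    HH (CrossedProduct ρ) q →ₗ[ℂ] Forms (FixedFun ρ γ) q :=
  ∑ π : Subgroup.zpowers γ →* ℂˣ,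
    (conj (π ⟨γ, Subgroup.mem_zpowers γ⟩ : ℂ) / (Nat.card (Subgroup.zpowers γ) : ℂ)) •
      (HKR (FixedFun ρ γ) q ∘ₗ HHtrace (Γ ⧸ Subgroup.zpowers γ) (FixedFun ρ γ) q ∘ₗ
        HHmap (psi ρ γ s π) q)

end Action

end CrossedHH

end

open CrossedHH

/-!
Let `A = O(X) ⋊ Γ`. The theorem combines a splitting of the Hochschild complex of `A` over the
group with a Hochschild–Kostant–Rosenberg theorem for twisted coefficients.

*Splitting.* Let `E` be the algebra of the `Γ × Γ` matrices over `A`. There are two morphisms from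
`A` to `E`: the regular representation `regMat`, whose matrices have all their entries in `O(X)`,
and the corner `a ↦ a e_{1,1}`. The column `(k⁻¹)_k` and the row `(k)_k` intertwine them
(`regMat_mul_colMat`, `rowMat_mul_regMat`). Inserting the column at all places of a chain is a
homotopy (`tw_insertion`) which, after the generalized trace, shows that the chain map `regChain`
agrees with multiplication by `|Γ|` in homology (`card_smul_sub_regChain_mem`). Yet `regChain`
takes its values in the sum over `γ` of the chains of `O(X)` with coefficients in the bimodule
`O(X) γ` (`sum_inc_projChain_regChain`). Hence a Hochschild class of `A` is determined by its
components at the elements `γ`, each of which is a class of `O(X)` with coefficients in `O(X) γ`,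
and the components at conjugate elements are transported into each other by the group
(`component_conj`). In particular the component at `γ` is invariant under the centralizer of `γ`.

*Twisted Hochschild–Kostant–Rosenberg theorem.* As `γ` has finite order, it is diagonal in suitable
coordinates `x_i` of `X`, say `γ · x_i = (1 + a_i) x_i` (`exists_diagonal_coordinates`). The bar
resolution of `B = O(X)` over `B ⊗ B` is homotopy equivalent to the Koszul complex of the sequence
`1 ⊗ x_i - x_i ⊗ 1`, so that every cycle with coefficients in `B γ` is, up to a boundary, the
antisymmetrization of a cycle of the Koszul complex of the sequence `a_i x_i`
(`exists_koszul_homotopy`, `exists_eps_add_boundary`). Give the variables `x_i` and the generators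
`e_i` with `a_i ≠ 0` the weight `1`, and the others the weight `0`. A partial de Rham differential
contracts the Koszul complex onto its part of weight zero (`koszul_homotopy`, `koszul_exact_succ`).
This part only involves the coordinates of the subspace `X^γ`, and there a Koszul cycle is nothing
but a differential form on `X^γ` (`twForm_res_injective`, `twForm_res_surjective`).

*The map `φ_γ`.* On a chain with coefficients in `O(X) γ'`, the matrices in the definition of `φ_γ`
are diagonal except for the first, so the generalized trace is a sum over the cosets that are fixed
by `γ'`. The orthogonality of the characters of `C_γ` keeps those cosets for which
`s(x)⁻¹ γ' s(x) = γ` (`phiChain_inc`). Consequently `φ_γ` is, up to a nonzero scalar, the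
Hochschild–Kostant–Rosenberg map of the component at `γ` (`card_smul_phiChain`). Invariance and
injectivity of `φ` follow at once, and an invariant form on `X^γ` is the image of a multiple of
the cycle with coefficients in `O(X) γ` that lifts it (`exists_phi_eq`).
-/

noncomputable section

namespace CrossedHH

/-! ### Tensor powers by their first factor -/

section TensorPowers

variable {A : Type*} [Ring A] [Algebra ℂ A] {A' : Type*} [Ring A'] [Algebra ℂ A']

/-- `a ⊗ (a₁ ⊗ ⋯ ⊗ a_q) ↦ a ⊗ a₁ ⊗ ⋯ ⊗ a_q`. -/
def tcons (A : Type*) [Ring A] [Algebra ℂ A] (q : ℕ) :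
    A →ₗ[ℂ] TensorPow A q →ₗ[ℂ] TensorPow A (q + 1) :=
  (PiTensorProduct.lift (R := ℂ) (s := fun _ : Fin q => A)
    (E := TensorPow A (q + 1))).toLinearMap ∘ₗ
    MultilinearMap.curryLeft (PiTensorProduct.tprod ℂ (s := fun _ : Fin (q + 1) => A))

@[simp] theorem tcons_tprod {q : ℕ} (a : A) (b : Fin q → A) :
    tcons A q a (PiTensorProduct.tprod ℂ b) = PiTensorProduct.tprod ℂ (Fin.cons a b) := by
  simp [tcons]

/-- The empty tensor, a generator of the zeroth tensor power. -/
def tnil (A : Type*) [Ring A] [Algebra ℂ A] : TensorPow A 0 := PiTensorProduct.tprod ℂ Fin.elim0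

theorem tprod_zero (b : Fin 0 → A) : PiTensorProduct.tprod ℂ b = tnil A := by
  rw [tnil]; congr 1; exact Subsingleton.elim _ _

theorem tensorPow_zero_eq (w : TensorPow A 0) : ∃ c : ℂ, w = c • tnil A := by
  induction w using PiTensorProduct.induction_on with
  | smul_tprod c b => exact ⟨c, by rw [tprod_zero]⟩
  | add x y hx hy =>
    obtain ⟨c, rfl⟩ := hx
    obtain ⟨d, rfl⟩ := hy
    exact ⟨c + d, by rw [add_smul]⟩

theorem tensorPow_succ_ext {q : ℕ} {E : Type*} [AddCommMonoid E] [Module ℂ E]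
    {f g : TensorPow A (q + 1) →ₗ[ℂ] E} (h : ∀ a w, f (tcons A q a w) = g (tcons A q a w)) :
    f = g := by
  refine PiTensorProduct.ext (MultilinearMap.ext fun b => ?_)
  have := h (b 0) (PiTensorProduct.tprod ℂ (Fin.tail b))
  rwa [tcons_tprod, Fin.cons_self_tail] at this

/-- The inverse of `tcons`: `a ⊗ a₁ ⊗ ⋯ ⊗ a_q ↦ a ⊗ (a₁ ⊗ ⋯ ⊗ a_q)`. -/
def headTail (A : Type*) [Ring A] [Algebra ℂ A] (q : ℕ) :
    TensorPow A (q + 1) →ₗ[ℂ] A ⊗[ℂ] TensorPow A q :=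
  PiTensorProduct.lift (LinearMap.uncurryLeft
    { toFun := fun a => (TensorProduct.mk ℂ A (TensorPow A q) a).compMultilinearMap
        (PiTensorProduct.tprod ℂ (s := fun _ : Fin q => A))
      map_add' := fun x y => by ext; simp
      map_smul' := fun c x => by ext; simp [TensorProduct.smul_tmul'] })

@[simp] theorem headTail_tcons {q : ℕ} (a : A) (w : TensorPow A q) :
    headTail A q (tcons A q a w) = a ⊗ₜ w := by
  have : headTail A q ∘ₗ tcons A q a = TensorProduct.mk ℂ A (TensorPow A q) a := by
    refine PiTensorProduct.ext (MultilinearMap.ext fun b => ?_)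
    simp [headTail]
  exact LinearMap.congr_fun this w

/-- `a₁ ⊗ ⋯ ⊗ a_{q+1} ↦ a_{q+1} ⊗ (a₁ ⊗ ⋯ ⊗ a_q)`. -/
def lastInit (A : Type*) [Ring A] [Algebra ℂ A] (q : ℕ) :
    TensorPow A (q + 1) →ₗ[ℂ] A ⊗[ℂ] TensorPow A q :=
  headTail A q ∘ₗ rotate A (q + 1)

theorem rotate_snoc {q : ℕ} (b : Fin q → A) (a : A) :
    rotate A (q + 1) (PiTensorProduct.tprod ℂ (Fin.snoc b a : Fin (q + 1) → A)) =
      PiTensorProduct.tprod ℂ (Fin.cons a b : Fin (q + 1) → A) := by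
  rw [rotate_tprod]
  congr 1
  funext k
  obtain ⟨k, rfl⟩ := (finRotate (q + 1)).surjective k
  rw [Equiv.symm_apply_apply]
  induction k using Fin.lastCases with
  | last => simp
  | cast k =>
    have : finRotate (q + 1) k.castSucc = k.succ := by
      apply Fin.ext
      have := k.isLt
      simp only [finRotate_val, Fin.val_castSucc, Fin.val_succ]
      split_ifs <;> omega
    rw [this]; simp

theorem lastInit_snoc {q : ℕ} (b : Fin q → A) (a : A) :
    lastInit A q (PiTensorProduct.tprod ℂ (Fin.snoc b a : Fin (q + 1) → A)) =
      a ⊗ₜ PiTensorProduct.tprod ℂ b := by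
  rw [lastInit, LinearMap.comp_apply, rotate_snoc, ← tcons_tprod, headTail_tcons]

theorem lastInit_tcons_tnil (a : A) : lastInit A 0 (tcons A 0 a (tnil A)) = a ⊗ₜ tnil A := by
  rw [tnil, tcons_tprod, ← lastInit_snoc]
  congr 2
  funext k
  exact Fin.cases rfl (fun i => i.elim0) k

theorem lastInit_tcons {q : ℕ} (a : A) (w : TensorPow A (q + 1)) :
    lastInit A (q + 1) (tcons A (q + 1) a w) = (tcons A q a).lTensor A (lastInit A q w) := by
  have : lastInit A (q + 1) ∘ₗ tcons A (q + 1) a = (tcons A q a).lTensor A ∘ₗ lastInit A q := by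
    refine PiTensorProduct.ext (MultilinearMap.ext fun b => ?_)
    rw [← Fin.snoc_init_self b]
    simp only [LinearMap.compMultilinearMap_apply, LinearMap.comp_apply, tcons_tprod,
      lastInit_snoc, Fin.cons_snoc_eq_snoc_cons, LinearMap.lTensor_tmul]
  exact LinearMap.congr_fun this w

theorem contract_zero_tcons {q : ℕ} (a c : A) (w : TensorPow A q) :
    contract A (0 : Fin (q + 1)) (tcons A (q + 1) a (tcons A q c w)) = tcons A q (a * c) w := by
  have : contract A (0 : Fin (q + 1)) ∘ₗ tcons A (q + 1) a ∘ₗ tcons A q c =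
      tcons A q (a * c) := by
    refine PiTensorProduct.ext (MultilinearMap.ext fun b => ?_)
    simp only [LinearMap.compMultilinearMap_apply, LinearMap.comp_apply, tcons_tprod,
      contract_tprod]
    congr 1
    funext k
    refine Fin.cases ?_ (fun k => ?_) k
    · simp [Fin.contractNth]
    · simp [Fin.contractNth]
  exact LinearMap.congr_fun this w

theorem contract_succ_tcons {q : ℕ} (j : Fin q) (a : A) (w : TensorPow A (q + 1)) :
    contract A j.succ (tcons A (q + 1) a w) = tcons A q a (contract A j w) := by
  have : contract A j.succ ∘ₗ tcons A (q + 1) a = tcons A q a ∘ₗ contract A j := by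
    refine PiTensorProduct.ext (MultilinearMap.ext fun b => ?_)
    simp only [LinearMap.compMultilinearMap_apply, LinearMap.comp_apply, tcons_tprod,
      contract_tprod]
    congr 1
    funext k
    refine Fin.cases ?_ (fun k => ?_) k
    · simp [Fin.contractNth]
    · simp [Fin.contractNth]
  exact LinearMap.congr_fun this w

/-- The sum `∑_j (-1)^j a₁ ⊗ ⋯ ⊗ aⱼ aⱼ₊₁ ⊗ ⋯ ⊗ a_{q+1}` of the inner faces; the first sign is
positive. -/
def bPrime (A : Type*) [Ring A] [Algebra ℂ A] (q : ℕ) :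
    TensorPow A (q + 1) →ₗ[ℂ] TensorPow A q :=
  ∑ j : Fin q, (-1 : ℂ) ^ (j : ℕ) • contract A j

@[simp] theorem bPrime_zero (w : TensorPow A 1) : bPrime A 0 w = 0 := by
  simp [bPrime]

theorem bPrime_tcons {q : ℕ} (a : A) (w : TensorPow A (q + 1)) :
    bPrime A (q + 1) (tcons A (q + 1) a w) =
      contract A (0 : Fin (q + 1)) (tcons A (q + 1) a w) - tcons A q a (bPrime A q w) := by
  simp only [bPrime, Fin.sum_univ_succ, LinearMap.add_apply, LinearMap.sum_apply,
    LinearMap.smul_apply, contract_succ_tcons, map_sum, map_smul]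
  simp [pow_succ, sub_eq_add_neg]

/-- The tensor power of a linear map. -/
def tpow (f : A →ₗ[ℂ] A') (q : ℕ) : TensorPow A q →ₗ[ℂ] TensorPow A' q :=
  PiTensorProduct.map fun _ => f

@[simp] theorem tpow_tprod (f : A →ₗ[ℂ] A') {q : ℕ} (b : Fin q → A) :
    tpow f q (PiTensorProduct.tprod ℂ b) = PiTensorProduct.tprod ℂ fun k => f (b k) := by
  simp [tpow]

@[simp] theorem tpow_tcons (f : A →ₗ[ℂ] A') {q : ℕ} (a : A) (w : TensorPow A q) :
    tpow f (q + 1) (tcons A q a w) = tcons A' q (f a) (tpow f q w) := by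
  have : tpow f (q + 1) ∘ₗ tcons A q a = tcons A' q (f a) ∘ₗ tpow f q := by
    refine PiTensorProduct.ext (MultilinearMap.ext fun b => ?_)
    simp only [LinearMap.compMultilinearMap_apply, LinearMap.comp_apply, tcons_tprod, tpow_tprod]
    congr 1
    funext k
    refine Fin.cases ?_ (fun k => ?_) k <;> simp
  exact LinearMap.congr_fun this w

@[simp] theorem tpow_tnil (f : A →ₗ[ℂ] A') : tpow f 0 (tnil A) = tnil A' := by
  rw [tnil, tpow_tprod, tprod_zero]

theorem tpow_comp {A'' : Type*} [Ring A''] [Algebra ℂ A''] (g : A' →ₗ[ℂ] A'') (f : A →ₗ[ℂ] A')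
    (q : ℕ) : tpow (g ∘ₗ f) q = tpow g q ∘ₗ tpow f q :=
  PiTensorProduct.map_comp _ _

theorem tpow_id (q : ℕ) : tpow (LinearMap.id : A →ₗ[ℂ] A) q = LinearMap.id :=
  PiTensorProduct.map_id

theorem headTail_tpow (f : A →ₗ[ℂ] A') {q : ℕ} (w : TensorPow A (q + 1)) :
    headTail A' q (tpow f (q + 1) w) = TensorProduct.map f (tpow f q) (headTail A q w) := by
  have : headTail A' q ∘ₗ tpow f (q + 1) = TensorProduct.map f (tpow f q) ∘ₗ headTail A q :=
    tensorPow_succ_ext fun a w => by simp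
  exact LinearMap.congr_fun this w

theorem rotate_tpow (f : A →ₗ[ℂ] A') {q : ℕ} (w : TensorPow A q) :
    rotate A' q (tpow f q w) = tpow f q (rotate A q w) := by
  have : rotate A' q ∘ₗ tpow f q = tpow f q ∘ₗ rotate A q := by
    refine PiTensorProduct.ext (MultilinearMap.ext fun b => ?_)
    simp
  exact LinearMap.congr_fun this w

theorem lastInit_tpow (f : A →ₗ[ℂ] A') {q : ℕ} (w : TensorPow A (q + 1)) :
    lastInit A' q (tpow f (q + 1) w) = TensorProduct.map f (tpow f q) (lastInit A q w) := by
  simp only [lastInit, LinearMap.comp_apply, rotate_tpow, headTail_tpow]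

theorem bPrime_tpow (f : A →ₗ[ℂ] A') (hf : ∀ x y, f (x * y) = f x * f y) {q : ℕ}
    (w : TensorPow A (q + 1)) : bPrime A' q (tpow f (q + 1) w) = tpow f q (bPrime A q w) := by
  have : ∀ j : Fin q, contract A' j ∘ₗ tpow f (q + 1) = tpow f q ∘ₗ contract A j := fun j => by
    refine PiTensorProduct.ext (MultilinearMap.ext fun b => ?_)
    simp only [LinearMap.compMultilinearMap_apply, LinearMap.comp_apply, tpow_tprod,
      contract_tprod]
    congr 1
    exact (Fin.comp_contractNth _ _ hf _ _).symm
  simp only [bPrime, LinearMap.sum_apply, LinearMap.smul_apply, map_sum, map_smul]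
  refine Finset.sum_congr rfl fun j _ => ?_
  have := LinearMap.congr_fun (this j) w
  simp only [LinearMap.comp_apply] at this
  rw [this]

end TensorPowers

/-! ### Hochschild chains with coefficients -/

section Coefficients

variable {A : Type*} [Ring A] [Algebra ℂ A] {M : Type*} [AddCommGroup M] [Module ℂ M]
  {A' : Type*} [Ring A'] [Algebra ℂ A'] {M' : Type*} [AddCommGroup M'] [Module ℂ M']

/-- The Hochschild differential `M ⊗ A^{⊗ (q+1)} → M ⊗ A^{⊗ q}` of `A` with coefficients in `M`,
where `L a m = a m` and `R a m = m a` are the two multiplications; the axioms of a bimodule are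
not imposed. -/
def tw (L R : A →ₗ[ℂ] M →ₗ[ℂ] M) (q : ℕ) :
    M ⊗[ℂ] TensorPow A (q + 1) →ₗ[ℂ] M ⊗[ℂ] TensorPow A q :=
  TensorProduct.lift (LinearMap.lcomp ℂ _ (headTail A q) ∘ₗ
      LinearMap.rTensorHom (TensorPow A q) ∘ₗ R.flip) -
    (bPrime A q).lTensor M +
    (-1 : ℂ) ^ (q + 1) • TensorProduct.lift (LinearMap.lcomp ℂ _ (lastInit A q) ∘ₗ
      LinearMap.rTensorHom (TensorPow A q) ∘ₗ L.flip)

theorem tw_tmul (L R : A →ₗ[ℂ] M →ₗ[ℂ] M) {q : ℕ} (m : M) (w : TensorPow A (q + 1)) :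
    tw L R q (m ⊗ₜ w) = (R.flip m).rTensor _ (headTail A q w) - m ⊗ₜ bPrime A q w +
      (-1 : ℂ) ^ (q + 1) • (L.flip m).rTensor _ (lastInit A q w) := by
  simp [tw]

/-- Naturality of the Hochschild differential in the coefficients and in the algebra. -/
theorem tw_map {L R : A →ₗ[ℂ] M →ₗ[ℂ] M} {L' R' : A' →ₗ[ℂ] M' →ₗ[ℂ] M'} (u : M →ₗ[ℂ] M')
    (f : A →ₗ[ℂ] A') (hf : ∀ x y, f (x * y) = f x * f y)
    (hL : ∀ a m, u (L a m) = L' (f a) (u m)) (hR : ∀ a m, u (R a m) = R' (f a) (u m)) {q : ℕ}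
    (x : M ⊗[ℂ] TensorPow A (q + 1)) :
    tw L' R' q (TensorProduct.map u (tpow f (q + 1)) x) =
      TensorProduct.map u (tpow f q) (tw L R q x) := by
  induction x with
  | zero => simp
  | add x y hx hy => simp only [map_add, hx, hy]
  | tmul m w =>
    have key : ∀ (L : A →ₗ[ℂ] M →ₗ[ℂ] M) (L' : A' →ₗ[ℂ] M' →ₗ[ℂ] M')
        (_ : ∀ a m, u (L a m) = L' (f a) (u m)) (y : A ⊗[ℂ] TensorPow A q),
        (L'.flip (u m)).rTensor _ (TensorProduct.map f (tpow f q) y) =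
          TensorProduct.map u (tpow f q) ((L.flip m).rTensor _ y) := by
      intro L L' h y
      induction y with
      | zero => simp
      | add x y hx hy => simp only [map_add, hx, hy]
      | tmul a w => simp [h]
    rw [TensorProduct.map_tmul, tw_tmul, tw_tmul, headTail_tpow, lastInit_tpow,
      bPrime_tpow f hf, key L L' hL, key R R' hR]
    simp

/-- The identification of `A ⊗ A^{⊗ q}` with `A^{⊗ (q+1)}`. -/
def join (A : Type*) [Ring A] [Algebra ℂ A] (q : ℕ) :
    A ⊗[ℂ] TensorPow A q →ₗ[ℂ] TensorPow A (q + 1) :=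
  TensorProduct.lift (tcons A q)

@[simp] theorem join_tmul {q : ℕ} (a : A) (w : TensorPow A q) :
    join A q (a ⊗ₜ w) = tcons A q a w := by simp [join]

theorem headTail_join {q : ℕ} (x : A ⊗[ℂ] TensorPow A q) : headTail A q (join A q x) = x := by
  induction x with
  | zero => simp
  | add x y hx hy => simp only [map_add, hx, hy]
  | tmul a w => simp

theorem join_headTail {q : ℕ} (w : TensorPow A (q + 1)) : join A q (headTail A q w) = w := by
  have : join A q ∘ₗ headTail A q = LinearMap.id := tensorPow_succ_ext fun a w => by simp
  exact LinearMap.congr_fun this w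

variable (A) in
/-- The Hochschild complex of `A` is the complex with coefficients in the bimodule `A`. -/
theorem hochB_join {q : ℕ} (x : A ⊗[ℂ] TensorPow A (q + 1)) :
    hochB A q (join A (q + 1) x) =
      join A q (tw (LinearMap.mul ℂ A) (LinearMap.mul ℂ A).flip q x) := by
  induction x with
  | zero => simp
  | add x y hx hy => simp only [map_add, hx, hy]
  | tmul a w =>
    have h1 : contract A (0 : Fin (q + 1)) (tcons A (q + 1) a w) =
        join A q ((LinearMap.mul ℂ A a).rTensor _ (headTail A q w)) := by
      have : contract A (0 : Fin (q + 1)) ∘ₗ tcons A (q + 1) a =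
          join A q ∘ₗ (LinearMap.mul ℂ A a).rTensor _ ∘ₗ headTail A q :=
        tensorPow_succ_ext fun c w => by simp [contract_zero_tcons]
      exact LinearMap.congr_fun this w
    have h2 : contract A (0 : Fin (q + 1)) (rotate A (q + 2) (tcons A (q + 1) a w)) =
        join A q (((LinearMap.mul ℂ A).flip a).rTensor _ (lastInit A q w)) := by
      have : contract A (0 : Fin (q + 1)) ∘ₗ rotate A (q + 2) ∘ₗ tcons A (q + 1) a =
          join A q ∘ₗ ((LinearMap.mul ℂ A).flip a).rTensor _ ∘ₗ lastInit A q := by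
        refine PiTensorProduct.ext (MultilinearMap.ext fun b => ?_)
        rw [← Fin.snoc_init_self b]
        simp only [LinearMap.compMultilinearMap_apply, LinearMap.comp_apply, tcons_tprod,
          lastInit_snoc, Fin.cons_snoc_eq_snoc_cons, rotate_snoc, LinearMap.rTensor_tmul]
        rw [← tcons_tprod, ← tcons_tprod, contract_zero_tcons]
        simp
      exact LinearMap.congr_fun this w
    rw [join_tmul, tw_tmul]
    simp only [hochB, Fin.sum_univ_succ, LinearMap.add_apply, LinearMap.sum_apply,
      LinearMap.smul_apply, LinearMap.comp_apply, contract_succ_tcons, h1, h2, map_add, map_sub,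
      map_smul, join_tmul, LinearMap.flip_flip]
    congr 1
    simp [bPrime, map_sum, pow_succ, sub_eq_add_neg]

end Coefficients

/-! ### The homotopy given by a pair of intertwined morphisms -/

section Homotopy

variable {A : Type*} [Ring A] [Algebra ℂ A] {E : Type*} [Ring E] [Algebra ℂ E]

theorem contract_zero_join {q : ℕ} (a : A) (x : A ⊗[ℂ] TensorPow A q) :
    contract A (0 : Fin (q + 1)) (tcons A (q + 1) a (join A q x)) =
      join A q ((LinearMap.mul ℂ A a).rTensor _ x) := by
  induction x with
  | zero => simp
  | add x y hx hy => simp only [map_add, hx, hy]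
  | tmul c w => simp [contract_zero_tcons]

/-- `a₁ ⊗ ⋯ ⊗ a_q ↦ ∑_j (-1)^j α a₁ ⊗ ⋯ ⊗ α aⱼ ⊗ v ⊗ β aⱼ₊₁ ⊗ ⋯ ⊗ β a_q`, where `0 ≤ j ≤ q`. -/
def insertion (α β : A →ₗ[ℂ] E) (v : E) : (q : ℕ) → TensorPow A q →ₗ[ℂ] TensorPow E (q + 1)
  | 0 => tcons E 0 v ∘ₗ tpow β 0
  | q + 1 => tcons E (q + 1) v ∘ₗ tpow β (q + 1) -
      join E (q + 1) ∘ₗ TensorProduct.map α (insertion α β v q) ∘ₗ headTail A q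

variable {α β : A →ₗ[ℂ] E} {v w : E}

theorem insertion_zero (x : TensorPow A 0) :
    insertion α β v 0 x = tcons E 0 v (tpow β 0 x) := rfl

theorem insertion_tcons {q : ℕ} (a : A) (x : TensorPow A q) :
    insertion α β v (q + 1) (tcons A q a x) =
      tcons E (q + 1) v (tcons E q (β a) (tpow β q x)) -
        tcons E (q + 1) (α a) (insertion α β v q x) := by
  simp [insertion]

/-- The insertion of `v` anticommutes with the inner faces: since `α a * v = v * β a`, the two
products in which `v` is involved cancel between neighbouring positions of `v`. -/
theorem bPrime_insertion (hα : ∀ x y, α (x * y) = α x * α y) (hβ : ∀ x y, β (x * y) = β x * β y)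
    (hv : ∀ a, α a * v = v * β a) : ∀ (q : ℕ) (x : TensorPow A (q + 1)),
    bPrime E (q + 1) (insertion α β v (q + 1) x) = -insertion α β v q (bPrime A q x) := by
  intro q
  induction q with
  | zero =>
    refine fun x => LinearMap.congr_fun (f := bPrime E 1 ∘ₗ insertion α β v 1)
      (g := -(insertion α β v 0 ∘ₗ bPrime A 0)) (tensorPow_succ_ext fun a x => ?_) x
    simp only [LinearMap.comp_apply, LinearMap.neg_apply, insertion_tcons, insertion_zero, map_sub,
      bPrime_tcons, bPrime_zero, map_zero, contract_zero_tcons, hv]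
    simp
  | succ q ih =>
    refine fun x => LinearMap.congr_fun (f := bPrime E (q + 2) ∘ₗ insertion α β v (q + 2))
      (g := -(insertion α β v (q + 1) ∘ₗ bPrime A (q + 1))) (tensorPow_succ_ext fun a y => ?_) x
    refine LinearMap.congr_fun
      (f := bPrime E (q + 2) ∘ₗ insertion α β v (q + 2) ∘ₗ tcons A (q + 1) a)
      (g := -(insertion α β v (q + 1) ∘ₗ bPrime A (q + 1) ∘ₗ tcons A (q + 1) a))
      (tensorPow_succ_ext fun c y => ?_) y
    simp only [LinearMap.comp_apply, LinearMap.neg_apply]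
    rw [insertion_tcons, map_sub, bPrime_tcons, contract_zero_tcons, bPrime_tcons (α a), ih,
      ← tpow_tcons, bPrime_tpow β hβ, bPrime_tcons a, contract_zero_tcons,
      insertion_tcons c]
    simp only [map_sub, insertion_tcons, tpow_tcons, map_neg, contract_zero_tcons, hα, hβ, hv]
    abel

theorem headTail_insertion {q : ℕ} (x : TensorPow A (q + 1)) :
    headTail E (q + 1) (insertion α β v (q + 1) x) =
      v ⊗ₜ tpow β (q + 1) x - TensorProduct.map α (insertion α β v q) (headTail A q x) := by
  simp [insertion, headTail_join]

theorem lastInit_insertion_zero (x : TensorPow A 0) :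
    lastInit E 0 (insertion α β v 0 x) = v ⊗ₜ tpow α 0 x := by
  obtain ⟨c, rfl⟩ := tensorPow_zero_eq x
  simp [insertion_zero, lastInit_tcons_tnil]

/-- The last factor of an insertion is `v` when `v` is inserted at the end, and the image under
`β` of the last factor otherwise. -/
theorem lastInit_insertion : ∀ (q : ℕ) (x : TensorPow A (q + 1)),
    lastInit E (q + 1) (insertion α β v (q + 1) x) =
      (-1 : ℂ) ^ (q + 1) • (v ⊗ₜ[ℂ] tpow α (q + 1) x) +
        TensorProduct.map β (insertion α β v q) (lastInit A q x) := by
  have hnat : ∀ {q : ℕ} (a : A) (y : A ⊗[ℂ] TensorPow A q),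
      TensorProduct.map β (insertion α β v (q + 1)) ((tcons A q a).lTensor A y) =
        (tcons E (q + 1) v).lTensor E
          ((tcons E q (β a)).lTensor E (TensorProduct.map β (tpow β q) y)) -
        (tcons E (q + 1) (α a)).lTensor E
          (TensorProduct.map β (insertion α β v q) y) := by
    intro q a y
    induction y with
    | zero => simp
    | add x y hx hy => simp only [map_add, hx, hy]; abel
    | tmul b y => simp [insertion_tcons, TensorProduct.tmul_sub]
  intro q
  induction q with
  | zero =>
    refine fun x => LinearMap.congr_fun (f := lastInit E 1 ∘ₗ insertion α β v 1)
      (g := (-1 : ℂ) ^ 1 • (TensorProduct.mk ℂ E _ v ∘ₗ tpow α 1) +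
        TensorProduct.map β (insertion α β v 0) ∘ₗ lastInit A 0)
      (tensorPow_succ_ext fun a y => ?_) x
    obtain ⟨c, rfl⟩ := tensorPow_zero_eq y
    simp [insertion_tcons, insertion_zero, lastInit_tcons, lastInit_tcons_tnil]
    module
  | succ q ih =>
    refine fun x => LinearMap.congr_fun (f := lastInit E (q + 2) ∘ₗ insertion α β v (q + 2))
      (g := (-1 : ℂ) ^ (q + 2) • (TensorProduct.mk ℂ E _ v ∘ₗ tpow α (q + 2)) +
        TensorProduct.map β (insertion α β v (q + 1)) ∘ₗ lastInit A (q + 1))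
      (tensorPow_succ_ext fun a y => ?_) x
    simp only [LinearMap.comp_apply, LinearMap.add_apply, LinearMap.smul_apply,
      TensorProduct.mk_apply]
    rw [insertion_tcons, map_sub, lastInit_tcons, lastInit_tcons, lastInit_tcons, ih,
      lastInit_tpow, lastInit_tcons]
    rw [hnat, map_add, map_smul, LinearMap.lTensor_tmul, tpow_tcons, pow_succ _ (q + 1)]
    module

theorem tw_insertion_zero (x : A ⊗[ℂ] TensorPow A 0) :
    tw (LinearMap.mul ℂ E) (LinearMap.mul ℂ E).flip 0
        (TensorProduct.map (LinearMap.mulRight ℂ w ∘ₗ β) (insertion α β v 0) x) =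
      TensorProduct.map (LinearMap.mulRight ℂ (w * v) ∘ₗ β) (tpow β 0) x -
        TensorProduct.map (LinearMap.mulLeft ℂ v ∘ₗ LinearMap.mulRight ℂ w ∘ₗ β) (tpow α 0) x := by
  induction x with
  | zero => simp
  | add x y hx hy => simp only [map_add, hx, hy]; abel
  | tmul a x =>
    rw [TensorProduct.map_tmul, tw_tmul, lastInit_insertion_zero]
    simp [insertion_zero, mul_assoc]
    module

/-- The two chain maps `a₀ ⊗ ⋯ ⊗ a_q ↦ β(a₀) w v ⊗ β a₁ ⊗ ⋯ ⊗ β a_q` and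
`a₀ ⊗ ⋯ ⊗ a_q ↦ v β(a₀) w ⊗ α a₁ ⊗ ⋯ ⊗ α a_q` are homotopic. -/
theorem tw_insertion (hα : ∀ x y, α (x * y) = α x * α y) (hβ : ∀ x y, β (x * y) = β x * β y)
    (hv : ∀ a, α a * v = v * β a) (hw : ∀ a, w * α a = β a * w) {q : ℕ}
    (x : A ⊗[ℂ] TensorPow A (q + 1)) :
    tw (LinearMap.mul ℂ E) (LinearMap.mul ℂ E).flip (q + 1)
        (TensorProduct.map (LinearMap.mulRight ℂ w ∘ₗ β) (insertion α β v (q + 1)) x) =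
      TensorProduct.map (LinearMap.mulRight ℂ (w * v) ∘ₗ β) (tpow β (q + 1)) x -
        TensorProduct.map (LinearMap.mulLeft ℂ v ∘ₗ LinearMap.mulRight ℂ w ∘ₗ β)
          (tpow α (q + 1)) x -
        TensorProduct.map (LinearMap.mulRight ℂ w ∘ₗ β) (insertion α β v q)
          (tw (LinearMap.mul ℂ A) (LinearMap.mul ℂ A).flip q x) := by
  induction x with
  | zero => simp
  | add x y hx hy => simp only [map_add, hx, hy]; abel
  | tmul a x =>
    have h1 : ∀ y : A ⊗[ℂ] TensorPow A q,
        (LinearMap.mul ℂ E (β a * w)).rTensor _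
          (TensorProduct.map α (insertion α β v q) y) =
        TensorProduct.map (LinearMap.mulRight ℂ w ∘ₗ β) (insertion α β v q)
          ((LinearMap.mul ℂ A a).rTensor _ y) := by
      intro y
      induction y with
      | zero => simp
      | add x y hx hy => simp only [map_add, hx, hy]
      | tmul b y => simp [hβ, mul_assoc, hw]
    have h2 : ∀ y : A ⊗[ℂ] TensorPow A q,
        ((LinearMap.mul ℂ E).flip (β a * w)).rTensor _
          (TensorProduct.map β (insertion α β v q) y) =
        TensorProduct.map (LinearMap.mulRight ℂ w ∘ₗ β) (insertion α β v q)
          (((LinearMap.mul ℂ A).flip a).rTensor _ y) := by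
      intro y
      induction y with
      | zero => simp
      | add x y hx hy => simp only [map_add, hx, hy]
      | tmul b y => simp [hβ, mul_assoc]
    rw [TensorProduct.map_tmul, tw_tmul, tw_tmul, headTail_insertion, lastInit_insertion,
      bPrime_insertion hα hβ hv]
    simp only [LinearMap.flip_flip, map_sub, map_add, map_smul, LinearMap.comp_apply,
      LinearMap.mulRight_apply, h1, h2, TensorProduct.map_tmul, LinearMap.rTensor_tmul]
    simp only [smul_add, smul_smul, ← pow_add]
    have e : (-1 : ℂ) ^ (q + 1 + 1 + (q + 1)) = -1 := Odd.neg_one_pow ⟨q + 1, by ring⟩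
    rw [e, pow_succ (-1 : ℂ) (q + 1)]
    simp only [LinearMap.flip_apply, LinearMap.mul_apply', LinearMap.mulLeft_apply,
      TensorProduct.tmul_neg, mul_neg, mul_one, neg_smul, one_smul, mul_assoc]
    abel

/-- On Hochschild cycles, the two chain maps of `tw_insertion` agree up to a boundary. -/
theorem join_sub_join_mem_boundaries (hα : ∀ x y, α (x * y) = α x * α y)
    (hβ : ∀ x y, β (x * y) = β x * β y)
    (hv : ∀ a, α a * v = v * β a) (hw : ∀ a, w * α a = β a * w) {q : ℕ}
    {x : A ⊗[ℂ] TensorPow A q} (hx : join A q x ∈ cycles A q) :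
    join E q (TensorProduct.map (LinearMap.mulRight ℂ (w * v) ∘ₗ β) (tpow β q) x) -
      join E q (TensorProduct.map (LinearMap.mulLeft ℂ v ∘ₗ LinearMap.mulRight ℂ w ∘ₗ β)
        (tpow α q) x) ∈ boundaries E q := by
  refine ⟨join E (q + 1) (TensorProduct.map (LinearMap.mulRight ℂ w ∘ₗ β)
    (insertion α β v q) x), ?_⟩
  rw [hochB_join]
  cases q with
  | zero => rw [tw_insertion_zero, map_sub]
  | succ q =>
    have h : hochB A q (join A (q + 1) x) = 0 := hx
    rw [hochB_join] at h
    have h' := congrArg (headTail A q) h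
    rw [headTail_join, map_zero] at h'
    rw [tw_insertion hα hβ hv hw, h', map_zero, sub_zero, map_sub]

end Homotopy

/-! ### Hochschild chains of the crossed product -/

section MulBy

variable {B S : Type*} [CommRing B] [Algebra ℂ B] [CommRing S] [Algebra ℂ S]

/-- The multiplication of `S` by the elements of `B`, through a morphism `l : B → S`. The
`S`-valued Hochschild chains of `B` with left multiplication `mulBy l` and right multiplication
`mulBy r` have the differential `tw (mulBy l) (mulBy r)`. -/
def mulBy (l : B →ₐ[ℂ] S) : B →ₗ[ℂ] S →ₗ[ℂ] S := LinearMap.mul ℂ S ∘ₗ l.toLinearMap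

@[simp] theorem mulBy_apply (l : B →ₐ[ℂ] S) (b : B) (s : S) : mulBy l b s = l b * s := rfl

end MulBy

section Crossed

variable {Γ : Type*} [Group Γ] {n : ℕ} (ρ : Representation ℂ Γ (Fin n → ℂ))

/-- The `γ`-component `f ↦ f γ` of the crossed product. -/
def embG (γ : Γ) : RegFun ρ →ₗ[ℂ] CrossedProduct ρ where
  toFun f := SkewMonoidAlgebra.single γ f
  map_add' _ _ := SkewMonoidAlgebra.single_add _ _ _
  map_smul' _ _ := (SkewMonoidAlgebra.smul_single _ _ _).symm

/-- The coefficient of `γ` in an element of the crossed product. -/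
def coeffG (γ : Γ) : CrossedProduct ρ →ₗ[ℂ] RegFun ρ where
  toFun a := a.coeff γ
  map_add' _ _ := by rw [SkewMonoidAlgebra.coeff_add]; rfl
  map_smul' _ _ := by rw [SkewMonoidAlgebra.coeff_smul]; rfl

theorem coeffG_embG [DecidableEq Γ] (γ δ : Γ) (f : RegFun ρ) :
    coeffG ρ γ (embG ρ δ f) = if δ = γ then f else 0 := by
  change (SkewMonoidAlgebra.single δ f).coeff γ = _
  rw [SkewMonoidAlgebra.coeff_single_apply]

/-- The group element `g` of the crossed product. -/
def grp (g : Γ) : CrossedProduct ρ := embG ρ g 1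

theorem embG_mul (g h : Γ) (f f' : RegFun ρ) :
    embG ρ g f * embG ρ h f' = embG ρ (g * h) (f * g • f') :=
  SkewMonoidAlgebra.single_mul_single

theorem grp_mul_embG (g h : Γ) (f : RegFun ρ) : grp ρ g * embG ρ h f = embG ρ (g * h) (g • f) := by
  rw [grp, embG_mul, one_mul]

theorem embG_mul_grp (g h : Γ) (f : RegFun ρ) : embG ρ g f * grp ρ h = embG ρ (g * h) f := by
  rw [grp, embG_mul, smul_one, mul_one]

theorem grp_mul (g h : Γ) : grp ρ g * grp ρ h = grp ρ (g * h) := by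
  rw [grp, grp, embG_mul, smul_one, mul_one, grp]

theorem grp_one : grp ρ 1 = 1 := rfl

variable {ρ} in
theorem crossed_ext {E : Type*} [AddCommMonoid E] [Module ℂ E] {f f' : CrossedProduct ρ →ₗ[ℂ] E}
    (h : ∀ g b, f (embG ρ g b) = f' (embG ρ g b)) : f = f' := by
  have : f.toAddMonoidHom = f'.toAddMonoidHom := SkewMonoidAlgebra.addHom_ext fun g b => h g b
  exact LinearMap.ext fun x => DFunLike.congr_fun this x

/-- The projection `∑_g f_g g ↦ f_1` of the crossed product onto `O(X)`. -/
def proj : CrossedProduct ρ →ₗ[ℂ] CrossedProduct ρ := embG ρ 1 ∘ₗ coeffG ρ 1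

theorem proj_embG [DecidableEq Γ] (g : Γ) (f : RegFun ρ) :
    proj ρ (embG ρ g f) = if g = 1 then embG ρ 1 f else 0 := by
  rw [proj, LinearMap.comp_apply, coeffG_embG]
  split_ifs <;> simp

theorem proj_proj (x : CrossedProduct ρ) : proj ρ (proj ρ x) = proj ρ x := by
  classical
  rw [proj, LinearMap.comp_apply, LinearMap.comp_apply, coeffG_embG, if_pos rfl]

/-- The projection onto `O(X)` is linear over `O(X)`. -/
theorem proj_mul (x y : CrossedProduct ρ) : proj ρ (proj ρ x * y) = proj ρ x * proj ρ y := by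
  classical
  have : ∀ f, proj ρ ∘ₗ LinearMap.mulLeft ℂ (embG ρ 1 f) =
      LinearMap.mulLeft ℂ (embG ρ 1 f) ∘ₗ proj ρ := fun f => crossed_ext fun g b => by
    simp only [LinearMap.comp_apply, LinearMap.mulLeft_apply, embG_mul, proj_embG, one_mul,
      one_smul]
    split_ifs
    · rw [embG_mul]; simp
    · simp
  exact LinearMap.congr_fun (this (coeffG ρ 1 x)) y

theorem coeffG_conj (h γ : Γ) (x : CrossedProduct ρ) :
    coeffG ρ (h * γ * h⁻¹) (grp ρ h * x * grp ρ h⁻¹) = actHom ρ h (coeffG ρ γ x) := by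
  classical
  have : coeffG ρ (h * γ * h⁻¹) ∘ₗ LinearMap.mulRight ℂ (grp ρ h⁻¹) ∘ₗ
      LinearMap.mulLeft ℂ (grp ρ h) = (actHom ρ h).toLinearMap ∘ₗ coeffG ρ γ :=
    crossed_ext fun g b => by
      simp only [LinearMap.comp_apply, LinearMap.mulLeft_apply, LinearMap.mulRight_apply,
        grp_mul_embG, embG_mul_grp, coeffG_embG, AlgHom.toLinearMap_apply, mul_left_inj,
        mul_right_inj]
      split_ifs
      · rfl
      · simp
  exact LinearMap.congr_fun this x

/-- The regular representation `a ↦ ((k⁻¹ a k')_1)_{k, k'}` of the crossed product by matrices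
with entries in `O(X)`, which is regarded as a subalgebra of the crossed product. -/
def regMat : CrossedProduct ρ →ₗ[ℂ] Matrix Γ Γ (CrossedProduct ρ) where
  toFun a := Matrix.of fun k k' => proj ρ (grp ρ k⁻¹ * a * grp ρ k')
  map_add' _ _ := by ext1; simp [mul_add, add_mul]
  map_smul' _ _ := by ext1; simp

theorem regMat_apply (a : CrossedProduct ρ) (k k' : Γ) :
    regMat ρ a k k' = proj ρ (grp ρ k⁻¹ * a * grp ρ k') := rfl

variable [DecidableEq Γ]

/-- The corner `a ↦ a e_{1,1}` of the matrix algebra. -/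
def cornerMat : CrossedProduct ρ →ₗ[ℂ] Matrix Γ Γ (CrossedProduct ρ) where
  toFun a := Matrix.single 1 1 a
  map_add' _ _ := Matrix.single_add _ _ _ _
  map_smul' _ _ := (Matrix.smul_single _ _ _ _).symm

theorem cornerMat_apply (a : CrossedProduct ρ) (k k' : Γ) :
    cornerMat ρ a k k' = if 1 = k ∧ 1 = k' then a else 0 := rfl

variable [Fintype Γ]

theorem sum_embG_coeffG (x : CrossedProduct ρ) : ∑ γ, embG ρ γ (coeffG ρ γ x) = x := by
  have : ∑ γ, embG ρ γ ∘ₗ coeffG ρ γ = LinearMap.id := crossed_ext fun g b => by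
    simp only [LinearMap.sum_apply, LinearMap.comp_apply, coeffG_embG, LinearMap.id_apply]
    rw [Finset.sum_eq_single g] <;> simp +contextual [eq_comm]
  simpa using LinearMap.congr_fun this x

theorem sum_proj_mul_grp (x : CrossedProduct ρ) :
    ∑ k, proj ρ (x * grp ρ k) * grp ρ k⁻¹ = x := by
  have : ∑ k, LinearMap.mulRight ℂ (grp ρ k⁻¹) ∘ₗ proj ρ ∘ₗ LinearMap.mulRight ℂ (grp ρ k) =
      LinearMap.id := crossed_ext fun g b => by
    simp only [LinearMap.sum_apply, LinearMap.comp_apply, LinearMap.mulRight_apply,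
      embG_mul_grp, proj_embG, LinearMap.id_apply]
    rw [Finset.sum_eq_single g⁻¹]
    · simp [embG_mul_grp]
    · intro k _ hk
      rw [if_neg fun h => hk (eq_inv_of_mul_eq_one_right h), zero_mul]
    · simp
  simpa using LinearMap.congr_fun this x

theorem sum_grp_mul_proj (x : CrossedProduct ρ) :
    ∑ k, grp ρ k * proj ρ (grp ρ k⁻¹ * x) = x := by
  have : ∑ k, LinearMap.mulLeft ℂ (grp ρ k) ∘ₗ proj ρ ∘ₗ LinearMap.mulLeft ℂ (grp ρ k⁻¹) =
      LinearMap.id := crossed_ext fun g b => by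
    simp only [LinearMap.sum_apply, LinearMap.comp_apply, LinearMap.mulLeft_apply,
      grp_mul_embG, proj_embG, LinearMap.id_apply]
    rw [Finset.sum_eq_single g]
    · simp [grp_mul_embG]
    · intro k _ hk
      rw [if_neg fun h => hk (by simpa [inv_mul_eq_one] using h), mul_zero]
    · simp
  simpa using LinearMap.congr_fun this x

/-- The matrix whose first column consists of the inverses of the group elements. -/
def colMat : Matrix Γ Γ (CrossedProduct ρ) :=
  Matrix.of fun k j => if j = 1 then grp ρ k⁻¹ else 0

/-- The matrix whose first row consists of the group elements. -/
def rowMat : Matrix Γ Γ (CrossedProduct ρ) :=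
  Matrix.of fun j k => if j = 1 then grp ρ k else 0

theorem regMat_mul (a b : CrossedProduct ρ) : regMat ρ (a * b) = regMat ρ a * regMat ρ b := by
  ext1 k k''
  simp only [Matrix.mul_apply, regMat_apply, ← proj_mul]
  rw [← map_sum]
  conv_lhs => rw [← mul_assoc, ← sum_proj_mul_grp ρ (grp ρ k⁻¹ * a), Finset.sum_mul,
    Finset.sum_mul]
  simp only [mul_assoc]

theorem cornerMat_mul (a b : CrossedProduct ρ) :
    cornerMat ρ (a * b) = cornerMat ρ a * cornerMat ρ b :=
  (Matrix.single_mul_single_same _ _ _ _ _).symm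

/-- The column of the inverses of the group elements intertwines the regular representation and
the corner. -/
theorem regMat_mul_colMat (a : CrossedProduct ρ) :
    regMat ρ a * colMat ρ = colMat ρ * cornerMat ρ a := by
  ext1 k j
  simp only [Matrix.mul_apply, regMat_apply, colMat, cornerMat_apply, Matrix.of_apply]
  by_cases hj : j = 1
  · subst hj
    simp [sum_proj_mul_grp]
  · simp [hj, Ne.symm hj]

/-- The row of the group elements intertwines the corner and the regular representation. -/
theorem rowMat_mul_regMat (a : CrossedProduct ρ) :
    rowMat ρ * regMat ρ a = cornerMat ρ a * rowMat ρ := by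
  ext1 j k
  simp only [Matrix.mul_apply, regMat_apply, rowMat, cornerMat_apply, Matrix.of_apply]
  by_cases hj : j = 1
  · subst hj
    simp [mul_assoc, sum_grp_mul_proj]
  · simp [hj, Ne.symm hj]

theorem colMat_cornerMat_rowMat_apply (a : CrossedProduct ρ) (k k' : Γ) :
    (colMat ρ * (cornerMat ρ a * rowMat ρ)) k k' = grp ρ k⁻¹ * a * grp ρ k' := by
  simp [Matrix.mul_apply, rowMat, colMat, cornerMat_apply, mul_assoc, ite_and, Finset.sum_ite_eq]

/-- The product of the row and the column is `∑_k k k⁻¹ = |Γ|`, in the corner. -/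
theorem cornerMat_mul_rowMat_mul_colMat (a : CrossedProduct ρ) :
    cornerMat ρ a * (rowMat ρ * colMat ρ) = (Fintype.card Γ : ℂ) • cornerMat ρ a := by
  ext1 k k'
  rw [Matrix.mul_apply]
  simp only [cornerMat_apply, rowMat, colMat, Matrix.mul_apply, Matrix.of_apply, Matrix.smul_apply]
  by_cases hk' : k' = 1
  · subst hk'
    by_cases hk : 1 = k
    · subst hk
      rw [Finset.sum_eq_single 1] <;> simp +contextual [grp_mul, grp_one, eq_comm]
      rw [Algebra.smul_def, map_natCast, Nat.cast_comm]
    · simp [hk]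
  · simp [hk', Ne.symm hk']

end Crossed

section Crossed

variable {Γ : Type*} [Group Γ] {n : ℕ} (ρ : Representation ℂ Γ (Fin n → ℂ))

/-- The differential of the Hochschild chains of `O(X)` with coefficients in the bimodule `O(X) γ`.
This bimodule is `O(X)` with the right multiplication twisted by the action of `γ`, because
`(f γ) b = f (γ · b) γ`. -/
abbrev twAct (γ : Γ) (q : ℕ) : RegFun ρ ⊗[ℂ] TensorPow (RegFun ρ) (q + 1) →ₗ[ℂ]
    RegFun ρ ⊗[ℂ] TensorPow (RegFun ρ) q :=
  tw (mulBy (AlgHom.id ℂ (RegFun ρ))) (mulBy (actHom ρ γ)) q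

/-- The inclusion `f ⊗ b₁ ⊗ ⋯ ⊗ b_q ↦ f γ ⊗ b₁ ⊗ ⋯ ⊗ b_q` of the chains of `O(X)` with
coefficients in `O(X) γ` into the chains of the crossed product. -/
def inc (γ : Γ) (q : ℕ) :
    RegFun ρ ⊗[ℂ] TensorPow (RegFun ρ) q →ₗ[ℂ] TensorPow (CrossedProduct ρ) (q + 1) :=
  join (CrossedProduct ρ) q ∘ₗ TensorProduct.map (embG ρ γ) (tpow (embG ρ 1) q)

/-- The projection `a₀ ⊗ ⋯ ⊗ a_q ↦ (a₀)_γ ⊗ (a₁)_1 ⊗ ⋯ ⊗ (a_q)_1`. -/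
def projChain (γ : Γ) (q : ℕ) :
    TensorPow (CrossedProduct ρ) (q + 1) →ₗ[ℂ] RegFun ρ ⊗[ℂ] TensorPow (RegFun ρ) q :=
  TensorProduct.map (coeffG ρ γ) (tpow (coeffG ρ 1) q) ∘ₗ headTail (CrossedProduct ρ) q

/-- The inclusions `inc` are chain maps. -/
theorem hochB_inc (γ : Γ) {q : ℕ} (x : RegFun ρ ⊗[ℂ] TensorPow (RegFun ρ) (q + 1)) :
    hochB (CrossedProduct ρ) q (inc ρ γ (q + 1) x) = inc ρ γ q (twAct ρ γ q x) := by
  rw [inc, LinearMap.comp_apply, hochB_join, tw_map]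
  · rfl
  · intro f f'
    rw [embG_mul, one_mul, one_smul]
  · intro f m
    rw [LinearMap.mul_apply', embG_mul, one_mul, one_smul]
    rfl
  · intro f m
    rw [LinearMap.flip_apply, LinearMap.mul_apply', embG_mul, mul_one, mul_comm]
    rfl

theorem projChain_inc [DecidableEq Γ] (γ δ : Γ) {q : ℕ}
    (x : RegFun ρ ⊗[ℂ] TensorPow (RegFun ρ) q) :
    projChain ρ γ q (inc ρ δ q x) = if δ = γ then x else 0 := by
  have h1 : coeffG ρ 1 ∘ₗ embG ρ 1 = LinearMap.id := LinearMap.ext fun f => by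
    classical
    simp [coeffG_embG]
  rw [projChain, inc, LinearMap.comp_apply, LinearMap.comp_apply, headTail_join,
    ← LinearMap.comp_apply, ← TensorProduct.map_comp, ← tpow_comp, h1, tpow_id]
  split_ifs with h
  · have h2 : coeffG ρ γ ∘ₗ embG ρ δ = LinearMap.id := LinearMap.ext fun f => by
      simp [coeffG_embG, h]
    rw [h2, TensorProduct.map_id, LinearMap.id_apply]
  · have h2 : coeffG ρ γ ∘ₗ embG ρ δ = 0 := LinearMap.ext fun f => by
      simp [coeffG_embG, h]
    rw [h2, TensorProduct.map_zero_left, LinearMap.zero_apply]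

/-- The action of `h` on the chains of `O(X)`. It maps the chains with coefficients in `O(X) γ` to
those with coefficients in `O(X) h γ h⁻¹`. -/
def actChain (h : Γ) (q : ℕ) : RegFun ρ ⊗[ℂ] TensorPow (RegFun ρ) q →ₗ[ℂ]
    RegFun ρ ⊗[ℂ] TensorPow (RegFun ρ) q :=
  TensorProduct.map (actHom ρ h).toLinearMap (tpow (actHom ρ h).toLinearMap q)

variable [Fintype Γ] [DecidableEq Γ]

/-- The chain endomorphism `a₀ ⊗ ⋯ ⊗ a_q ↦
∑ k₀⁻¹ a₀ k₁ ⊗ (k₁⁻¹ a₁ k₂)_1 ⊗ ⋯ ⊗ (k_q⁻¹ a_q k₀)_1` of the Hochschild complex of the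
crossed product. -/
def regChain (q : ℕ) :
    TensorPow (CrossedProduct ρ) (q + 1) →ₗ[ℂ] TensorPow (CrossedProduct ρ) (q + 1) :=
  genTrace Γ (CrossedProduct ρ) (q + 1) ∘ₗ join (Matrix Γ Γ (CrossedProduct ρ)) q ∘ₗ
    TensorProduct.map (LinearMap.mulLeft ℂ (colMat ρ) ∘ₗ LinearMap.mulRight ℂ (rowMat ρ) ∘ₗ
      cornerMat ρ) (tpow (regMat ρ) q) ∘ₗ headTail (CrossedProduct ρ) q

theorem regChain_tprod {q : ℕ} (a : Fin (q + 1) → CrossedProduct ρ) :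
    regChain ρ q (PiTensorProduct.tprod ℂ a) = ∑ i : Fin (q + 1) → Γ,
      PiTensorProduct.tprod ℂ (Fin.cons
        (grp ρ (i 0)⁻¹ * a 0 * grp ρ (i (finRotate (q + 1) 0)))
        fun k : Fin q =>
          proj ρ (grp ρ (i k.succ)⁻¹ * a k.succ * grp ρ (i (finRotate (q + 1) k.succ)))) := by
  rw [regChain]
  simp only [LinearMap.comp_apply]
  rw [← Fin.cons_self_tail a, ← tcons_tprod, headTail_tcons, TensorProduct.map_tmul, join_tmul,
    tpow_tprod, tcons_tprod, genTrace_tprod]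
  refine Finset.sum_congr rfl fun i _ => ?_
  congr 1
  funext k
  refine Fin.cases ?_ (fun k => ?_) k
  · simp only [Fin.cons_zero, LinearMap.comp_apply, LinearMap.mulLeft_apply,
      LinearMap.mulRight_apply, colMat_cornerMat_rowMat_apply]
  · simp only [Fin.cons_succ, regMat_apply, Fin.tail]

theorem hochB_regChain {q : ℕ} (x : TensorPow (CrossedProduct ρ) (q + 2)) :
    hochB (CrossedProduct ρ) q (regChain ρ (q + 1) x) =
      regChain ρ q (hochB (CrossedProduct ρ) q x) := by
  have h := LinearMap.congr_fun (genTrace_hochB (ι := Γ) (B := CrossedProduct ρ) q)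
    (join (Matrix Γ Γ (CrossedProduct ρ)) (q + 1)
      (TensorProduct.map (LinearMap.mulLeft ℂ (colMat ρ) ∘ₗ LinearMap.mulRight ℂ (rowMat ρ) ∘ₗ
        cornerMat ρ) (tpow (regMat ρ) (q + 1)) (headTail (CrossedProduct ρ) (q + 1) x)))
  rw [LinearMap.comp_apply, LinearMap.comp_apply, hochB_join,
    tw_map (L := LinearMap.mul ℂ _) (R := (LinearMap.mul ℂ _).flip) _ _ (regMat_mul ρ)] at h
  · simp only [regChain, LinearMap.comp_apply]
    rw [h]
    conv_rhs => rw [← join_headTail x, hochB_join, headTail_join]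
  · intro a m
    simp only [LinearMap.comp_apply, LinearMap.mulLeft_apply, LinearMap.mulRight_apply,
      LinearMap.mul_apply', cornerMat_mul, ← mul_assoc, regMat_mul_colMat]
  · intro a m
    simp only [LinearMap.comp_apply, LinearMap.mulLeft_apply, LinearMap.mulRight_apply,
      LinearMap.mul_apply', LinearMap.flip_apply, cornerMat_mul, mul_assoc, rowMat_mul_regMat]

theorem genTrace_cornerMat {q : ℕ} (x : TensorPow (CrossedProduct ρ) (q + 1)) :
    genTrace Γ (CrossedProduct ρ) (q + 1) (tpow (cornerMat ρ) (q + 1) x) = x := by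
  have : genTrace Γ (CrossedProduct ρ) (q + 1) ∘ₗ tpow (cornerMat ρ) (q + 1) = LinearMap.id := by
    refine PiTensorProduct.ext (MultilinearMap.ext fun a => ?_)
    simp only [LinearMap.compMultilinearMap_apply, LinearMap.comp_apply, tpow_tprod,
      genTrace_tprod, LinearMap.id_apply, cornerMat_apply]
    rw [Finset.sum_eq_single fun _ => 1]
    · simp
    · intro i _ hi
      obtain ⟨k, hk⟩ := Function.ne_iff.1 hi
      refine MultilinearMap.map_coord_zero _ k ?_
      rw [if_neg fun h => hk h.1.symm]
    · simp
  exact LinearMap.congr_fun this x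

/-- On Hochschild cycles, the endomorphism `regChain` is multiplication by the order of the group,
up to a boundary. -/
theorem card_smul_sub_regChain_mem {q : ℕ} {x : TensorPow (CrossedProduct ρ) (q + 1)}
    (hx : x ∈ cycles (CrossedProduct ρ) q) :
    (Fintype.card Γ : ℂ) • x - regChain ρ q x ∈ boundaries (CrossedProduct ρ) q := by
  rw [← join_headTail x] at hx
  obtain ⟨y, hy⟩ := join_sub_join_mem_boundaries (regMat_mul ρ) (cornerMat_mul ρ)
    (regMat_mul_colMat ρ) (rowMat_mul_regMat ρ) hx
  refine ⟨genTrace Γ (CrossedProduct ρ) (q + 2) y, ?_⟩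
  rw [← LinearMap.comp_apply, genTrace_hochB, LinearMap.comp_apply, hy, map_sub]
  congr 1
  have h : LinearMap.mulRight ℂ (rowMat ρ * colMat ρ) ∘ₗ cornerMat ρ =
      (Fintype.card Γ : ℂ) • cornerMat ρ :=
    LinearMap.ext fun a => cornerMat_mul_rowMat_mul_colMat ρ a
  rw [h, TensorProduct.map_smul_left, LinearMap.smul_apply, map_smul, map_smul, ← headTail_tpow,
    join_headTail, genTrace_cornerMat]

/-- The values of `regChain` lie in the sum of the complexes of `O(X)` with coefficients in the
bimodules `O(X) γ`: all factors but the first are in `O(X)`. -/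
theorem sum_inc_projChain_regChain {q : ℕ} (x : TensorPow (CrossedProduct ρ) (q + 1)) :
    ∑ γ, inc ρ γ q (projChain ρ γ q (regChain ρ q x)) = regChain ρ q x := by
  have h1 : ∀ y : TensorPow (CrossedProduct ρ) (q + 1), ∑ γ, inc ρ γ q (projChain ρ γ q y) =
      join _ q ((tpow (proj ρ) q).lTensor _ (headTail _ q y)) := by
    refine fun y => LinearMap.congr_fun (f := ∑ γ, inc ρ γ q ∘ₗ projChain ρ γ q)
      (g := join _ q ∘ₗ (tpow (proj ρ) q).lTensor _ ∘ₗ headTail _ q)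
      (tensorPow_succ_ext fun a w => ?_) y |> fun h => by simpa using h
    simp only [LinearMap.sum_apply, LinearMap.comp_apply, inc, projChain, headTail_tcons,
      TensorProduct.map_tmul, LinearMap.lTensor_tmul, join_tmul]
    rw [← LinearMap.sum_apply, ← map_sum, sum_embG_coeffG, ← LinearMap.comp_apply (tpow _ q),
      ← tpow_comp]
    rfl
  rw [h1]
  refine LinearMap.congr_fun (f := join _ q ∘ₗ (tpow (proj ρ) q).lTensor _ ∘ₗ headTail _ q ∘ₗ
    regChain ρ q) (g := regChain ρ q) (PiTensorProduct.ext (MultilinearMap.ext fun a => ?_)) x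
  simp only [LinearMap.compMultilinearMap_apply, LinearMap.comp_apply, regChain_tprod, map_sum]
  refine Finset.sum_congr rfl fun i _ => ?_
  rw [← tcons_tprod, headTail_tcons, LinearMap.lTensor_tmul, join_tmul, tpow_tprod]
  simp only [proj_proj]

/-- The `γ`-component of `regChain` is a chain map. -/
theorem twAct_projChain_regChain (γ : Γ) {q : ℕ} (x : TensorPow (CrossedProduct ρ) (q + 2)) :
    twAct ρ γ q (projChain ρ γ (q + 1) (regChain ρ (q + 1) x)) =
      projChain ρ γ q (regChain ρ q (hochB (CrossedProduct ρ) q x)) := by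
  rw [← hochB_regChain]
  conv_rhs => rw [← sum_inc_projChain_regChain ρ x, map_sum, map_sum]
  simp only [hochB_inc, projChain_inc]
  simp

/-- The action of `h` maps the `γ`-component of `regChain` to its `h γ h⁻¹`-component: this is the
substitution `k ↦ k h` in the sum over the group. -/
theorem projChain_conj_regChain (h γ : Γ) {q : ℕ} (x : TensorPow (CrossedProduct ρ) (q + 1)) :
    projChain ρ (h * γ * h⁻¹) q (regChain ρ q x) =
      actChain ρ h q (projChain ρ γ q (regChain ρ q x)) := by
  refine LinearMap.congr_fun (f := projChain ρ (h * γ * h⁻¹) q ∘ₗ regChain ρ q)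
    (g := actChain ρ h q ∘ₗ projChain ρ γ q ∘ₗ regChain ρ q)
    (PiTensorProduct.ext (MultilinearMap.ext fun a => ?_)) x
  simp only [LinearMap.compMultilinearMap_apply, LinearMap.comp_apply, regChain_tprod, map_sum]
  refine Fintype.sum_equiv ((Equiv.refl _).arrowCongr (Equiv.mulRight h)) _ _ fun i => ?_
  have key : ∀ (δ k k' : Γ) (a : CrossedProduct ρ),
      coeffG ρ (h * δ * h⁻¹) (grp ρ k⁻¹ * a * grp ρ k') =
        actHom ρ h (coeffG ρ δ (grp ρ (k * h)⁻¹ * a * grp ρ (k' * h))) := by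
    intro δ k k' a
    rw [← coeffG_conj, mul_inv_rev, ← grp_mul ρ h⁻¹, ← grp_mul ρ k']
    simp only [← mul_assoc]
    rw [grp_mul, mul_inv_cancel, grp_one, one_mul, mul_assoc _ (grp ρ h), grp_mul,
      mul_inv_cancel, grp_one, mul_one]
  have key1 : ∀ (k k' : Γ) (a : CrossedProduct ρ),
      coeffG ρ 1 (grp ρ k⁻¹ * a * grp ρ k') =
        actHom ρ h (coeffG ρ 1 (grp ρ (k * h)⁻¹ * a * grp ρ (k' * h))) := by
    intro k k' a
    rw [← key, mul_one, mul_inv_cancel]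
  have hp : ∀ a : CrossedProduct ρ, coeffG ρ 1 (proj ρ a) = coeffG ρ 1 a := fun a => by
    rw [proj, LinearMap.comp_apply, coeffG_embG, if_pos rfl]
  simp only [projChain, actChain, LinearMap.comp_apply]
  rw [← tcons_tprod, ← tcons_tprod, headTail_tcons, headTail_tcons, TensorProduct.map_tmul,
    TensorProduct.map_tmul, TensorProduct.map_tmul, tpow_tprod, tpow_tprod, tpow_tprod, key]
  simp only [hp]
  exact congrArg _ (congrArg _ (funext fun k => key1 _ _ _))

end Crossed

/-! ### The Koszul complex of a polynomial algebra -/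

section Weights

variable {ι S : Type*} [CommRing S] [Algebra ℂ S]

/-- Multiplication of the monomials by scalars. -/
def scaleBy (φ : (ι →₀ ℕ) → ℂ) : MvPolynomial ι S →ₗ[S] MvPolynomial ι S :=
  (MvPolynomial.basisMonomials ι S).constr S fun s => φ s • MvPolynomial.monomial s 1

theorem scaleBy_monomial (φ : (ι →₀ ℕ) → ℂ) (s : ι →₀ ℕ) (b : S) :
    scaleBy φ (MvPolynomial.monomial s b) = φ s • MvPolynomial.monomial s b := by
  have h : MvPolynomial.monomial s b = b • (MvPolynomial.basisMonomials ι S) s := by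
    rw [MvPolynomial.coe_basisMonomials, MvPolynomial.smul_monomial, smul_eq_mul, mul_one]
  rw [h, map_smul, scaleBy, Module.Basis.constr_basis, smul_comm,
    MvPolynomial.coe_basisMonomials]

theorem scaleBy_smul (φ : (ι →₀ ℕ) → ℂ) (c : ℂ) (y : MvPolynomial ι S) :
    scaleBy φ (c • y) = c • scaleBy φ y := by
  rw [← algebraMap_smul S c, map_smul, algebraMap_smul]

variable (a : ι → ℂ)

/-- The weight of an index: `1` if its coefficient is nonzero, and `0` otherwise. -/
def wt (i : ι) : ℂ := if a i = 0 then 0 else 1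

theorem mul_inv_eq_wt (i : ι) : a i * (a i)⁻¹ = wt a i := by
  unfold wt
  split_ifs with h
  · simp [h]
  · exact mul_inv_cancel₀ h

variable [Fintype ι]

/-- The weight of the term `x^s e_{i₁} ∧ ⋯ ∧ e_{i_q}`. -/
def wtTerm {q : ℕ} (I : Fin q → ι) (s : ι →₀ ℕ) : ℂ := ∑ i, s i * wt a i + ∑ p, wt a (I p)

theorem wtTerm_eq_zero_iff {q : ℕ} {I : Fin q → ι} {s : ι →₀ ℕ} :
    wtTerm a I s = 0 ↔ (∀ i, a i ≠ 0 → s i = 0) ∧ ∀ p, a (I p) = 0 := by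
  have h : wtTerm a I s = ((∑ i, s i * (if a i = 0 then 0 else 1) +
      ∑ p, (if a (I p) = 0 then 0 else 1) : ℕ) : ℂ) := by
    simp [wtTerm, wt]
  rw [h, Nat.cast_eq_zero, Nat.add_eq_zero_iff, Finset.sum_eq_zero_iff, Finset.sum_eq_zero_iff]
  simp

/-- The terms of weight zero in the coefficient with the multi-index `I` of an element of the
Koszul complex. -/
def wtZero {q : ℕ} (I : Fin q → ι) : MvPolynomial ι S →ₗ[S] MvPolynomial ι S :=
  scaleBy fun s => if wtTerm a I s = 0 then 1 else 0

/-- Multiplication of each term of the coefficient with the multi-index `I` by its weight. -/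
def weightOp {q : ℕ} (I : Fin q → ι) (y : MvPolynomial ι S) : MvPolynomial ι S :=
  ∑ i, wt a i • (MvPolynomial.X i * MvPolynomial.pderiv i y) + (∑ p, wt a (I p)) • y

theorem weightOp_monomial {q : ℕ} (I : Fin q → ι) (s : ι →₀ ℕ) (b : S) :
    weightOp a I (MvPolynomial.monomial s b) = wtTerm a I s • MvPolynomial.monomial s b := by
  rw [weightOp, wtTerm, add_smul, Finset.sum_smul (f := fun i => (s i : ℂ) * wt a i)]
  congr 1
  refine Finset.sum_congr rfl fun i _ => ?_
  rw [MvPolynomial.X_mul_pderiv_monomial, ← Nat.cast_smul_eq_nsmul ℂ, smul_smul, mul_comm]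

end Weights

section Koszul

variable {ι : Type*} [DecidableEq ι] {S : Type*} [CommRing S] [Algebra ℂ S]

/-- The elements `∑ k_I e_{i₁} ∧ ⋯ ∧ e_{i_q}` of degree `q` of the Koszul complex, given by their
coefficients `k_I`, which are alternating in `I`: these are the values on the standard basis of an
alternating map. -/
abbrev Koszul (ι S : Type*) [CommRing S] [Algebra ℂ S] (q : ℕ) : Type _ :=
  (ι → ℂ) [⋀^Fin q]→ₗ[ℂ] S

/-- The tuple of standard basis vectors with indices `I`. -/
def stdVec {q : ℕ} (I : Fin q → ι) : Fin q → ι → ℂ := fun p => Pi.single (I p) 1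

theorem stdVec_cons {q : ℕ} (i : ι) (I : Fin q → ι) :
    stdVec (Fin.cons i I : Fin (q + 1) → ι) =
      (Fin.cons (Pi.single i 1) (stdVec I) : Fin (q + 1) → ι → ℂ) := by
  funext p
  refine Fin.cases ?_ (fun p => ?_) p <;> simp [stdVec]

theorem koszul_perm {q : ℕ} (k : Koszul ι S q) (I : Fin q → ι) (σ : Equiv.Perm (Fin q)) :
    k (stdVec (I ∘ σ)) = (Equiv.Perm.sign σ : ℤ) • k (stdVec I) := by
  rw [← Units.smul_def, ← AlternatingMap.map_perm]
  rfl

theorem koszul_snoc {q : ℕ} (k : Koszul ι S (q + 1)) (i : ι) (I : Fin q → ι) :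
    k (stdVec (Fin.snoc I i : Fin (q + 1) → ι)) =
      (-1 : ℂ) ^ q • k (stdVec (Fin.cons i I : Fin (q + 1) → ι)) := by
  have h := k.map_insertNth (Fin.last q) (Pi.single i 1) (stdVec I)
  rw [Fin.insertNth_last', Fin.val_last] at h
  have e : stdVec (Fin.snoc I i : Fin (q + 1) → ι) =
      (Fin.snoc (stdVec I) (Pi.single i 1) : Fin (q + 1) → ι → ℂ) := by
    funext p
    refine Fin.lastCases ?_ (fun p => ?_) p <;> simp [stdVec]
  rw [e, h, stdVec_cons]
  simp only [Matrix.vecCons]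
  rcases Nat.even_or_odd q with hq | hq <;>
    rw [hq.neg_one_pow, hq.neg_one_pow] <;> simp

theorem alternatingMap_sum_apply {V N α : Type*} [AddCommGroup V] [Module ℂ V] [AddCommGroup N]
    [Module ℂ N] {q : ℕ} (t : Finset α) (f : α → V [⋀^Fin q]→ₗ[ℂ] N) (v : Fin q → V) :
    (∑ i ∈ t, f i) v = ∑ i ∈ t, f i v :=
  map_sum (⟨⟨fun g : V [⋀^Fin q]→ₗ[ℂ] N => g v, rfl⟩, fun _ _ => rfl⟩ :
    V [⋀^Fin q]→ₗ[ℂ] N →+ N) f t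

variable [Fintype ι]

theorem koszul_ext {q : ℕ} {k k' : Koszul ι S q} (h : ∀ I, k (stdVec I) = k' (stdVec I)) :
    k = k' := by
  refine Module.Basis.ext_alternating (Pi.basisFun ℂ ι) fun I _ => ?_
  simp only [Pi.basisFun_apply]
  exact h I

/-- The alternating map with the values `(1 / q!) ∑_σ sgn(σ) f(I ∘ σ)` on the standard basis. -/
def altOf {q : ℕ} (f : (Fin q → ι) → S) : Koszul ι S q :=
  (1 / (q.factorial : ℂ)) • MultilinearMap.alternatization
    (∑ I : Fin q → ι, ((MultilinearMap.mkPiAlgebra ℂ (Fin q) ℂ).compLinearMap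
      fun p => LinearMap.proj (R := ℂ) (φ := fun _ : ι => ℂ) (I p)).smulRight (f I))

theorem altOf_stdVec {q : ℕ} (f : (Fin q → ι) → S) (J : Fin q → ι) :
    altOf f (stdVec J) = (1 / (q.factorial : ℂ)) •
      ∑ σ : Equiv.Perm (Fin q), (Equiv.Perm.sign σ : ℤ) • f (J ∘ σ) := by
  rw [altOf, AlternatingMap.smul_apply, MultilinearMap.alternatization_apply]
  congr 1
  refine Finset.sum_congr rfl fun σ _ => ?_
  rw [Units.smul_def]
  congr 1
  rw [MultilinearMap.domDomCongr_apply, sum_apply,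
    Finset.sum_eq_single (J ∘ σ)]
  · simp [stdVec]
  · intro I _ hI
    obtain ⟨p, hp⟩ := Function.ne_iff.1 hI
    have : ∏ p, stdVec J (σ p) (I p) = 0 :=
      Finset.prod_eq_zero (Finset.mem_univ p) (by
        exact (Pi.single_apply _ _ _).trans (if_neg hp))
    simp [this]
  · simp

theorem altOf_stdVec_of_alternating {q : ℕ} {f : (Fin q → ι) → S}
    (hf : ∀ I (σ : Equiv.Perm (Fin q)), f (I ∘ σ) = (Equiv.Perm.sign σ : ℤ) • f I)
    (J : Fin q → ι) : altOf f (stdVec J) = f J := by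
  rw [altOf_stdVec]
  have : ∀ σ : Equiv.Perm (Fin q), (Equiv.Perm.sign σ : ℤ) • f (J ∘ σ) = f J := fun σ => by
    rw [hf, smul_smul, ← Units.val_mul, ← sq, Int.units_sq]
    simp
  simp only [this, Finset.sum_const, Finset.card_univ, Fintype.card_perm, Fintype.card_fin]
  rw [← Nat.cast_smul_eq_nsmul ℂ, smul_smul, one_div_mul_cancel, one_smul]
  exact_mod_cast q.factorial_ne_zero

/-- The Koszul differential `e_{i₁} ∧ ⋯ ∧ e_{i_q} ↦ ∑_p ± u_{i_p} e_{i₁} ∧ ⋯ ∧ e_{i_q}` (with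
`e_{i_p}` omitted on the right), up to the factor `q`. -/
def koszulD (u : ι → S) (q : ℕ) : Koszul ι S (q + 1) →ₗ[ℂ] Koszul ι S q where
  toFun k := ∑ i, u i • k.curryLeft (Pi.single i 1)
  map_add' k k' := by
    simp only [AlternatingMap.curryLeft_add, LinearMap.add_apply, smul_add,
      Finset.sum_add_distrib]
  map_smul' c k := by
    simp only [AlternatingMap.curryLeft_smul, LinearMap.smul_apply, Finset.smul_sum,
      RingHom.id_apply]
    exact Finset.sum_congr rfl fun i _ => smul_comm _ _ _

theorem koszulD_apply (u : ι → S) {q : ℕ} (k : Koszul ι S (q + 1)) (v : Fin q → ι → ℂ) :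
    koszulD u q k v = ∑ i, u i * k (Fin.cons (Pi.single i 1) v : Fin (q + 1) → ι → ℂ) := by
  simp [koszulD, alternatingMap_sum_apply, Matrix.vecCons]

theorem koszulD_stdVec (u : ι → S) {q : ℕ} (k : Koszul ι S (q + 1)) (I : Fin q → ι) :
    koszulD u q k (stdVec I) =
      ∑ i, u i * k (stdVec (Fin.cons i I : Fin (q + 1) → ι)) := by
  simp only [koszulD_apply, stdVec_cons]

variable (a : ι → ℂ)

/-- The operator `∑_i a_i⁻¹ ∂_i e_i ∧ ·`, a partial de Rham differential, in which the indices
with `a_i = 0` do not contribute since `0⁻¹ = 0`. -/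
def koszulH {q : ℕ} (k : Koszul ι (MvPolynomial ι S) q) : Koszul ι (MvPolynomial ι S) (q + 1) :=
  AlternatingMap.alternatizeUncurryFin (∑ i, (LinearMap.proj (R := ℂ) (φ := fun _ : ι => ℂ)
    i).smulRight ((a i)⁻¹ • ((MvPolynomial.pderiv (R := S) i).toLinearMap.restrictScalars
      ℂ).compAlternatingMap k))

theorem koszulH_stdVec {q : ℕ} (k : Koszul ι (MvPolynomial ι S) q) (I : Fin (q + 1) → ι) :
    koszulH a k (stdVec I) = ∑ p : Fin (q + 1), (-1 : ℂ) ^ (p : ℕ) • (a (I p))⁻¹ •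
      MvPolynomial.pderiv (I p) (k (stdVec (p.removeNth I))) := by
  rw [koszulH, AlternatingMap.alternatizeUncurryFin_apply]
  refine Finset.sum_congr rfl fun p _ => ?_
  have h : ∀ x : MvPolynomial ι S, (-1 : ℤ) ^ (p : ℕ) • x = (-1 : ℂ) ^ (p : ℕ) • x := fun x => by
    rcases Nat.even_or_odd (p : ℕ) with hq | hq <;> simp [hq.neg_one_pow]
  rw [h]
  congr 1
  rw [LinearMap.sum_apply, alternatingMap_sum_apply, Finset.sum_eq_single (I p)]
  · simp [stdVec]
    rfl
  · intro i _ hi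
    simp [stdVec, hi]
  · simp

theorem koszulD_koszulH {q : ℕ} (k : Koszul ι (MvPolynomial ι S) q) (I : Fin q → ι) :
    koszulD (fun i => a i • MvPolynomial.X i) q (koszulH a k) (stdVec I) =
      ∑ i, wt a i • (MvPolynomial.X i * MvPolynomial.pderiv i (k (stdVec I))) -
      ∑ i, ∑ p : Fin q, (-1 : ℂ) ^ (p : ℕ) • (a i * (a (I p))⁻¹) • (MvPolynomial.X i *
        MvPolynomial.pderiv (I p) (k (stdVec
          ((p.succ).removeNth (Fin.cons i I : Fin (q + 1) → ι))))) := by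
  rw [koszulD_stdVec, ← Finset.sum_sub_distrib]
  refine Finset.sum_congr rfl fun i _ => ?_
  rw [koszulH_stdVec, Fin.sum_univ_succ, mul_add, sub_eq_add_neg, ← Finset.sum_neg_distrib,
    Finset.mul_sum]
  congr 1
  · rw [← mul_inv_eq_wt, mul_comm (a i)]
    simp [smul_smul]
  · refine Finset.sum_congr rfl fun p _ => ?_
    simp only [Fin.cons_succ, Fin.val_succ, pow_succ, mul_neg, mul_one, smul_mul_assoc,
      mul_smul_comm, smul_smul]
    rw [← neg_smul]
    congr 1
    ring

theorem koszul_homotopy_zero (k : Koszul ι (MvPolynomial ι S) 0) (I : Fin 0 → ι) :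
    koszulD (fun i => a i • MvPolynomial.X i) 0 (koszulH a k) (stdVec I) =
      weightOp a I (k (stdVec I)) := by
  rw [koszulD_koszulH, weightOp]
  simp

/-- Cartan formula: the anticommutator of `koszulH` and the Koszul differential of the sequence
`a_i x_i` is multiplication by the weight. -/
theorem koszul_homotopy {q : ℕ} (k : Koszul ι (MvPolynomial ι S) (q + 1)) (I : Fin (q + 1) → ι) :
    koszulD (fun i => a i • MvPolynomial.X i) (q + 1) (koszulH a k) (stdVec I) +
      koszulH a (koszulD (fun i => a i • MvPolynomial.X i) q k) (stdVec I) =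
      weightOp a I (k (stdVec I)) := by
  have hcons : ∀ (i : ι) (p : Fin (q + 1)),
      (p.succ).removeNth (Fin.cons i I : Fin (q + 2) → ι) =
        (Fin.cons i (p.removeNth I) : Fin (q + 1) → ι) := fun i p => by
    funext j
    refine Fin.cases ?_ (fun j => ?_) j <;> simp [Fin.removeNth]
  have hins : ∀ p : Fin (q + 1), k (stdVec (Fin.cons (I p) (p.removeNth I) : Fin (q + 1) → ι)) =
      (-1 : ℂ) ^ (p : ℕ) • k (stdVec I) := fun p => by
    have h := k.neg_one_pow_smul_map_insertNth p (Pi.single (I p) 1) (stdVec (p.removeNth I))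
    have e : p.insertNth (Pi.single (I p) 1) (stdVec (p.removeNth I)) = stdVec I := by
      rw [Fin.insertNth_eq_iff]
      exact ⟨rfl, rfl⟩
    rw [e] at h
    rw [stdVec_cons]
    simp only [Matrix.vecCons] at h
    rw [← h]
    rcases Nat.even_or_odd (p : ℕ) with hq | hq <;> simp [hq.neg_one_pow]
  rw [koszulD_koszulH, koszulH_stdVec, weightOp, Finset.sum_smul, sub_add_eq_add_sub,
    sub_eq_iff_eq_add, add_assoc, add_right_inj, Finset.sum_comm, ← Finset.sum_add_distrib]
  refine Finset.sum_congr rfl fun p _ => ?_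
  have hterm : ∀ (i : ι) (y : MvPolynomial ι S),
      (-1 : ℂ) ^ (p : ℕ) • (a (I p))⁻¹ • MvPolynomial.pderiv (I p)
        ((a i • MvPolynomial.X i : MvPolynomial ι S) * y) =
      (-1 : ℂ) ^ (p : ℕ) • (a i * (a (I p))⁻¹) • (MvPolynomial.X i *
        MvPolynomial.pderiv (I p) y) +
      ((-1 : ℂ) ^ (p : ℕ) * (a i * (a (I p))⁻¹)) •
        (y * MvPolynomial.pderiv (I p) (MvPolynomial.X i)) := fun i y => by
    rw [smul_mul_assoc, Derivation.map_smul_of_tower, Derivation.leibniz]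
    simp only [smul_eq_mul]
    module
  rw [koszulD_stdVec, map_sum, Finset.smul_sum, Finset.smul_sum]
  simp only [hterm, Finset.sum_add_distrib, hcons]
  rw [add_comm]
  congr 1
  rw [Finset.sum_eq_single (I p)]
  · have e : (-1 : ℂ) ^ (p : ℕ) * (-1 : ℂ) ^ (p : ℕ) = 1 := by
      rw [← mul_pow]; simp
    rw [hins, MvPolynomial.pderiv_X_self, mul_one, smul_smul, mul_right_comm, e, one_mul,
      mul_inv_eq_wt]
  · intro i _ hi
    rw [MvPolynomial.pderiv_X_of_ne hi, mul_zero, smul_zero]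
  · simp

/-- Division of all terms of nonzero weight by their weight is an inverse of `weightOp` off the
part of weight zero. -/
theorem exists_weightOp_inverse {q : ℕ} (k : Koszul ι (MvPolynomial ι S) q) :
    ∃ k' : Koszul ι (MvPolynomial ι S) q,
      (∀ I, k' (stdVec I) = scaleBy (fun s => (wtTerm a I s)⁻¹) (k (stdVec I))) ∧
      ∀ I, weightOp a I (k' (stdVec I)) = k (stdVec I) - wtZero a I (k (stdVec I)) := by
  have hperm : ∀ (I : Fin q → ι) (σ : Equiv.Perm (Fin q)), wtTerm a (I ∘ σ) = wtTerm a I := by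
    intro I σ
    funext s
    simp only [wtTerm, Function.comp_apply]
    rw [Equiv.sum_comp σ fun p => wt a (I p)]
  have h1 : ∀ I : Fin q → ι,
      altOf (fun I : Fin q → ι => scaleBy (fun s => (wtTerm a I s)⁻¹) (k (stdVec I))) (stdVec I) =
      scaleBy (fun s => (wtTerm a I s)⁻¹) (k (stdVec I)) :=
    altOf_stdVec_of_alternating fun I σ => by
      simp only [hperm, koszul_perm, map_zsmul]
  refine ⟨altOf fun I => scaleBy (fun s => (wtTerm a I s)⁻¹) (k (stdVec I)), h1, fun I => ?_⟩
  rw [h1]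
  have h2 : ∀ y : MvPolynomial ι S, weightOp a I (scaleBy (fun s => (wtTerm a I s)⁻¹) y) =
      y - wtZero a I y := by
    intro y
    induction y using MvPolynomial.induction_on' with
    | monomial s b =>
      rw [scaleBy_monomial, ← algebraMap_smul S, MvPolynomial.smul_monomial, weightOp_monomial,
        ← MvPolynomial.smul_monomial, algebraMap_smul, smul_smul, wtZero, scaleBy_monomial]
      split_ifs with h
      · simp [h]
      · rw [mul_inv_cancel₀ h]; simp
    | add x y hx hy =>
      have : ∀ x y : MvPolynomial ι S, weightOp a I (x + y) = weightOp a I x + weightOp a I y := by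
        intro x y
        simp only [weightOp, map_add, mul_add, smul_add, Finset.sum_add_distrib]
        abel
      rw [map_add, this, hx, hy, map_add]
      abel
  exact h2 _

/-- Division by the weight commutes with the Koszul differential, which preserves the weight. For
`a_i ≠ 0` the factor `x_i` replaces `e_i`; for `a_i = 0` both sides vanish. -/
theorem X_mul_scaleBy (i : ι) {q : ℕ} (I : Fin q → ι) (y : MvPolynomial ι S) :
    (a i • MvPolynomial.X i : MvPolynomial ι S) *
        scaleBy (fun s => (wtTerm a (Fin.cons i I : Fin (q + 1) → ι) s)⁻¹) y =
      scaleBy (fun s => (wtTerm a I s)⁻¹) ((a i • MvPolynomial.X i : MvPolynomial ι S) * y) := by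
  induction y using MvPolynomial.induction_on' with
  | monomial s b =>
    rw [scaleBy_monomial, smul_mul_assoc, smul_mul_assoc, scaleBy_smul, mul_smul_comm,
      MvPolynomial.X, MvPolynomial.monomial_mul, scaleBy_monomial]
    congr 3
    simp only [wtTerm, Fin.sum_univ_succ, Fin.cons_zero, Fin.cons_succ, Finsupp.add_apply,
      Nat.cast_add, add_mul, Finset.sum_add_distrib, Finsupp.single_apply]
    simp
    ring
  | add x y hx hy => simp only [map_add, mul_add, hx, hy]

/-- In degree zero, every element agrees with its part of weight zero up to a boundary. -/
theorem koszul_exact_zero (k : Koszul ι (MvPolynomial ι S) 0) :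
    ∃ k' : Koszul ι (MvPolynomial ι S) 1, ∀ I : Fin 0 → ι,
      (k - koszulD (fun i => a i • MvPolynomial.X i) 0 k' :
        Koszul ι (MvPolynomial ι S) 0) (stdVec I) = wtZero a I (k (stdVec I)) := by
  obtain ⟨k', -, h2⟩ := exists_weightOp_inverse a k
  refine ⟨koszulH a k', fun I => ?_⟩
  rw [AlternatingMap.sub_apply, koszul_homotopy_zero, h2, sub_sub_cancel]

/-- In positive degree, every cycle agrees with its part of weight zero up to a boundary. -/
theorem koszul_exact_succ {q : ℕ} (k : Koszul ι (MvPolynomial ι S) (q + 1))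
    (hk : koszulD (fun i => a i • MvPolynomial.X i) q k = 0) :
    ∃ k' : Koszul ι (MvPolynomial ι S) (q + 2), ∀ I : Fin (q + 1) → ι,
      (k - koszulD (fun i => a i • MvPolynomial.X i) (q + 1) k' :
        Koszul ι (MvPolynomial ι S) (q + 1)) (stdVec I) = wtZero a I (k (stdVec I)) := by
  obtain ⟨k', h1, h2⟩ := exists_weightOp_inverse a k
  have h0 : koszulD (fun i => a i • MvPolynomial.X i) q k' = 0 := koszul_ext fun I => by
    rw [koszulD_stdVec]
    simp only [h1, X_mul_scaleBy]
    rw [← map_sum, ← koszulD_stdVec, hk]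
    simp
  refine ⟨koszulH a k', fun I => ?_⟩
  have h3 := koszul_homotopy a k' I
  have h4 : koszulH a (0 : Koszul ι (MvPolynomial ι S) q) (stdVec I) = 0 := by
    rw [koszulH_stdVec]; simp
  rw [h0, h4, add_zero] at h3
  rw [AlternatingMap.sub_apply, h3, h2, sub_sub_cancel]

end Koszul

/-! ### From the Koszul complex to the Hochschild complex -/

section Antisymmetrization

variable {B S : Type*} [CommRing B] [Algebra ℂ B] [CommRing S] [Algebra ℂ S]
  {ι : Type*} [Fintype ι] [DecidableEq ι]

/-- The antisymmetrization map `∑_I k_I e_{i₁} ∧ ⋯ ∧ e_{i_q} ↦ ∑_I k_I ⊗ x_{i₁} ⊗ ⋯ ⊗ x_{i_q}`. -/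
def eps (x : ι → B) (q : ℕ) : Koszul ι S q →ₗ[ℂ] S ⊗[ℂ] TensorPow B q where
  toFun k := ∑ I : Fin q → ι, k (stdVec I) ⊗ₜ PiTensorProduct.tprod ℂ fun p => x (I p)
  map_add' k k' := by simp [TensorProduct.add_tmul, Finset.sum_add_distrib]
  map_smul' c k := by
    simp only [AlternatingMap.smul_apply, TensorProduct.smul_tmul', Finset.smul_sum,
      RingHom.id_apply]

theorem eps_apply (x : ι → B) {q : ℕ} (k : Koszul ι S q) :
    eps x q k = ∑ I : Fin q → ι, k (stdVec I) ⊗ₜ PiTensorProduct.tprod ℂ fun p => x (I p) := rfl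

/-- In a commutative algebra, an inner face does not see the order of the two factors that it
multiplies. -/
theorem contract_swap {q : ℕ} (j : Fin q) (b : Fin (q + 1) → B) :
    contract B j (PiTensorProduct.tprod ℂ (b ∘ Equiv.swap j.castSucc j.succ)) =
      contract B j (PiTensorProduct.tprod ℂ b) := by
  rw [contract_tprod, contract_tprod]
  congr 1
  funext k
  have hne : ∀ m : Fin (q + 1), (m : ℕ) ≠ j → (m : ℕ) ≠ j + 1 →
      Equiv.swap j.castSucc j.succ m = m := fun m h1 h2 =>
    Equiv.swap_apply_of_ne_of_ne (fun h => h1 (by simp [h])) (fun h => h2 (by simp [h]))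
  rcases lt_trichotomy (k : ℕ) j with h | h | h
  · rw [Fin.contractNth_apply_of_lt _ _ _ _ (by simpa using h),
      Fin.contractNth_apply_of_lt _ _ _ _ (by simpa using h), Function.comp_apply, hne] <;>
    simp <;> omega
  · have : k = j := Fin.ext h
    subst this
    rw [Fin.contractNth_apply_of_eq _ _ _ _ (by simp),
      Fin.contractNth_apply_of_eq _ _ _ _ (by simp)]
    simp [mul_comm]
  · rw [Fin.contractNth_apply_of_gt _ _ _ _ (by simpa using h),
      Fin.contractNth_apply_of_gt _ _ _ _ (by simpa using h), Function.comp_apply, hne] <;>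
    simp <;> omega

/-- The antisymmetrization map is a morphism from the Koszul complex to the Hochschild complex:
the inner faces cancel since `B` is commutative, and the two outer faces give the Koszul
differential. -/
theorem tw_eps (l r : B →ₐ[ℂ] S) (x : ι → B) {q : ℕ} (k : Koszul ι S (q + 1)) :
    tw (mulBy l) (mulBy r) q (eps x (q + 1) k) =
      eps x q (koszulD (fun i => r (x i) - l (x i)) q k) := by
  have h1 : ∑ I : Fin (q + 1) → ι, k (stdVec I) ⊗ₜ[ℂ]
      bPrime B q (PiTensorProduct.tprod ℂ fun p => x (I p)) = 0 := by
    simp only [bPrime, LinearMap.sum_apply, LinearMap.smul_apply, TensorProduct.tmul_sum,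
      TensorProduct.tmul_smul]
    rw [Finset.sum_comm]
    refine Finset.sum_eq_zero fun j _ => ?_
    rw [← Finset.smul_sum]
    have h : ∑ I : Fin (q + 1) → ι, k (stdVec I) ⊗ₜ[ℂ]
        contract B j (PiTensorProduct.tprod ℂ fun p => x (I p)) =
        -∑ I : Fin (q + 1) → ι, k (stdVec I) ⊗ₜ[ℂ]
          contract B j (PiTensorProduct.tprod ℂ fun p => x (I p)) := by
      rw [← Finset.sum_neg_distrib]
      refine Fintype.sum_equiv ((Equiv.swap j.castSucc j.succ).arrowCongr (Equiv.refl ι)) _ _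
        fun I => ?_
      have e : (Equiv.swap j.castSucc j.succ).arrowCongr (Equiv.refl ι) I =
          I ∘ Equiv.swap j.castSucc j.succ := by
        funext p; simp [Equiv.arrowCongr]
      have hs : Equiv.Perm.sign (Equiv.swap j.castSucc j.succ) = -1 :=
        Equiv.Perm.sign_swap (Fin.castSucc_lt_succ).ne
      have hc := contract_swap j fun p => x (I p)
      rw [e, koszul_perm, hs]
      have hc' : contract B j (PiTensorProduct.tprod ℂ fun p =>
          x ((I ∘ Equiv.swap j.castSucc j.succ) p)) =
          contract B j (PiTensorProduct.tprod ℂ fun p => x (I p)) := hc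
      rw [hc', Units.val_neg, Units.val_one, neg_smul, one_smul, TensorProduct.neg_tmul, neg_neg]
    have h2 : ∀ z : S ⊗[ℂ] TensorPow B q, z = -z → z = 0 := fun z hz => by
      have : (2 : ℂ) • z = 0 := by rw [two_smul]; exact add_eq_zero_iff_eq_neg.2 hz
      exact (smul_eq_zero.1 this).resolve_left two_ne_zero
    rw [h2 _ h, smul_zero]
  have h2 : ∑ I : Fin (q + 1) → ι, ((mulBy r).flip (k (stdVec I))).rTensor _
      (headTail B q (PiTensorProduct.tprod ℂ fun p => x (I p))) =
      ∑ J : Fin q → ι, ∑ i, (r (x i) * k (stdVec (Fin.cons i J : Fin (q + 1) → ι))) ⊗ₜ[ℂ]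
        PiTensorProduct.tprod ℂ fun p => x (J p) := by
    rw [← (Fin.consEquiv (fun _ => ι)).sum_comp, Fintype.sum_prod_type_right]
    refine Finset.sum_congr rfl fun J _ => Finset.sum_congr rfl fun i _ => ?_
    have e : (fun p => x ((Fin.cons i J : Fin (q + 1) → ι) p)) =
        Fin.cons (x i) fun p => x (J p) := by
      funext p; refine Fin.cases ?_ (fun p => ?_) p <;> simp
    change ((mulBy r).flip (k (stdVec (Fin.cons i J : Fin (q + 1) → ι)))).rTensor _
      (headTail B q (PiTensorProduct.tprod ℂ fun p => x ((Fin.cons i J : Fin (q + 1) → ι) p))) = _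
    rw [e, ← tcons_tprod, headTail_tcons]
    simp
  have h3 : ∑ I : Fin (q + 1) → ι, ((mulBy l).flip (k (stdVec I))).rTensor _
      (lastInit B q (PiTensorProduct.tprod ℂ fun p => x (I p))) =
      (-1 : ℂ) ^ q • ∑ J : Fin q → ι, ∑ i,
        (l (x i) * k (stdVec (Fin.cons i J : Fin (q + 1) → ι))) ⊗ₜ[ℂ]
          PiTensorProduct.tprod ℂ fun p => x (J p) := by
    rw [← (Fin.snocEquiv (fun _ => ι)).sum_comp, Fintype.sum_prod_type_right, Finset.smul_sum]
    refine Finset.sum_congr rfl fun J _ => ?_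
    rw [Finset.smul_sum]
    refine Finset.sum_congr rfl fun i _ => ?_
    have e : (fun p => x ((Fin.snoc J i : Fin (q + 1) → ι) p)) =
        Fin.snoc (fun p => x (J p)) (x i) := by
      funext p; refine Fin.lastCases ?_ (fun p => ?_) p <;> simp
    change ((mulBy l).flip (k (stdVec (Fin.snoc J i : Fin (q + 1) → ι)))).rTensor _
      (lastInit B q (PiTensorProduct.tprod ℂ fun p => x ((Fin.snoc J i : Fin (q + 1) → ι) p))) = _
    rw [e, lastInit_snoc, koszul_snoc]
    simp [TensorProduct.smul_tmul']
  rw [eps_apply, map_sum]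
  simp only [tw_tmul, Finset.sum_add_distrib, Finset.sum_sub_distrib, h1, h2, sub_zero,
    ← Finset.smul_sum, h3, smul_smul]
  have e : (-1 : ℂ) ^ (q + 1) * (-1 : ℂ) ^ q = -1 := by
    rw [← pow_add]; exact Odd.neg_one_pow ⟨q, by ring⟩
  rw [e, neg_one_smul, ← sub_eq_add_neg, ← Finset.sum_sub_distrib, eps_apply]
  refine Finset.sum_congr rfl fun J _ => ?_
  rw [koszulD_stdVec, ← Finset.sum_sub_distrib, TensorProduct.sum_tmul]
  simp only [sub_mul, TensorProduct.sub_tmul]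

end Antisymmetrization

/-! ### The bar resolution -/

section Bar

variable {B S : Type*} [CommRing B] [Algebra ℂ B] [CommRing S] [Algebra ℂ S]

/-- The differential is linear over `S`, as `S` is commutative. -/
theorem tw_smul (l r : B →ₐ[ℂ] S) {q : ℕ} (z : S) (X : S ⊗[ℂ] TensorPow B (q + 1)) :
    tw (mulBy l) (mulBy r) q (z • X) = z • tw (mulBy l) (mulBy r) q X := by
  induction X with
  | zero => simp
  | add x y hx hy => simp only [smul_add, map_add, hx, hy]
  | tmul s w =>
    have key : ∀ (l : B →ₐ[ℂ] S) (y : B ⊗[ℂ] TensorPow B q),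
        ((mulBy l).flip (z * s)).rTensor _ y = z • ((mulBy l).flip s).rTensor _ y := by
      intro l y
      induction y with
      | zero => simp
      | add x y hx hy => simp only [smul_add, map_add, hx, hy]
      | tmul b w => simp [TensorProduct.smul_tmul', mul_left_comm]
    rw [TensorProduct.smul_tmul', smul_eq_mul, tw_tmul, tw_tmul, key, key, smul_add, smul_sub,
      TensorProduct.smul_tmul', smul_eq_mul, smul_comm z]

/-- The contracting homotopy `(x ⊗ y) ⊗ w ↦ (x ⊗ 1) ⊗ (y ⊗ w)` of the bar resolution, where
`B ⊗ B` is identified with `S` by means of `κ`. -/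
def barH (l : B →ₐ[ℂ] S) (κ : S →ₗ[ℂ] B ⊗[ℂ] B) (q : ℕ) :
    S ⊗[ℂ] TensorPow B q →ₗ[ℂ] S ⊗[ℂ] TensorPow B (q + 1) :=
  TensorProduct.map l.toLinearMap (join B q) ∘ₗ
    (TensorProduct.assoc ℂ B B (TensorPow B q)).toLinearMap ∘ₗ κ.rTensor _

variable {l r : B →ₐ[ℂ] S} {κ : S →ₗ[ℂ] B ⊗[ℂ] B}

theorem barH_tmul (hκ : ∀ x y, κ (l x * r y) = x ⊗ₜ y) {q : ℕ} (x y : B) (w : TensorPow B q) :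
    barH l κ q ((l x * r y) ⊗ₜ w) = l x ⊗ₜ tcons B q y w := by
  simp [barH, hκ]

/-- When `κ` identifies `S` with `B ⊗ B`, the chains of `B` with coefficients in `S` form the bar
resolution of `B`, which is contracted by `barH`. -/
theorem tw_barH (hκ : ∀ x y, κ (l x * r y) = x ⊗ₜ y)
    (hspan : ∀ z, z ∈ Submodule.span ℂ (Set.range fun p : B × B => l p.1 * r p.2)) {q : ℕ}
    (X : S ⊗[ℂ] TensorPow B (q + 1)) :
    tw (mulBy l) (mulBy r) (q + 1) (barH l κ (q + 1) X) +
      barH l κ q (tw (mulBy l) (mulBy r) q X) = X := by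
  induction X with
  | zero => simp
  | add x y hx hy =>
    rw [map_add, map_add, map_add, map_add, add_add_add_comm, hx, hy]
  | tmul z w =>
    induction hspan z using Submodule.span_induction with
    | zero => simp
    | add x y _ _ hx hy =>
      rw [TensorProduct.add_tmul, map_add, map_add, map_add, map_add, add_add_add_comm, hx, hy]
    | smul c x _ hx =>
      rw [← TensorProduct.smul_tmul', map_smul, map_smul, map_smul, map_smul, ← smul_add, hx]
    | mem z hz =>
      obtain ⟨⟨x, y⟩, rfl⟩ := hz
      have h1 : ∀ Y : B ⊗[ℂ] TensorPow B q,
          barH l κ q (((mulBy r).flip (l x * r y)).rTensor _ Y) =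
            l x ⊗ₜ join B q ((LinearMap.mul ℂ B y).rTensor _ Y) := by
        intro Y
        induction Y with
        | zero => simp
        | add Y Y' hY hY' => simp only [map_add, hY, hY', TensorProduct.tmul_add]
        | tmul b w =>
          simp only [LinearMap.rTensor_tmul, LinearMap.flip_apply, mulBy_apply, join_tmul,
            LinearMap.mul_apply']
          rw [← barH_tmul hκ, map_mul]
          congr 2
          ring
      have h2 : ∀ Y : B ⊗[ℂ] TensorPow B q,
          barH l κ q (((mulBy l).flip (l x * r y)).rTensor _ Y) =
            ((mulBy l).flip (l x)).rTensor _ ((tcons B q y).lTensor _ Y) := by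
        intro Y
        induction Y with
        | zero => simp
        | add Y Y' hY hY' => simp only [map_add, hY, hY']
        | tmul b w =>
          simp only [LinearMap.rTensor_tmul, LinearMap.lTensor_tmul, LinearMap.flip_apply,
            mulBy_apply]
          rw [← map_mul, ← barH_tmul hκ, map_mul]
          congr 2
          ring
      have h3 : contract B (0 : Fin (q + 1)) (tcons B (q + 1) y w) =
          join B q ((LinearMap.mul ℂ B y).rTensor _ (headTail B q w)) := by
        conv_lhs => rw [← join_headTail w]
        exact contract_zero_join _ _
      rw [barH_tmul hκ, tw_tmul, tw_tmul, headTail_tcons, lastInit_tcons, bPrime_tcons, map_add,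
        map_sub, map_smul, barH_tmul hκ, h1, h2, h3]
      simp only [LinearMap.rTensor_tmul, LinearMap.flip_apply, mulBy_apply,
        TensorProduct.tmul_sub, pow_succ, mul_neg, mul_one, mul_comm (r y)]
      module

theorem tw_tw_zero (X : S ⊗[ℂ] TensorPow B 2) :
    tw (mulBy l) (mulBy r) 0 (tw (mulBy l) (mulBy r) 1 X) = 0 := by
  induction X with
  | zero => simp
  | add x y hx hy => rw [map_add, map_add, hx, hy, add_zero]
  | tmul z w =>
    refine LinearMap.congr_fun (f := tw (mulBy l) (mulBy r) 0 ∘ₗ tw (mulBy l) (mulBy r) 1 ∘ₗ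
      TensorProduct.mk ℂ S _ z) (g := 0) (tensorPow_succ_ext fun b w => ?_) w
    refine LinearMap.congr_fun (f := tw (mulBy l) (mulBy r) 0 ∘ₗ tw (mulBy l) (mulBy r) 1 ∘ₗ
      TensorProduct.mk ℂ S _ z ∘ₗ tcons B 1 b) (g := 0) (tensorPow_succ_ext fun c w => ?_) w
    obtain ⟨t, rfl⟩ := tensorPow_zero_eq w
    simp only [LinearMap.comp_apply, map_smul, TensorProduct.mk_apply, tw_tmul, headTail_tcons,
      lastInit_tcons, lastInit_tcons_tnil, bPrime_tcons, contract_zero_tcons, map_sub, map_add,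
      LinearMap.rTensor_tmul, LinearMap.lTensor_tmul, bPrime_zero, map_zero,
      LinearMap.flip_apply, mulBy_apply, TensorProduct.tmul_sub, TensorProduct.tmul_zero, map_mul]
    rw [LinearMap.zero_apply, show r c * (r b * z) = r b * r c * z by ring,
      show r b * (l c * z) = l c * (r b * z) by ring,
      show l b * (l c * z) = l b * l c * z by ring]
    congr 1
    module

/-- The square of the bar differential vanishes. By linearity over `S` it suffices to consider
elements in the image of the contracting homotopy, which reduces the claim to the degree below. -/
theorem tw_tw (hκ : ∀ x y, κ (l x * r y) = x ⊗ₜ y)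
    (hspan : ∀ z, z ∈ Submodule.span ℂ (Set.range fun p : B × B => l p.1 * r p.2)) :
    ∀ (q : ℕ) (X : S ⊗[ℂ] TensorPow B (q + 2)),
      tw (mulBy l) (mulBy r) q (tw (mulBy l) (mulBy r) (q + 1) X) = 0 := by
  intro q
  induction q with
  | zero => exact tw_tw_zero
  | succ q ih =>
    intro X
    induction X with
    | zero => simp
    | add x y hx hy => rw [map_add, map_add, hx, hy, add_zero]
    | tmul z w =>
      refine LinearMap.congr_fun (f := tw (mulBy l) (mulBy r) (q + 1) ∘ₗ
        tw (mulBy l) (mulBy r) (q + 2) ∘ₗ TensorProduct.mk ℂ S _ z) (g := 0)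
        (tensorPow_succ_ext fun b w => ?_) w
      have h1 : z ⊗ₜ[ℂ] tcons B (q + 2) b w = z • barH l κ (q + 2) (r b ⊗ₜ w) := by
        have := barH_tmul hκ (q := q + 2) 1 b w
        rw [map_one, one_mul] at this
        rw [this, TensorProduct.smul_tmul', smul_eq_mul, mul_one]
      rw [LinearMap.comp_apply, LinearMap.comp_apply, TensorProduct.mk_apply, h1, tw_smul, tw_smul,
        eq_sub_of_add_eq (tw_barH hκ hspan _), map_sub, eq_sub_of_add_eq (tw_barH hκ hspan _), ih,
        map_zero, sub_zero, sub_self, smul_zero, LinearMap.zero_apply]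

end Bar

/-! ### Comparison of the bar resolution with an exact Koszul complex -/

section BaseChange

variable {S S' W N N' : Type*} [CommRing S] [Algebra ℂ S] [CommRing S'] [Algebra ℂ S']
  [AddCommGroup W] [Module ℂ W] [AddCommGroup N] [Module ℂ N] [Module S N] [IsScalarTower ℂ S N]
  [AddCommGroup N'] [Module ℂ N'] [Module S' N'] [IsScalarTower ℂ S' N']

theorem liftBaseChange_map (θ : S →ₐ[ℂ] S') (Θ : N →ₗ[ℂ] N')
    (hΘ : ∀ (z : S) y, Θ (z • y) = θ z • Θ y) (f : W →ₗ[ℂ] N) (X : S ⊗[ℂ] W) :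
    (Θ ∘ₗ f).liftBaseChange S' (θ.toLinearMap.rTensor W X) = Θ (f.liftBaseChange S X) := by
  induction X with
  | zero => simp
  | add x y hx hy => simp only [map_add, hx, hy]
  | tmul z w => simp [hΘ]

/-- A linear map on a complex vector space whose values lie in the range of `D` lifts along `D`. -/
theorem exists_lift_of_mem_range (D : N →ₗ[ℂ] N') (f : W →ₗ[ℂ] N')
    (hf : ∀ w, f w ∈ LinearMap.range D) : ∃ g : W →ₗ[ℂ] N, ∀ w, D (g w) = f w := by
  obtain ⟨g, hg⟩ := Module.projective_lifting_property D.rangeRestrict (f.codRestrict _ hf)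
    D.surjective_rangeRestrict
  exact ⟨g, fun w => congrArg Subtype.val (LinearMap.congr_fun hg w)⟩

end BaseChange

section Comparison

variable {ι : Type*} [Fintype ι] [DecidableEq ι] {B S S' : Type*} [CommRing B] [Algebra ℂ B]
  [CommRing S] [Algebra ℂ S] [CommRing S'] [Algebra ℂ S']

instance koszulScalarTower {q : ℕ} : IsScalarTower ℂ S (Koszul ι S q) :=
  ⟨fun c z k => by ext v; simp⟩

/-- The element of degree `0` of the Koszul complex with coefficient `z`. -/
abbrev koszulConst (ι : Type*) (z : S) : Koszul ι S 0 := AlternatingMap.constOfIsEmpty ℂ _ _ z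

theorem koszulD_smul (u : ι → S) {q : ℕ} (z : S) (k : Koszul ι S (q + 1)) :
    koszulD u q (z • k) = z • koszulD u q k := by
  ext v
  simp only [AlternatingMap.smul_apply, koszulD_apply, smul_eq_mul, Finset.mul_sum]
  exact Finset.sum_congr rfl fun i _ => by ring

theorem eps_smul (x : ι → B) {q : ℕ} (z : S) (k : Koszul ι S q) :
    eps x q (z • k) = z • eps x q k := by
  simp only [eps_apply, AlternatingMap.smul_apply, Finset.smul_sum, TensorProduct.smul_tmul']

theorem koszulD_comp (θ : S →ₐ[ℂ] S') (u : ι → S) {q : ℕ} (k : Koszul ι S (q + 1)) :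
    koszulD (fun i => θ (u i)) q (θ.toLinearMap.compAlternatingMap k) =
      θ.toLinearMap.compAlternatingMap (koszulD u q k) := by
  ext v
  simp [koszulD_apply]

theorem eps_comp (θ : S →ₐ[ℂ] S') (x : ι → B) {q : ℕ} (k : Koszul ι S q) :
    eps x q (θ.toLinearMap.compAlternatingMap k : Koszul ι S' q) =
      θ.toLinearMap.rTensor _ (eps x q k) := by
  simp [eps_apply]

theorem eps_const (x : ι → B) (z : S) : eps x 0 (koszulConst ι z) = z ⊗ₜ tnil B := by
  rw [eps_apply, Fintype.sum_unique, tprod_zero]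
  rfl

/-- An `S`-linear comparison morphism from the bar resolution to the Koszul complex, over the
identity in degree `0`, exists as soon as the Koszul complex is exact. -/
theorem exists_comparison (l r : B →ₐ[ℂ] S) (u : ι → S)
    (htw : ∀ (q : ℕ) (X : S ⊗[ℂ] TensorPow B (q + 2)),
      tw (mulBy l) (mulBy r) q (tw (mulBy l) (mulBy r) (q + 1) X) = 0)
    (h0 : ∀ z b, koszulConst ι (z * (r b - l b)) ∈ LinearMap.range (koszulD u 0))
    (hs : ∀ q (k : Koszul ι S (q + 1)), koszulD u q k = 0 →
      k ∈ LinearMap.range (koszulD u (q + 1))) :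
    ∃ g : ∀ q, TensorPow B q →ₗ[ℂ] Koszul ι S q, g 0 (tnil B) = koszulConst ι 1 ∧
      ∀ q (w : TensorPow B (q + 1)), koszulD u q (g (q + 1) w) =
        (g q).liftBaseChange S (tw (mulBy l) (mulBy r) q (1 ⊗ₜ w)) := by
  -- The morphism extends to the next degree if `g` maps boundaries to boundaries.
  let P : ∀ q, (TensorPow B q →ₗ[ℂ] Koszul ι S q) → Prop := fun q g =>
    ∀ X : S ⊗[ℂ] TensorPow B (q + 1),
      g.liftBaseChange S (tw (mulBy l) (mulBy r) q X) ∈ LinearMap.range (koszulD u q)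
  have step : ∀ q (g : {g // P q g}), ∃ g' : {g' // P (q + 1) g'},
      ∀ w, koszulD u q (g'.1 w) = g.1.liftBaseChange S (tw (mulBy l) (mulBy r) q (1 ⊗ₜ w)) := by
    rintro q ⟨g, hg⟩
    obtain ⟨g', hg'⟩ := exists_lift_of_mem_range (koszulD u q)
      ((g.liftBaseChange S).restrictScalars ℂ ∘ₗ tw (mulBy l) (mulBy r) q ∘ₗ
        TensorProduct.mk ℂ S _ 1) fun w => hg _
    have hext : ∀ X, koszulD u q (g'.liftBaseChange S X) =
        g.liftBaseChange S (tw (mulBy l) (mulBy r) q X) := by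
      intro X
      induction X with
      | zero => simp
      | add x y hx hy => simp only [map_add, hx, hy]
      | tmul z w =>
        rw [LinearMap.liftBaseChange_tmul, koszulD_smul, hg']
        simp only [LinearMap.comp_apply, LinearMap.restrictScalars_apply, TensorProduct.mk_apply]
        rw [← map_smul, ← tw_smul, TensorProduct.smul_tmul', smul_eq_mul, mul_one]
    refine ⟨⟨g', fun X => hs q _ ?_⟩, hg'⟩
    rw [hext, htw, map_zero]
  choose next hnext using step
  let c : TensorPow B 0 →ₗ[ℂ] ℂ :=
    (PiTensorProduct.isEmptyEquiv (Fin 0)).toLinearMap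
  have hc : c (tnil B) = 1 := by
    simp only [c, ← tprod_zero (A := B) Fin.elim0]
    simp
  let g0 : TensorPow B 0 →ₗ[ℂ] Koszul ι S 0 := c.smulRight (koszulConst ι 1)
  have hP0 : P 0 g0 := by
    intro X
    induction X with
    | zero => rw [map_zero, map_zero]; exact zero_mem _
    | add x y hx hy => rw [map_add, map_add]; exact add_mem hx hy
    | tmul z w =>
      suffices h : ∀ b (t : TensorPow B 0), g0.liftBaseChange S
          (tw (mulBy l) (mulBy r) 0 (z ⊗ₜ tcons B 0 b t)) ∈ LinearMap.range (koszulD u 0) by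
        have e : (Submodule.mkQ (LinearMap.range (koszulD u 0))) ∘ₗ
          (g0.liftBaseChange S).restrictScalars ℂ ∘ₗ tw (mulBy l) (mulBy r) 0 ∘ₗ
            TensorProduct.mk ℂ S _ z = 0 :=
          tensorPow_succ_ext fun b t => (Submodule.Quotient.mk_eq_zero _).2 (h b t)
        exact (Submodule.Quotient.mk_eq_zero _).1 (LinearMap.congr_fun e w)
      intro b t
      obtain ⟨t, rfl⟩ := tensorPow_zero_eq t
      convert Submodule.smul_mem _ t (h0 z b) using 1
      rw [map_smul, TensorProduct.tmul_smul, map_smul, ← algebraMap_smul S t, map_smul,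
        algebraMap_smul]
      congr 1
      have key : tw (mulBy l) (mulBy r) 0 (z ⊗ₜ tcons B 0 b (tnil B)) =
          (z * (r b - l b)) ⊗ₜ tnil B := by
        rw [tw_tmul, headTail_tcons, lastInit_tcons_tnil, bPrime_zero, mul_sub,
          TensorProduct.sub_tmul, mul_comm z, mul_comm z]
        simp only [LinearMap.rTensor_tmul, LinearMap.flip_apply, mulBy_apply, zero_add, pow_one,
          TensorProduct.tmul_zero, sub_zero]
        module
      rw [key, LinearMap.liftBaseChange_tmul]
      ext v
      simp [g0, hc]
  let G : ∀ q, {g // P q g} := fun q => Nat.rec ⟨g0, hP0⟩ (fun q g => next q g) q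
  refine ⟨fun q => (G q).1, ?_, fun q w => hnext q (G q) w⟩
  change g0 (tnil B) = _
  simp [g0, hc]

/-- The comparison morphism `g` from the bar resolution to an exact Koszul complex, followed by
antisymmetrization, is homotopic to the identity, by an `S`-linear homotopy `h`. By linearity over
`S` the identities need only be recorded on the elements `1 ⊗ w`. -/
theorem exists_koszul_homotopy {l r : B →ₐ[ℂ] S} {κ : S →ₗ[ℂ] B ⊗[ℂ] B}
    (hκ : ∀ x y, κ (l x * r y) = x ⊗ₜ y)
    (hspan : ∀ z, z ∈ Submodule.span ℂ (Set.range fun p : B × B => l p.1 * r p.2))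
    (x : ι → B)
    (h0 : ∀ z b, koszulConst ι (z * (r b - l b)) ∈
      LinearMap.range (koszulD (fun i => r (x i) - l (x i)) 0))
    (hs : ∀ q (k : Koszul ι S (q + 1)), koszulD (fun i => r (x i) - l (x i)) q k = 0 →
      k ∈ LinearMap.range (koszulD (fun i => r (x i) - l (x i)) (q + 1))) :
    ∃ (g : ∀ q, TensorPow B q →ₗ[ℂ] Koszul ι S q)
      (h : ∀ q, TensorPow B q →ₗ[ℂ] S ⊗[ℂ] TensorPow B (q + 1)),
      (∀ X : S ⊗[ℂ] TensorPow B 0, eps x 0 ((g 0).liftBaseChange S X) = X) ∧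
      (∀ q (w : TensorPow B (q + 1)),
        koszulD (fun i => r (x i) - l (x i)) q (g (q + 1) w) =
          (g q).liftBaseChange S (tw (mulBy l) (mulBy r) q (1 ⊗ₜ w))) ∧
      ∀ q (w : TensorPow B (q + 1)),
        (1 ⊗ₜ w - eps x (q + 1) (g (q + 1) w) : S ⊗[ℂ] TensorPow B (q + 1)) =
          tw (mulBy l) (mulBy r) (q + 1) (h (q + 1) w) +
            (h q).liftBaseChange S (tw (mulBy l) (mulBy r) q (1 ⊗ₜ w)) := by
  set u : ι → S := fun i => r (x i) - l (x i)
  obtain ⟨g, hg0, hg⟩ := exists_comparison l r u (tw_tw hκ hspan) h0 hs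
  have hg' : ∀ q X, koszulD u q ((g (q + 1)).liftBaseChange S X) =
      (g q).liftBaseChange S (tw (mulBy l) (mulBy r) q X) := by
    intro q X
    induction X with
    | zero => simp
    | add x y hx hy => simp only [map_add, hx, hy]
    | tmul z w =>
      rw [LinearMap.liftBaseChange_tmul, koszulD_smul, hg, ← map_smul, ← tw_smul,
        TensorProduct.smul_tmul', smul_eq_mul, mul_one]
  have he0 : ∀ X : S ⊗[ℂ] TensorPow B 0, eps x 0 ((g 0).liftBaseChange S X) = X := by
    intro X
    induction X with
    | zero => simp
    | add x y hx hy => simp only [map_add, hx, hy]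
    | tmul z w =>
      obtain ⟨t, rfl⟩ := tensorPow_zero_eq w
      rw [LinearMap.liftBaseChange_tmul, eps_smul, map_smul, hg0, map_smul, eps_const,
        TensorProduct.tmul_smul, smul_comm, TensorProduct.smul_tmul', smul_eq_mul, mul_one]
  let δ : ∀ q, S ⊗[ℂ] TensorPow B (q + 1) →ₗ[ℂ] S ⊗[ℂ] TensorPow B q := tw (mulBy l) (mulBy r)
  let E : ∀ q, S ⊗[ℂ] TensorPow B (q + 1) →ₗ[ℂ] S ⊗[ℂ] TensorPow B (q + 1) := fun q =>
    LinearMap.id - eps x (q + 1) ∘ₗ ((g (q + 1)).liftBaseChange S).restrictScalars ℂ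
  have hE : ∀ q X, E q X = X - eps x (q + 1) ((g (q + 1)).liftBaseChange S X) := fun q X => rfl
  -- The homotopy is built degree by degree: the part of `id - eps ∘ g` that is not yet accounted
  -- for is a cycle, and the contraction `barH` turns it into a boundary.
  let h : ∀ q, TensorPow B q →ₗ[ℂ] S ⊗[ℂ] TensorPow B (q + 1) := fun q =>
    Nat.rec 0 (fun q h => barH l κ (q + 1) ∘ₗ
      (E q - (h.liftBaseChange S).restrictScalars ℂ ∘ₗ δ q) ∘ₗ TensorProduct.mk ℂ S _ 1) q
  have hh : ∀ q w, h (q + 1) w =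
      barH l κ (q + 1) (E q (1 ⊗ₜ w) - (h q).liftBaseChange S (δ q (1 ⊗ₜ w))) := fun q w => rfl
  have hδ : ∀ q, (∀ X, δ q (E q X - (h q).liftBaseChange S (δ q X)) = 0) →
      ∀ X, E q X = δ (q + 1) ((h (q + 1)).liftBaseChange S X) +
        (h q).liftBaseChange S (δ q X) := by
    intro q hq X
    induction X with
    | zero => simp
    | add x y hx hy => simp only [map_add, hx, hy]; abel
    | tmul z w =>
      have key := tw_barH hκ hspan (E q (1 ⊗ₜ w) - (h q).liftBaseChange S (δ q (1 ⊗ₜ w)))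
      have hq1 : tw (mulBy l) (mulBy r) q
        (E q (1 ⊗ₜ w) - (h q).liftBaseChange S (δ q (1 ⊗ₜ w))) = 0 := hq _
      rw [hq1, map_zero, add_zero, ← hh] at key
      have e : z ⊗ₜ[ℂ] w = z • (1 ⊗ₜ[ℂ] w) := by
        rw [TensorProduct.smul_tmul', smul_eq_mul, mul_one]
      have e1 : E q (z • (1 ⊗ₜ[ℂ] w)) = z • E q (1 ⊗ₜ[ℂ] w) := by
        rw [hE, hE, map_smul, eps_smul, smul_sub]
      have e2 : ∀ X, δ q (z • X) = z • δ q X := tw_smul l r z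
      have e3 : ∀ X, δ (q + 1) (z • X) = z • δ (q + 1) X := tw_smul l r z
      rw [e, e1, e2, map_smul, e3, map_smul, LinearMap.liftBaseChange_tmul, one_smul, ← smul_add]
      congr 1
      exact sub_eq_iff_eq_add.1 key.symm
  have hcl : ∀ q X, δ q (E q X - (h q).liftBaseChange S (δ q X)) = 0 := by
    intro q
    have hepsD : ∀ q X, δ q (eps x (q + 1) ((g (q + 1)).liftBaseChange S X)) =
        eps x q ((g q).liftBaseChange S (δ q X)) := fun q X =>
      (tw_eps l r x _).trans (congrArg (eps x q) (hg' q X))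
    induction q with
    | zero =>
      intro X
      have : (h 0).liftBaseChange S (δ 0 X) = 0 := by
        have h00 : h 0 = 0 := rfl
        rw [h00]
        exact LinearMap.congr_fun (map_zero (LinearMap.liftBaseChangeEquiv S)) _
      rw [this, sub_zero, hE, map_sub, hepsD, he0, sub_self]
    | succ q ih =>
      intro X
      have h1 := hδ q ih (δ (q + 1) X)
      have h2 : δ q (δ (q + 1) X) = 0 := tw_tw hκ hspan q X
      rw [h2, map_zero, add_zero, hE] at h1
      rw [map_sub, hE, map_sub, hepsD, h1, sub_self]
  refine ⟨g, h, he0, hg, fun q w => ?_⟩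
  have := hδ q (hcl q) (1 ⊗ₜ w)
  rwa [LinearMap.liftBaseChange_tmul, one_smul, hE, LinearMap.liftBaseChange_tmul,
    one_smul] at this

/-- Base change of `exists_koszul_homotopy` along `θ`: up to a boundary, a cycle of positive degree
with coefficients in `S'` is the antisymmetrization of a Koszul cycle. -/
theorem exists_eps_add_boundary {l r : B →ₐ[ℂ] S} {κ : S →ₗ[ℂ] B ⊗[ℂ] B}
    (hκ : ∀ x y, κ (l x * r y) = x ⊗ₜ y)
    (hspan : ∀ z, z ∈ Submodule.span ℂ (Set.range fun p : B × B => l p.1 * r p.2))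
    (x : ι → B)
    (h0 : ∀ z b, koszulConst ι (z * (r b - l b)) ∈
      LinearMap.range (koszulD (fun i => r (x i) - l (x i)) 0))
    (hs : ∀ q (k : Koszul ι S (q + 1)), koszulD (fun i => r (x i) - l (x i)) q k = 0 →
      k ∈ LinearMap.range (koszulD (fun i => r (x i) - l (x i)) (q + 1)))
    (θ : S →ₐ[ℂ] S') {q : ℕ} (c : S' ⊗[ℂ] TensorPow B (q + 1))
    (hc : tw (mulBy (θ.comp l)) (mulBy (θ.comp r)) q c = 0) :
    ∃ k : Koszul ι S' (q + 1), koszulD (fun i => θ (r (x i)) - θ (l (x i))) q k = 0 ∧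
      ∃ y, c = eps x (q + 1) k + tw (mulBy (θ.comp l)) (mulBy (θ.comp r)) (q + 1) y := by
  obtain ⟨g, h, -, hg, hh⟩ := exists_koszul_homotopy hκ hspan x h0 hs
  let T : ∀ q, S ⊗[ℂ] TensorPow B q →ₗ[ℂ] S' ⊗[ℂ] TensorPow B q := fun q =>
    θ.toLinearMap.rTensor _
  let K : ∀ q, Koszul ι S q →ₗ[ℂ] Koszul ι S' q := fun q => θ.toLinearMap.compAlternatingMapₗ ℂ
  have hT : ∀ q (z : S) X, T q (z • X) = θ z • T q X := by
    intro q z X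
    induction X with
    | zero => simp
    | add x y hx hy => simp only [map_add, smul_add, hx, hy]
    | tmul s w => simp [T, TensorProduct.smul_tmul']
  have hK : ∀ q (z : S) (k : Koszul ι S q), K q (z • k) = θ z • K q k := by
    intro q z k; ext v; simp [K]
  have hT1 : ∀ q (w : TensorPow B q), T q (1 ⊗ₜ w) = 1 ⊗ₜ w := fun q w => by simp [T]
  have hTw : ∀ q X, tw (mulBy (θ.comp l)) (mulBy (θ.comp r)) q (T (q + 1) X) =
      T q (tw (mulBy l) (mulBy r) q X) := by
    intro q X
    have := tw_map (L := mulBy l) (R := mulBy r) (L' := mulBy (θ.comp l))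
      (R' := mulBy (θ.comp r)) θ.toLinearMap (LinearMap.id : B →ₗ[ℂ] B) (fun _ _ => rfl)
      (fun a m => by simp) (fun a m => by simp) X
    simp only [tpow_id] at this
    exact this
  set u : ι → S := fun i => r (x i) - l (x i)
  have hu : (fun i => θ (r (x i)) - θ (l (x i))) = fun i => θ (u i) := by
    funext i; simp [u]
  set δ : ∀ q, S' ⊗[ℂ] TensorPow B (q + 1) →ₗ[ℂ] S' ⊗[ℂ] TensorPow B q :=
    tw (mulBy (θ.comp l)) (mulBy (θ.comp r))
  let g' : ∀ q, S' ⊗[ℂ] TensorPow B q →ₗ[S'] Koszul ι S' q := fun q =>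
    (K q ∘ₗ g q).liftBaseChange S'
  let h' : ∀ q, S' ⊗[ℂ] TensorPow B q →ₗ[S'] S' ⊗[ℂ] TensorPow B (q + 1) := fun q =>
    (T (q + 1) ∘ₗ h q).liftBaseChange S'
  have hg' : ∀ q X, g' q (T q X) = K q ((g q).liftBaseChange S X) := fun q X =>
    liftBaseChange_map θ (K q) (hK q) (g q) X
  have hh' : ∀ q X, h' q (T q X) = T (q + 1) ((h q).liftBaseChange S X) := fun q X =>
    liftBaseChange_map θ (T (q + 1)) (hT (q + 1)) (h q) X
  have hδs : ∀ q (z : S') X, δ q (z • X) = z • δ q X := fun q z X => tw_smul _ _ z X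
  have h1 : ∀ X, koszulD (fun i => θ (u i)) q (g' (q + 1) X) = g' q (δ q X) := by
    intro X
    induction X with
    | zero => simp
    | add x y hx hy => simp only [map_add, hx, hy]
    | tmul z w =>
      have e : z ⊗ₜ[ℂ] w = z • T (q + 1) (1 ⊗ₜ[ℂ] w) := by
        rw [hT1, TensorProduct.smul_tmul', smul_eq_mul, mul_one]
      rw [e, map_smul, koszulD_smul, hδs, map_smul, hTw, hg', hg', LinearMap.liftBaseChange_tmul,
        one_smul, ← hg]
      exact congrArg _ (koszulD_comp θ u _)
  have h2 : ∀ X, X - eps x (q + 1) (g' (q + 1) X) = δ (q + 1) (h' (q + 1) X) + h' q (δ q X) := by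
    intro X
    induction X with
    | zero => simp
    | add x y hx hy =>
      simp only [map_add]
      rw [add_sub_add_comm, hx, hy]; abel
    | tmul z w =>
      have e : z ⊗ₜ[ℂ] w = z • T (q + 1) (1 ⊗ₜ[ℂ] w) := by
        rw [hT1, TensorProduct.smul_tmul', smul_eq_mul, mul_one]
      have e2 : eps x (q + 1) (K (q + 1) (g (q + 1) w)) = T (q + 1) (eps x (q + 1) (g (q + 1) w)) :=
        eps_comp θ x _
      rw [e, map_smul, eps_smul, hδs, map_smul, hδs, map_smul]
      have gen : ∀ a b c d : S' ⊗[ℂ] TensorPow B (q + 1), a - b = c + d →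
          z • a - z • b = z • c + z • d := fun a b c d h => by
        rw [← smul_add, ← h, smul_sub]
      refine gen _ _ _ _ ?_
      rw [hTw, hg', hh', hh', LinearMap.liftBaseChange_tmul, one_smul, LinearMap.liftBaseChange_tmul,
        one_smul, e2, hTw, ← map_sub, hh, map_add]
  refine ⟨g' (q + 1) c, ?_, h' (q + 1) c, ?_⟩
  · rw [hu, h1, hc, map_zero]
  · have := h2 c
    rw [hc, map_zero, add_zero, sub_eq_iff_eq_add'] at this
    exact this

end Comparison

/-! ### Chains of a polynomial algebra with coefficients twisted by a diagonal automorphism -/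

section Twisted

variable {B : Type*} [CommRing B] [Algebra ℂ B]

/-- The cycles of degree `q` of the chains of `B` with coefficients in `B`, where the right
multiplication of the bimodule is twisted by the endomorphism `σ`. -/
def twCycles (σ : B →ₐ[ℂ] B) : ∀ q, Submodule ℂ (B ⊗[ℂ] TensorPow B q)
  | 0 => ⊤
  | q + 1 => LinearMap.ker (tw (mulBy (AlgHom.id ℂ B)) (mulBy σ) q)

variable {Q : Type*} [CommRing Q] [Algebra ℂ Q]

/-- The Hochschild–Kostant–Rosenberg map
`f ⊗ b₁ ⊗ ⋯ ⊗ b_q ↦ (1/q!) τ(f) dτ(b₁) ∧ ⋯ ∧ dτ(b_q)`, followed by restriction along `τ`. -/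
def twForm (τ : B →ₐ[ℂ] Q) (q : ℕ) : B ⊗[ℂ] TensorPow B q →ₗ[ℂ] Forms Q q :=
  (1 / (q.factorial : ℂ)) • (formChain Q q ∘ₗ join Q q ∘ₗ
    TensorProduct.map τ.toLinearMap (tpow τ.toLinearMap q))

theorem twForm_tmul_tprod (τ : B →ₐ[ℂ] Q) {q : ℕ} (f : B) (b : Fin q → B) :
    twForm τ q (f ⊗ₜ PiTensorProduct.tprod ℂ b) = (1 / (q.factorial : ℂ)) • τ f •
      exteriorPower.ιMulti Q q (fun i => KaehlerDifferential.D ℂ Q (τ (b i))) := by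
  simp [twForm, tpow_tprod, tcons_tprod, formChain_tprod]

/-- The Hochschild–Kostant–Rosenberg map kills the boundaries of the twisted complex if the twist
`σ` is invisible after restriction along `τ`. -/
theorem twForm_tw {σ : B →ₐ[ℂ] B} {τ : B →ₐ[ℂ] Q} (h : τ.comp σ = τ) {q : ℕ}
    (x : B ⊗[ℂ] TensorPow B (q + 1)) :
    twForm τ q (tw (mulBy (AlgHom.id ℂ B)) (mulBy σ) q x) = 0 := by
  have h' : ∀ b, τ (σ b) = τ b := fun b => DFunLike.congr_fun h b
  rw [twForm, LinearMap.smul_apply, LinearMap.comp_apply, LinearMap.comp_apply, ← tw_map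
    (L' := LinearMap.mul ℂ Q) (R' := (LinearMap.mul ℂ Q).flip), ← hochB_join]
  · have := LinearMap.congr_fun (formChain_hochB Q q) (join Q (q + 1)
      (TensorProduct.map τ.toLinearMap (tpow τ.toLinearMap (q + 1)) x))
    rw [LinearMap.comp_apply] at this
    rw [this, LinearMap.zero_apply, smul_zero]
  · simp
  · simp
  · intro a m
    simp [h', mul_comm]

theorem twForm_smul (τ : B →ₐ[ℂ] Q) {q : ℕ} (z : B) (x : B ⊗[ℂ] TensorPow B q) :
    twForm τ q (z • x) = τ z • twForm τ q x := by
  induction x with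
  | zero => simp
  | add x y hx hy => simp only [smul_add, map_add, hx, hy]
  | tmul f w =>
    refine LinearMap.congr_fun (f := twForm τ q ∘ₗ TensorProduct.mk ℂ B _ (z * f))
      (g := (LinearMap.lsmul ℂ (Forms Q q) (1 : ℂ)) ∘ₗ
        (((LinearMap.lsmul Q (Forms Q q) (τ z)).restrictScalars ℂ) ∘ₗ twForm τ q ∘ₗ
        TensorProduct.mk ℂ B _ f))
      (PiTensorProduct.ext (MultilinearMap.ext fun b => ?_)) w |>.trans ?_
    · simp only [LinearMap.compMultilinearMap_apply, LinearMap.comp_apply, TensorProduct.mk_apply,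
        twForm_tmul_tprod, map_mul, mul_smul, LinearMap.lsmul_apply, one_smul,
        LinearMap.restrictScalars_apply]
      rw [smul_comm]
    · simp

theorem smul_mem_twCycles {σ : B →ₐ[ℂ] B} : ∀ {q : ℕ} (z : B) {x : B ⊗[ℂ] TensorPow B q},
    x ∈ twCycles σ q → z • x ∈ twCycles σ q
  | 0, _, _, _ => Submodule.mem_top
  | q + 1, z, x, hx => by
    have hx' : tw (mulBy (AlgHom.id ℂ B)) (mulBy σ) q x = 0 := hx
    change tw (mulBy (AlgHom.id ℂ B)) (mulBy σ) q (z • x) = 0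
    rw [tw_smul, hx', smul_zero]

end Twisted

section Polynomial

variable {ι : Type*} [Fintype ι] [DecidableEq ι]

/-- The image of the last Koszul differential of the sequence of variables is the ideal of the
polynomials without constant term. -/
theorem koszulConst_mem_range_koszulD (z : MvPolynomial ι (MvPolynomial ι ℂ))
    (hz : MvPolynomial.constantCoeff z = 0) :
    koszulConst ι z ∈ LinearMap.range (koszulD (fun i : ι =>
      (MvPolynomial.X i : MvPolynomial ι (MvPolynomial ι ℂ))) 0) := by
  obtain ⟨k', hk'⟩ := koszul_exact_zero (fun _ : ι => (1 : ℂ)) (koszulConst ι z)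
  simp only [one_smul] at hk'
  refine ⟨k', (sub_eq_zero.1 (koszul_ext fun I => ?_)).symm⟩
  rw [hk']
  have h : ∀ y : MvPolynomial ι (MvPolynomial ι ℂ),
      wtZero (fun _ : ι => (1 : ℂ)) I y = MvPolynomial.C (MvPolynomial.constantCoeff y) := by
    intro y
    induction y using MvPolynomial.induction_on' with
    | add x y hx hy => rw [map_add, map_add, map_add, hx, hy]
    | monomial s b =>
      rw [wtZero, scaleBy_monomial]
      by_cases hs : s = 0
      · subst hs
        have : wtTerm (fun _ : ι => (1 : ℂ)) I 0 = 0 :=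
          (wtTerm_eq_zero_iff _).2 ⟨fun _ _ => rfl, fun p => p.elim0⟩
        rw [if_pos this, one_smul, MvPolynomial.constantCoeff_monomial, if_pos rfl]
        rfl
      · have : wtTerm (fun _ : ι => (1 : ℂ)) I s ≠ 0 := fun h =>
          hs (Finsupp.ext fun i => ((wtTerm_eq_zero_iff _).1 h).1 i one_ne_zero)
        rw [if_neg this, zero_smul, MvPolynomial.constantCoeff_monomial, if_neg hs, map_zero]
  rw [h]
  simp [hz]

/-- The Koszul complex of the sequence of variables is exact in positive degree: here all indices
have weight `1`, so that nothing of positive degree has weight zero. -/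
theorem mem_range_koszulD_of_cycle {q : ℕ}
    (k : Koszul ι (MvPolynomial ι (MvPolynomial ι ℂ)) (q + 1))
    (hk : koszulD (fun i : ι => (MvPolynomial.X i : MvPolynomial ι (MvPolynomial ι ℂ))) q k = 0) :
    k ∈ LinearMap.range (koszulD (fun i : ι =>
      (MvPolynomial.X i : MvPolynomial ι (MvPolynomial ι ℂ))) (q + 1)) := by
  obtain ⟨k', hk'⟩ := koszul_exact_succ (fun _ : ι => (1 : ℂ)) k (by simpa only [one_smul] using hk)
  simp only [one_smul] at hk'
  refine ⟨k', (sub_eq_zero.1 (koszul_ext fun I => ?_)).symm⟩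
  rw [hk']
  have h : (fun s => if wtTerm (fun _ : ι => (1 : ℂ)) I s = 0 then (1 : ℂ) else 0) = 0 := by
    funext s
    exact if_neg fun h => one_ne_zero (((wtTerm_eq_zero_iff _).1 h).2 0)
  rw [wtZero, h]
  induction k (stdVec I) using MvPolynomial.induction_on' with
  | add x y hx hy => rw [map_add, hx, hy]; simp
  | monomial s b => rw [scaleBy_monomial]; simp

/-- Chains with coefficients in the polynomial algebra twisted by the diagonal endomorphism
`x_i ↦ (1 + a_i) x_i`: modulo boundaries, a cycle is the antisymmetrization of a Koszul cycle whose
coefficients and indices only involve the variables with `a_i = 0`. -/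
theorem exists_koszul_representative {a : ι → ℂ} {σ : MvPolynomial ι ℂ →ₐ[ℂ] MvPolynomial ι ℂ}
    (hσ : ∀ i, σ (MvPolynomial.X i) = MvPolynomial.X i + a i • MvPolynomial.X i) {q : ℕ}
    {c : MvPolynomial ι ℂ ⊗[ℂ] TensorPow (MvPolynomial ι ℂ) q} (hc : c ∈ twCycles σ q) :
    ∃ k : Koszul ι (MvPolynomial ι ℂ) q, (∀ I, ∃ f, k (stdVec I) = wtZero a I f) ∧
      ∃ y, c = eps MvPolynomial.X q k + tw (mulBy (AlgHom.id ℂ _)) (mulBy σ) q y := by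
  have huv : (fun i => σ (MvPolynomial.X i) - AlgHom.id ℂ (MvPolynomial ι ℂ) (MvPolynomial.X i)) =
      fun i => a i • MvPolynomial.X i := by
    funext i
    rw [hσ, AlgHom.id_apply, add_sub_cancel_left]
  cases q with
  | zero =>
    have hk : ∃ k : Koszul ι (MvPolynomial ι ℂ) 0, c = eps MvPolynomial.X 0 k := by
      clear hc
      induction c with
      | zero => exact ⟨0, (map_zero _).symm⟩
      | add x y hx hy =>
        obtain ⟨k, hk⟩ := hx
        obtain ⟨k', hk'⟩ := hy
        exact ⟨k + k', by rw [map_add, hk, hk']⟩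
      | tmul z w =>
        obtain ⟨t, rfl⟩ := tensorPow_zero_eq w
        exact ⟨t • koszulConst ι z, by rw [map_smul, eps_const, TensorProduct.tmul_smul]⟩
    obtain ⟨k, rfl⟩ := hk
    obtain ⟨k', hk'⟩ := koszul_exact_zero a k
    refine ⟨_, fun I => ⟨_, hk' I⟩, eps MvPolynomial.X 1 k', ?_⟩
    rw [tw_eps, huv, map_sub, sub_add_cancel]
  | succ q =>
    let B := MvPolynomial ι ℂ
    let P := MvPolynomial ι B
    -- `P = B[X]` is `B ⊗ B`, where `X i` stands for `1 ⊗ x_i - x_i ⊗ 1`: this makes the Koszul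
    -- complex of the diagonal the one of the sequence of variables of `P`. The base change `θ`
    -- sends `X i` to `σ x_i - x_i`.
    let l : B →ₐ[ℂ] P := IsScalarTower.toAlgHom ℂ B P
    let r : B →ₐ[ℂ] P := MvPolynomial.aeval fun i =>
      MvPolynomial.C (MvPolynomial.X i) + MvPolynomial.X i
    let κ : P →ₐ[ℂ] B ⊗[ℂ] B := (MvPolynomial.aeval (R := B) fun i : ι =>
      (1 ⊗ₜ MvPolynomial.X i - MvPolynomial.X i ⊗ₜ 1 : B ⊗[ℂ] B)).restrictScalars ℂ
    let θ : P →ₐ[ℂ] B := (MvPolynomial.aeval (R := B) fun i : ι =>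
      (a i • MvPolynomial.X i : B)).restrictScalars ℂ
    have hl : ∀ b, l b = MvPolynomial.C b := fun b => rfl
    have hr : ∀ i, r (MvPolynomial.X i) = MvPolynomial.C (MvPolynomial.X i) + MvPolynomial.X i :=
      fun i => MvPolynomial.aeval_X _ _
    have hu : (fun i => r (MvPolynomial.X i) - l (MvPolynomial.X i)) = MvPolynomial.X := by
      funext i
      rw [hr, hl, add_sub_cancel_left]
    have hκl : ∀ b, κ (l b) = b ⊗ₜ 1 := fun b => MvPolynomial.aeval_C _ b
    have hκX : ∀ i, κ (MvPolynomial.X i) = 1 ⊗ₜ MvPolynomial.X i - MvPolynomial.X i ⊗ₜ 1 := fun i =>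
      MvPolynomial.aeval_X _ i
    have hκr : ∀ b, κ (r b) = 1 ⊗ₜ b := fun b => by
      have : κ.comp r = Algebra.TensorProduct.includeRight := by
        refine MvPolynomial.algHom_ext fun i => ?_
        rw [AlgHom.comp_apply, hr, map_add, ← hl, hκl, hκX]
        simp
      exact DFunLike.congr_fun this b
    have hθl : θ.comp l = AlgHom.id ℂ B := AlgHom.ext fun b => MvPolynomial.aeval_C _ b
    have hθX : ∀ i, θ (MvPolynomial.X i) = a i • MvPolynomial.X i := fun i =>
      MvPolynomial.aeval_X _ i
    have hθr : θ.comp r = σ := by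
      refine MvPolynomial.algHom_ext fun i => ?_
      rw [AlgHom.comp_apply, hr, map_add, hσ, ← hl, hθX, ← AlgHom.comp_apply, hθl]
      rfl
    have hspan : ∀ z, z ∈ Submodule.span ℂ (Set.range fun p : B × B => l p.1 * r p.2) := by
      intro z
      induction z using MvPolynomial.induction_on with
      | C b => exact Submodule.subset_span ⟨(b, 1), by simp [hl]⟩
      | add x y hx hy => exact add_mem hx hy
      | mul_X z i hz =>
        induction hz using Submodule.span_induction with
        | zero => rw [zero_mul]; exact zero_mem _
        | add x y _ _ hx hy => rw [add_mul]; exact add_mem hx hy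
        | smul t x _ hx => rw [smul_mul_assoc]; exact Submodule.smul_mem _ _ hx
        | mem z hz =>
          obtain ⟨⟨x, y⟩, rfl⟩ := hz
          have e : l x * r y * MvPolynomial.X i =
              l x * r (y * MvPolynomial.X i) - l (x * MvPolynomial.X i) * r y := by
            rw [← congrFun hu i, map_mul, map_mul]; ring
          change l x * r y * MvPolynomial.X i ∈ _
          rw [e]
          exact sub_mem (Submodule.subset_span ⟨(x, y * MvPolynomial.X i), rfl⟩)
            (Submodule.subset_span ⟨(x * MvPolynomial.X i, y), rfl⟩)
    have hcc : ∀ b, MvPolynomial.constantCoeff (r b) = b := fun b => by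
      have : ((MvPolynomial.aeval (R := B) fun _ : ι => (0 : B)).restrictScalars ℂ).comp r =
          AlgHom.id ℂ B := by
        refine MvPolynomial.algHom_ext fun i => ?_
        rw [AlgHom.comp_apply, hr]
        simp
        rfl
      have h2 := DFunLike.congr_fun this b
      simpa using h2
    have hc' : tw (mulBy (θ.comp l)) (mulBy (θ.comp r)) q c = 0 := by
      rw [hθl, hθr]; exact hc
    obtain ⟨k, hk, y, hy⟩ := exists_eps_add_boundary (l := l) (r := r) (κ := κ.toLinearMap)
      (fun x y => by simp [hκl, hκr]) hspan MvPolynomial.X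
      (fun z b => by
        rw [hu]
        refine koszulConst_mem_range_koszulD _ ?_
        rw [map_mul, map_sub, hcc, hl, MvPolynomial.constantCoeff_C, sub_self, mul_zero])
      (fun q k hk => by
        rw [hu] at hk ⊢
        exact mem_range_koszulD_of_cycle k hk) θ c hc'
    have hθu : (fun i => θ (r (MvPolynomial.X i)) - θ (l (MvPolynomial.X i))) =
        fun i => a i • MvPolynomial.X i := by
      funext i
      rw [← map_sub, congrFun hu i, hθX]
    rw [hθu] at hk
    rw [hθl, hθr] at hy
    obtain ⟨k', hk'⟩ := koszul_exact_succ a k hk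
    refine ⟨_, fun I => ⟨_, hk' I⟩, y + eps MvPolynomial.X (q + 2) k', ?_⟩
    rw [map_add, tw_eps, huv, map_sub, hy]
    abel

end Polynomial

section CoordDeriv

variable {ι Q : Type*} [CommRing Q] [Algebra ℂ Q]

/-- The derivation `∂/∂x_j` of the algebra `Q` of functions on a coordinate subspace, which `δ`
embeds into the polynomial algebra. -/
def coordDeriv (τ : MvPolynomial ι ℂ →ₐ[ℂ] Q) (δ : Q →ₐ[ℂ] MvPolynomial ι ℂ)
    (hτδ : ∀ z, τ (δ z) = z) (j : ι) : Derivation ℂ Q Q :=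
  Derivation.mk' (τ.toLinearMap ∘ₗ (MvPolynomial.pderiv (R := ℂ) j).toLinearMap ∘ₗ δ.toLinearMap)
    fun x y => by simp [hτδ]

theorem coordDeriv_apply (τ : MvPolynomial ι ℂ →ₐ[ℂ] Q) (δ : Q →ₐ[ℂ] MvPolynomial ι ℂ)
    (hτδ : ∀ z, τ (δ z) = z) (j : ι) (z : Q) :
    coordDeriv τ δ hτδ j z = τ (MvPolynomial.pderiv j (δ z)) := rfl

variable [Fintype ι] {a : ι → ℂ}

/-- The terms of weight zero only involve the variables with `a_i = 0`, and are recovered from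
their restriction to the coordinate subspace. -/
theorem apply_apply_wtZero (τ : MvPolynomial ι ℂ →ₐ[ℂ] Q) (δ : Q →ₐ[ℂ] MvPolynomial ι ℂ)
    (hδ : ∀ i, δ (τ (MvPolynomial.X i)) = if a i = 0 then MvPolynomial.X i else 0)
    {q : ℕ} (I : Fin q → ι) (f : MvPolynomial ι ℂ) :
    δ (τ (wtZero a I f)) = wtZero a I f := by
  induction f using MvPolynomial.induction_on' with
  | add x y hx hy => simp only [map_add, hx, hy]
  | monomial s b =>
    rw [wtZero, scaleBy_monomial]
    split_ifs with h
    · rw [one_smul, MvPolynomial.monomial_eq, map_mul, map_mul, Finsupp.prod, map_prod, map_prod]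
      congr 1
      · rw [← MvPolynomial.algebraMap_eq, AlgHom.commutes, AlgHom.commutes]
      · refine Finset.prod_congr rfl fun i hi => ?_
        have : a i = 0 := by
          by_contra hai
          exact (Finsupp.mem_support_iff.1 hi) (((wtTerm_eq_zero_iff _).1 h).1 i hai)
        rw [map_pow, map_pow, hδ, if_pos this]
    · simp

theorem wtZero_eq_zero {q : ℕ} {I : Fin q → ι} {p : Fin q} (hp : a (I p) ≠ 0)
    (f : MvPolynomial ι ℂ) : wtZero a I f = 0 := by
  induction f using MvPolynomial.induction_on' with
  | add x y hx hy => simp only [map_add, hx, hy, add_zero]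
  | monomial s b =>
    rw [wtZero, scaleBy_monomial, if_neg fun h => hp (((wtTerm_eq_zero_iff _).1 h).2 p), zero_smul]

end CoordDeriv

section TwistedHKR

variable {ι : Type*} [Fintype ι] [DecidableEq ι]

/-- Expansion of a sum over all multi-indices against the minors of the identity matrix. -/
theorem sum_det_smul (R : Type*) {M : Type*} [CommRing R] [AddCommGroup M] [Module R M] {q : ℕ}
    {g : (Fin q → ι) → M}
    (hg : ∀ I (σ : Equiv.Perm (Fin q)), g (I ∘ σ) = (Equiv.Perm.sign σ : ℤ) • g I)
    (J : Fin q → ι) :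
    ∑ I : Fin q → ι, (Matrix.of fun i j => if I i = J j then (1 : R) else 0).det • g I =
      (q.factorial : R) • g J := by
  have h : ∀ (I : Fin q → ι), (Matrix.of fun i j => if I i = J j then (1 : R) else 0).det • g I =
      ∑ σ : Equiv.Perm (Fin q), if I = J ∘ σ.symm then g J else 0 := by
    intro I
    rw [Matrix.det_apply, Finset.sum_smul]
    refine Finset.sum_congr rfl fun σ _ => ?_
    split_ifs with hI
    · subst hI
      have : ∏ i, (Matrix.of fun i j => if (J ∘ σ.symm) i = J j then (1 : R) else 0) (σ i) i = 1 :=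
        Finset.prod_eq_one fun i _ => by simp
      rw [this, hg, Equiv.Perm.sign_symm, Units.smul_def, smul_assoc, one_smul, smul_smul,
        ← Units.val_mul, ← sq, Int.units_sq, Units.val_one, one_smul]
    · have : ∃ i, I (σ i) ≠ J i := by
        by_contra! hc
        exact hI (funext fun i => by rw [Function.comp_apply, ← hc, Equiv.apply_symm_apply])
      obtain ⟨i, hi⟩ := this
      rw [Finset.prod_eq_zero (Finset.mem_univ i) (by simp [hi]), smul_zero, zero_smul]
  simp only [h]
  rw [Finset.sum_comm]
  simp [Fintype.card_perm, Nat.cast_smul_eq_nsmul]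

variable {Q : Type*} [CommRing Q] [Algebra ℂ Q] {a : ι → ℂ}
  {σ : MvPolynomial ι ℂ →ₐ[ℂ] MvPolynomial ι ℂ}

theorem twForm_eps (τ : MvPolynomial ι ℂ →ₐ[ℂ] Q) {q : ℕ} (k : Koszul ι (MvPolynomial ι ℂ) q) :
    twForm τ q (eps MvPolynomial.X q k) = (1 / (q.factorial : ℂ)) • ∑ I : Fin q → ι,
      τ (k (stdVec I)) • exteriorPower.ιMulti Q q
        (fun p => KaehlerDifferential.D ℂ Q (τ (MvPolynomial.X (I p)))) := by
  rw [eps_apply, map_sum, Finset.smul_sum]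
  exact Finset.sum_congr rfl fun I _ => twForm_tmul_tprod _ _ _

/-- Twisted Hochschild–Kostant–Rosenberg theorem, injectivity: here `τ` is the restriction to the
subspace on which all `x_i` with `a_i ≠ 0` vanish, and `δ` is the section of `τ` that extends a
function to be independent of these coordinates. -/
theorem mem_range_tw_of_twForm_eq_zero
    (hσ : ∀ i, σ (MvPolynomial.X i) = MvPolynomial.X i + a i • MvPolynomial.X i)
    (τ : MvPolynomial ι ℂ →ₐ[ℂ] Q) (δ : Q →ₐ[ℂ] MvPolynomial ι ℂ) (hτδ : ∀ z, τ (δ z) = z)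
    (hτσ : τ.comp σ = τ)
    (hδ : ∀ i, δ (τ (MvPolynomial.X i)) = if a i = 0 then MvPolynomial.X i else 0) {q : ℕ}
    {c : MvPolynomial ι ℂ ⊗[ℂ] TensorPow (MvPolynomial ι ℂ) q} (hc : c ∈ twCycles σ q)
    (h : twForm τ q c = 0) :
    c ∈ LinearMap.range (tw (mulBy (AlgHom.id ℂ _)) (mulBy σ) q) := by
  obtain ⟨k, hk, y, rfl⟩ := exists_koszul_representative hσ hc
  suffices hk0 : k = 0 by
    rw [hk0, map_zero, zero_add]
    exact ⟨y, rfl⟩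
  rw [map_add, twForm_tw hτσ, add_zero, twForm_eps, smul_eq_zero] at h
  have h := h.resolve_left (by
    rw [one_div]; exact inv_ne_zero (Nat.cast_ne_zero.2 (Nat.factorial_ne_zero q)))
  refine koszul_ext fun J => ?_
  obtain ⟨f, hf⟩ := hk J
  rw [AlternatingMap.zero_apply]
  by_cases hJ : ∀ p, a (J p) = 0
  swap
  · push Not at hJ
    obtain ⟨p, hp⟩ := hJ
    rw [hf, wtZero_eq_zero hp]
  suffices hτ : τ (k (stdVec J)) = 0 by
    rw [hf] at hτ ⊢
    rw [← apply_apply_wtZero τ δ hδ J f, hτ, map_zero]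
  -- The coefficient of `dx_J` is extracted by the minor with the columns `J`.
  let L : Ω[Q⁄ℂ] →ₗ[Q] Fin q → Q := LinearMap.pi fun p =>
    (coordDeriv τ δ hτδ (J p)).liftKaehlerDifferential
  have h1 := congrArg (exteriorPower.alternatingMapLinearEquiv
    (Matrix.detRowAlternating.compLinearMap L)) h
  have h2 : ∀ I : Fin q → ι, Matrix.detRowAlternating.compLinearMap L
      (fun p => KaehlerDifferential.D ℂ Q (τ (MvPolynomial.X (I p)))) =
      (Matrix.of fun i j => if I i = J j then (1 : Q) else 0).det := by
    intro I
    change Matrix.det _ = _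
    congr 1
    ext i j
    change (coordDeriv τ δ hτδ (J j)).liftKaehlerDifferential
      (KaehlerDifferential.D ℂ Q (τ (MvPolynomial.X (I i)))) = _
    rw [Derivation.liftKaehlerDifferential_comp_D, coordDeriv_apply, hδ, Matrix.of_apply]
    by_cases e : I i = J j
    · rw [e, if_pos (hJ j), if_pos rfl, MvPolynomial.pderiv_X_self, map_one]
    · rw [if_neg e]
      split_ifs
      · rw [MvPolynomial.pderiv_X_of_ne e, map_zero]
      · rw [map_zero, map_zero]
  rw [map_sum, map_zero] at h1
  simp only [map_smul, exteriorPower.alternatingMapLinearEquiv_apply_ιMulti, h2, smul_eq_mul] at h1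
  have h3 := sum_det_smul Q (g := fun I => τ (k (stdVec I)))
    (fun I π => by rw [koszul_perm, map_zsmul]) J
  simp only [smul_eq_mul] at h3
  simp only [mul_comm (τ _)] at h1
  rw [h1] at h3
  have h4 : (q.factorial : ℂ) • τ (k (stdVec J)) = 0 := by
    rw [Algebra.smul_def, map_natCast]; exact h3.symm
  exact (smul_eq_zero.1 h4).resolve_left (Nat.cast_ne_zero.2 (Nat.factorial_ne_zero q))

/-- Twisted Hochschild–Kostant–Rosenberg theorem, surjectivity. Every form is a combination of
forms `dx_I` that only involve coordinates of the subspace, and such a form lifts to an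
antisymmetrized cycle with constant coefficients. -/
theorem exists_twForm_eq
    (hσ : ∀ i, σ (MvPolynomial.X i) = MvPolynomial.X i + a i • MvPolynomial.X i)
    (τ : MvPolynomial ι ℂ →ₐ[ℂ] Q) (δ : Q →ₐ[ℂ] MvPolynomial ι ℂ) (hτδ : ∀ z, τ (δ z) = z)
    (hδ : ∀ i, δ (τ (MvPolynomial.X i)) = if a i = 0 then MvPolynomial.X i else 0) {q : ℕ}
    (η : Forms Q q) : ∃ c ∈ twCycles σ q, twForm τ q c = η := by
  have hspan : Submodule.span Q (Set.range fun i =>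
      KaehlerDifferential.D ℂ Q (τ (MvPolynomial.X i))) = ⊤ := by
    rw [eq_top_iff, ← KaehlerDifferential.span_range_derivation, Submodule.span_le]
    rintro _ ⟨z, rfl⟩
    rw [← hτδ z]
    induction δ z using MvPolynomial.induction_on with
    | C b =>
      rw [← MvPolynomial.algebraMap_eq, AlgHom.commutes, Derivation.map_algebraMap]
      exact zero_mem _
    | add x y hx hy => rw [map_add, map_add]; exact add_mem hx hy
    | mul_X x i hx =>
      rw [map_mul, Derivation.leibniz]
      exact add_mem (Submodule.smul_mem _ _ (Submodule.subset_span ⟨i, rfl⟩))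
        (Submodule.smul_mem _ _ hx)
  have hη : η ∈ Submodule.span Q (exteriorPower.ιMulti Q q '' {v | Set.range v ⊆
      Set.range fun i => KaehlerDifferential.D ℂ Q (τ (MvPolynomial.X i))}) := by
    rw [exteriorPower.ιMulti_span_of_span Q q _ hspan]; trivial
  induction hη using Submodule.span_induction with
  | zero => exact ⟨0, zero_mem _, map_zero _⟩
  | add x y _ _ hx hy =>
    obtain ⟨c, hc, rfl⟩ := hx
    obtain ⟨c', hc', rfl⟩ := hy
    exact ⟨c + c', add_mem hc hc', map_add _ _ _⟩
  | smul z x _ hx =>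
    obtain ⟨c, hc, rfl⟩ := hx
    exact ⟨δ z • c, smul_mem_twCycles _ hc, by rw [twForm_smul, hτδ]⟩
  | mem x hx =>
    obtain ⟨v, hv, rfl⟩ := hx
    choose I hI using fun p => hv (Set.mem_range_self p)
    have hv' : v = fun p => KaehlerDifferential.D ℂ Q (τ (MvPolynomial.X (I p))) :=
      funext fun p => (hI p).symm
    by_cases hIa : ∀ p, a (I p) = 0
    swap
    · push Not at hIa
      obtain ⟨p, hp⟩ := hIa
      have h0 : τ (MvPolynomial.X (I p)) = 0 := by
        rw [← hτδ (τ _), hδ, if_neg hp, map_zero]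
      refine ⟨0, zero_mem _, ?_⟩
      rw [map_zero, AlternatingMap.map_coord_zero _ p]
      simp only [hv', h0, map_zero]
    -- The Koszul cycle dual to `I`.
    let k : Koszul ι (MvPolynomial ι ℂ) q :=
      (Algebra.linearMap ℂ (MvPolynomial ι ℂ)).compAlternatingMap
      (Matrix.detRowAlternating.compLinearMap (LinearMap.funLeft ℂ ℂ I))
    have hk : ∀ J, k (stdVec J) = algebraMap ℂ _
        (Matrix.of fun i j => if J i = I j then (1 : ℂ) else 0).det := by
      intro J
      change algebraMap ℂ _ (Matrix.det _) = _
      congr 2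
      ext i j
      simp [stdVec, LinearMap.funLeft_apply, Pi.single_apply, eq_comm]
    refine ⟨eps MvPolynomial.X q k, ?_, ?_⟩
    · cases q with
      | zero => exact Submodule.mem_top
      | succ q =>
        change tw _ _ q _ = 0
        rw [tw_eps]
        suffices h : koszulD (fun i => σ (MvPolynomial.X i) -
            AlgHom.id ℂ (MvPolynomial ι ℂ) (MvPolynomial.X i)) q k = 0 by rw [h, map_zero]
        refine koszul_ext fun J => ?_
        rw [koszulD_stdVec, AlternatingMap.zero_apply]
        refine Finset.sum_eq_zero fun i _ => ?_
        rw [hσ, AlgHom.id_apply, add_sub_cancel_left]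
        by_cases hi : a i = 0
        · rw [hi, zero_smul, zero_mul]
        · rw [hk, Matrix.det_eq_zero_of_row_eq_zero 0, map_zero, mul_zero]
          intro j
          rw [Matrix.of_apply, Fin.cons_zero, if_neg]
          rintro rfl
          exact hi (hIa j)
    · have h3 := sum_det_smul ℂ (g := fun J : Fin q → ι => exteriorPower.ιMulti Q q
        (fun p => KaehlerDifferential.D ℂ Q (τ (MvPolynomial.X (J p)))))
        (fun J π => by
          rw [← Units.smul_def, ← AlternatingMap.map_perm]
          rfl) I
      have h4 : ∀ J, τ (k (stdVec J)) • exteriorPower.ιMulti Q q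
          (fun p => KaehlerDifferential.D ℂ Q (τ (MvPolynomial.X (J p)))) =
          (Matrix.of fun i j => if J i = I j then (1 : ℂ) else 0).det • exteriorPower.ιMulti Q q
          (fun p => KaehlerDifferential.D ℂ Q (τ (MvPolynomial.X (J p)))) := fun J => by
        rw [hk, AlgHom.commutes, algebraMap_smul]
      rw [twForm_eps]
      simp only [h4]
      rw [h3, smul_smul, one_div,
        inv_mul_cancel₀ (Nat.cast_ne_zero.2 (Nat.factorial_ne_zero q)), one_smul, hv']

end TwistedHKR

/-! ### Hochschild homology of `O(X)` with coefficients twisted by a group element -/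

section Transport

theorem twForm_map {B B' Q : Type*} [CommRing B] [Algebra ℂ B] [CommRing B'] [Algebra ℂ B']
    [CommRing Q] [Algebra ℂ Q] (τ : B' →ₐ[ℂ] Q) (u : B →ₐ[ℂ] B') {q : ℕ}
    (x : B ⊗[ℂ] TensorPow B q) :
    twForm τ q (TensorProduct.map u.toLinearMap (tpow u.toLinearMap q) x) =
      twForm (τ.comp u) q x := by
  have h : (τ.comp u).toLinearMap = τ.toLinearMap ∘ₗ u.toLinearMap := rfl
  rw [twForm, twForm, h, tpow_comp, TensorProduct.map_comp]
  rfl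

/-- The morphism of chains induced by an algebra morphism. -/
abbrev twMap {B B' : Type*} [CommRing B] [Algebra ℂ B] [CommRing B'] [Algebra ℂ B']
    (u : B →ₐ[ℂ] B') (q : ℕ) : B ⊗[ℂ] TensorPow B q →ₗ[ℂ] B' ⊗[ℂ] TensorPow B' q :=
  TensorProduct.map u.toLinearMap (tpow u.toLinearMap q)

theorem twMap_twMap {B B' : Type*} [CommRing B] [Algebra ℂ B] [CommRing B'] [Algebra ℂ B']
    {u : B →ₐ[ℂ] B'} {u' : B' →ₐ[ℂ] B} (h : ∀ b, u (u' b) = b) {q : ℕ}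
    (x : B' ⊗[ℂ] TensorPow B' q) : twMap u q (twMap u' q x) = x := by
  have e : u.toLinearMap ∘ₗ u'.toLinearMap = LinearMap.id := LinearMap.ext h
  rw [← LinearMap.comp_apply, ← TensorProduct.map_comp, ← tpow_comp, e, tpow_id,
    TensorProduct.map_id, LinearMap.id_apply]

theorem tw_twMap {B B' : Type*} [CommRing B] [Algebra ℂ B] [CommRing B'] [Algebra ℂ B']
    {u : B →ₐ[ℂ] B'} {σ : B →ₐ[ℂ] B} {σ' : B' →ₐ[ℂ] B'} (h : ∀ b, u (σ b) = σ' (u b)) {q : ℕ}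
    (x : B ⊗[ℂ] TensorPow B (q + 1)) :
    tw (mulBy (AlgHom.id ℂ B')) (mulBy σ') q (twMap u (q + 1) x) =
      twMap u q (tw (mulBy (AlgHom.id ℂ B)) (mulBy σ) q x) :=
  tw_map u.toLinearMap u.toLinearMap (fun _ _ => map_mul u _ _) (fun _ _ => map_mul u _ _)
    (fun b m => by simp [h]) x

theorem twMap_mem_twCycles {B B' : Type*} [CommRing B] [Algebra ℂ B] [CommRing B'] [Algebra ℂ B']
    {u : B →ₐ[ℂ] B'} {σ : B →ₐ[ℂ] B} {σ' : B' →ₐ[ℂ] B'} (h : ∀ b, u (σ b) = σ' (u b)) :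
    ∀ {q : ℕ} {x : B ⊗[ℂ] TensorPow B q}, x ∈ twCycles σ q → twMap u q x ∈ twCycles σ' q
  | 0, _, _ => Submodule.mem_top
  | q + 1, x, hx => by
    have hx' : tw (mulBy (AlgHom.id ℂ B)) (mulBy σ) q x = 0 := hx
    change tw (mulBy (AlgHom.id ℂ B')) (mulBy σ') q _ = 0
    rw [tw_twMap h, hx', map_zero]

/-- A linear operator of finite order on a finite-dimensional complex vector space has a basis of
eigenvectors. -/
theorem exists_basis_eigenvectors {V : Type} [AddCommGroup V] [Module ℂ V] [FiniteDimensional ℂ V]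
    (f : Module.End ℂ V) {N : ℕ} (hN : N ≠ 0) (hf : f ^ N = 1) :
    ∃ (ι : Type) (_ : Fintype ι) (v : Module.Basis ι ℂ V) (ζ : ι → ℂ),
      ∀ i, f (v i) = ζ i • v i := by
  have hss : f.IsSemisimple := by
    refine Module.End.isSemisimple_of_squarefree_aeval_eq_zero
      (p := Polynomial.X ^ N - Polynomial.C 1) ?_ ?_
    · exact (Polynomial.separable_X_pow_sub_C 1 (Nat.cast_ne_zero.2 hN) one_ne_zero).squarefree
    · simp [hf]
  let s : Set V := {x | ∃ μ : ℂ, f x = μ • x}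
  have hs : ⊤ ≤ Submodule.span ℂ s := by
    rw [← Module.End.iSup_maxGenEigenspace_eq_top f]
    refine iSup_le fun μ => ?_
    rw [hss.isFinitelySemisimple.maxGenEigenspace_eq_eigenspace]
    exact fun x hx => Submodule.subset_span ⟨μ, Module.End.mem_eigenspace_iff.1 hx⟩
  have hmem : ∀ i, Module.Basis.ofSpan hs i ∈ s := fun i =>
    Module.Basis.ofSpan_subset hs ⟨i, rfl⟩
  choose ζ hζ using hmem
  exact ⟨_, FiniteDimensional.fintypeBasisIndex (Module.Basis.ofSpan hs),
    Module.Basis.ofSpan hs, ζ, hζ⟩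

variable {Γ : Type*} [Group Γ] {n : ℕ} (ρ : Representation ℂ Γ (Fin n → ℂ))

theorem evalAt_X (x : Fin n → ℂ) (j : Fin n) :
    evalAt ρ x (MvPolynomial.X j : MvPolynomial (Fin n) ℂ) = x j :=
  MvPolynomial.aeval_X _ _

variable [Finite Γ]

/-- In the coordinates given by a basis of eigenvectors of `γ`, the algebra `O(X)` is a polynomial
algebra (by `Θ` and its inverse `Θ'`), the action of `γ` is the diagonal endomorphism
`x_i ↦ (1 + a_i) x_i`, and `X^γ` is the coordinate subspace on which all `x_i` with `a_i ≠ 0`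
vanish. -/
theorem exists_diagonal_coordinates (γ : Γ) : ∃ (ι : Type) (_ : Fintype ι) (_ : DecidableEq ι)
    (Θ : MvPolynomial ι ℂ →ₐ[ℂ] RegFun ρ) (Θ' : RegFun ρ →ₐ[ℂ] MvPolynomial ι ℂ) (a : ι → ℂ)
    (δ : FixedFun ρ γ →ₐ[ℂ] MvPolynomial ι ℂ),
    (∀ f, Θ (Θ' f) = f) ∧ (∀ p, Θ' (Θ p) = p) ∧
    (∀ i, Θ' (actHom ρ γ (Θ (MvPolynomial.X i))) = MvPolynomial.X i + a i • MvPolynomial.X i) ∧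
    (∀ z, res ρ γ (Θ (δ z)) = z) ∧
    ∀ i, δ (res ρ γ (Θ (MvPolynomial.X i))) = if a i = 0 then MvPolynomial.X i else 0 := by
  classical
  -- Functions are acted on through `γ⁻¹`, whose eigenvalues are therefore the ones that matter.
  obtain ⟨ι, _, v, ζ, hζ⟩ := exists_basis_eigenvectors (ρ γ⁻¹) (Nat.card_pos (α := Γ)).ne' (by
    rw [← map_pow, pow_card_eq_one', map_one])
  let co : (Fin n → ℂ) → ι → ℂ := fun x i => v.repr x i
  let pt : (ι → ℂ) → Fin n → ℂ := fun y => ∑ i, y i • v i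
  have hcopt : ∀ y, co (pt y) = y := fun y => by
    funext i; simp [co, pt, Finsupp.single_apply]
  have hptco : ∀ x, pt (co x) = x := fun x => v.sum_repr x
  have hcoT : ∀ x i, co (ρ γ⁻¹ x) i = ζ i * co x i := by
    intro x i
    conv_lhs => rw [← hptco x]
    simp only [pt, co, map_sum, map_smul, hζ, Finsupp.coe_finsetSum, Finset.sum_apply,
      Finsupp.smul_apply, Module.Basis.repr_self, Finsupp.single_apply, smul_eq_mul]
    simp [mul_comm]
  have hfix : ∀ x, x ∈ fixedPts ρ γ ↔ ∀ i, ζ i - 1 ≠ 0 → co x i = 0 := by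
    intro x
    have h1 : x ∈ fixedPts ρ γ ↔ ρ γ⁻¹ x = x := by
      have e : ∀ g y, ρ g⁻¹ (ρ g y) = y := fun g y => by
        rw [← Module.End.mul_apply, ← map_mul, inv_mul_cancel, map_one, Module.End.one_apply]
      constructor
      · intro (h : ρ γ x = x)
        conv_lhs => rw [← h]
        exact e γ x
      · intro h
        change ρ γ x = x
        conv_lhs => rw [← h]
        simpa only [inv_inv] using e γ⁻¹ x
    have h2 : ρ γ⁻¹ x = x ↔ ∀ i, co (ρ γ⁻¹ x) i = co x i :=
      ⟨fun h i => by rw [h], fun h => by rw [← hptco (ρ γ⁻¹ x), funext h, hptco]⟩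
    rw [h1, h2]
    refine forall_congr' fun i => ?_
    rw [hcoT]
    constructor
    · intro h hi
      have : (ζ i - 1) * co x i = 0 := by rw [sub_mul, h, one_mul, sub_self]
      exact (mul_eq_zero.1 this).resolve_left hi
    · intro h
      by_cases hi : ζ i - 1 = 0
      · rw [sub_eq_zero.1 hi, one_mul]
      · rw [h hi, mul_zero]
  let Θ : MvPolynomial ι ℂ →ₐ[ℂ] RegFun ρ := MvPolynomial.aeval fun i =>
    (∑ j, co (Pi.single j 1) i • (MvPolynomial.X j : MvPolynomial (Fin n) ℂ) :
      MvPolynomial (Fin n) ℂ)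
  let Θ' : RegFun ρ →ₐ[ℂ] MvPolynomial ι ℂ := (MvPolynomial.aeval fun j =>
    ∑ i, v i j • (MvPolynomial.X i : MvPolynomial ι ℂ) :
      MvPolynomial (Fin n) ℂ →ₐ[ℂ] MvPolynomial ι ℂ)
  have hΘ : ∀ x p, evalAt ρ x (Θ p) = MvPolynomial.aeval (co x) p := by
    intro x p
    have : (evalAt ρ x).comp Θ = MvPolynomial.aeval (co x) := by
      refine MvPolynomial.algHom_ext fun i => ?_
      have hX : Θ (MvPolynomial.X i) = (∑ j, co (Pi.single j 1) i •
          (MvPolynomial.X j : MvPolynomial (Fin n) ℂ) : MvPolynomial (Fin n) ℂ) :=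
        MvPolynomial.aeval_X _ _
      rw [AlgHom.comp_apply, hX, MvPolynomial.aeval_X]
      refine (map_sum (evalAt ρ x) _ _).trans ?_
      have hx : x = ∑ j, x j • (Pi.single j 1 : Fin n → ℂ) := by
        funext k; simp [Finset.sum_apply, Pi.single_apply]
      conv_rhs => rw [hx]
      simp only [co, map_sum, map_smul, Finsupp.coe_finsetSum, Finset.sum_apply,
        Finsupp.smul_apply, smul_eq_mul]
      refine Finset.sum_congr rfl fun j _ => ?_
      refine (map_smul (evalAt ρ x) _ _).trans ?_
      rw [evalAt_X, smul_eq_mul, mul_comm]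
    exact DFunLike.congr_fun this p
  have hΘ' : ∀ y f, MvPolynomial.aeval y (Θ' f) = evalAt ρ (pt y) f := by
    intro y f
    have : (MvPolynomial.aeval y : MvPolynomial ι ℂ →ₐ[ℂ] ℂ).comp Θ' = evalAt ρ (pt y) := by
      refine MvPolynomial.algHom_ext (A := ℂ) (R := ℂ) (σ := Fin n) fun j => ?_
      have hX : Θ' (MvPolynomial.X j : MvPolynomial (Fin n) ℂ) =
          ∑ i, v i j • (MvPolynomial.X i : MvPolynomial ι ℂ) := MvPolynomial.aeval_X _ _
      refine (congrArg (MvPolynomial.aeval y) hX).trans (Eq.trans ?_ (evalAt_X ρ (pt y) j).symm)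
      simp [pt, Finset.sum_apply, mul_comm]
    exact DFunLike.congr_fun this f
  have hext : ∀ p p' : MvPolynomial ι ℂ, (∀ y : ι → ℂ, MvPolynomial.aeval y p =
      MvPolynomial.aeval y p') → p = p' := fun p p' h => MvPolynomial.funext fun y => by
    simpa [MvPolynomial.coe_aeval_eq_eval] using h y
  let a : ι → ℂ := fun i => ζ i - 1
  let κ : MvPolynomial ι ℂ →ₐ[ℂ] MvPolynomial ι ℂ := MvPolynomial.aeval fun i =>
    if a i = 0 then MvPolynomial.X i else 0
  have hκX : ∀ i, κ (MvPolynomial.X i) = if a i = 0 then MvPolynomial.X i else 0 :=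
    fun i => MvPolynomial.aeval_X _ _
  let cut : (ι → ℂ) → ι → ℂ := fun y i => if a i = 0 then y i else 0
  have hκ : ∀ y p, MvPolynomial.aeval y (κ p) = MvPolynomial.aeval (cut y) p := by
    intro y p
    have : (MvPolynomial.aeval y : MvPolynomial ι ℂ →ₐ[ℂ] ℂ).comp κ =
        MvPolynomial.aeval (cut y) := by
      refine MvPolynomial.algHom_ext fun i => ?_
      rw [AlgHom.comp_apply, hκX, MvPolynomial.aeval_X]
      simp only [cut]
      split_ifs <;> simp
    exact DFunLike.congr_fun this p
  have hcut : ∀ y, pt (cut y) ∈ fixedPts ρ γ := fun y => by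
    rw [hfix]
    intro i hi
    rw [hcopt]
    exact if_neg hi
  let δ : FixedFun ρ γ →ₐ[ℂ] MvPolynomial ι ℂ :=
    Ideal.Quotient.liftₐ (fixedIdeal ρ γ) (κ.comp Θ') fun f hf => hext _ _ fun y => by
      rw [AlgHom.comp_apply, hκ, hΘ', map_zero]
      exact (mem_fixedIdeal ρ).1 hf _ (hcut y)
  have hδ : ∀ f, δ (res ρ γ f) = κ (Θ' f) := fun f => rfl
  have h1 : ∀ p, Θ' (Θ p) = p := fun p => hext _ _ fun y => by rw [hΘ', hΘ, hcopt]
  refine ⟨ι, inferInstance, inferInstance, Θ, Θ', a, δ, fun f => RegFun.ext fun x => ?_, h1,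
    fun i => hext _ _ fun y => ?_, fun z => ?_, fun i => ?_⟩
  · rw [hΘ, hΘ', hptco]
  · rw [hΘ', evalAt_actHom, hΘ, MvPolynomial.aeval_X, hcoT, hcopt]
    simp [a]
    ring
  · obtain ⟨f, rfl⟩ := Ideal.Quotient.mk_surjective z
    refine res_eq_res ρ fun x hx => ?_
    refine (hΘ _ _).trans ((hκ _ _).trans ((hΘ' _ _).trans ?_))
    congr 2
    have : cut (co x) = co x := by
      funext i
      simp only [cut]
      split_ifs with h
      · rfl
      · exact ((hfix x).1 hx i h).symm
    rw [this, hptco]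
  · rw [hδ, h1, hκX]

/-- The forms on `X^γ` detect the Hochschild homology of `O(X)` with coefficients in `O(X) γ`. -/
theorem twForm_res_injective (γ : Γ) {q : ℕ} {c : RegFun ρ ⊗[ℂ] TensorPow (RegFun ρ) q}
    (hc : c ∈ twCycles (actHom ρ γ) q) (h : twForm (res ρ γ) q c = 0) :
    c ∈ LinearMap.range (twAct ρ γ q) := by
  obtain ⟨ι, _, _, Θ, Θ', a, δ, h1, h2, h3, h4, h5⟩ := exists_diagonal_coordinates ρ γ
  have hres : ∀ f, res ρ γ (actHom ρ γ f) = res ρ γ f := fun f =>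
    res_zpowers (Subgroup.mem_zpowers γ) f
  obtain ⟨y, hy⟩ := mem_range_tw_of_twForm_eq_zero (σ := Θ'.comp ((actHom ρ γ).comp Θ)) h3
    ((res ρ γ).comp Θ) δ h4
    (AlgHom.ext fun p => by simp only [AlgHom.comp_apply, h1, hres]) h5
    (twMap_mem_twCycles (u := Θ') (fun b => by simp only [AlgHom.comp_apply, h1]) hc) (by
      rw [twForm_map, AlgHom.comp_assoc]
      have : Θ.comp Θ' = AlgHom.id ℂ _ := AlgHom.ext h1
      rw [this, AlgHom.comp_id, h])
  refine ⟨twMap Θ (q + 1) y, ?_⟩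
  rw [tw_twMap (σ := Θ'.comp ((actHom ρ γ).comp Θ)) (fun b => by simp only [AlgHom.comp_apply, h1]),
    hy, twMap_twMap h1]

/-- Every form on `X^γ` comes from a Hochschild cycle of `O(X)` with coefficients in `O(X) γ`. -/
theorem twForm_res_surjective (γ : Γ) {q : ℕ} (η : Forms (FixedFun ρ γ) q) :
    ∃ c ∈ twCycles (actHom ρ γ) q, twForm (res ρ γ) q c = η := by
  obtain ⟨ι, _, _, Θ, Θ', a, δ, h1, h2, h3, h4, h5⟩ := exists_diagonal_coordinates ρ γ
  obtain ⟨c, hc, hη⟩ := exists_twForm_eq (σ := Θ'.comp ((actHom ρ γ).comp Θ)) h3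
    ((res ρ γ).comp Θ) δ h4 h5 η
  exact ⟨twMap Θ q c, twMap_mem_twCycles (fun b => by simp only [AlgHom.comp_apply, h1]) hc,
    by rw [twForm_map, hη]⟩

end Transport

/-! ### The map `φ_γ` on the chains with coefficients in `O(X) γ'` -/

section Equivariance

theorem formsMap_smul_ιMulti {B B' : Type*} [CommRing B] [Algebra ℂ B] [CommRing B'] [Algebra ℂ B']
    (f : B →ₐ[ℂ] B') {q : ℕ} (z : B) (b : Fin q → B) :
    formsMap f q (z • exteriorPower.ιMulti B q fun i => KaehlerDifferential.D ℂ B (b i)) =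
      f z • exteriorPower.ιMulti B' q fun i => KaehlerDifferential.D ℂ B' (f (b i)) := by
  let _ : Algebra B B' := f.toRingHom.toAlgebra
  have : IsScalarTower ℂ B B' := IsScalarTower.of_algebraMap_eq fun r => (f.commutes r).symm
  change formsMapAux B B' q _ = _
  rw [map_smul, ← algebraMap_smul B' z]
  congr 1
  rw [formsMapAux, exteriorPower.alternatingMapLinearEquiv_apply_ιMulti]
  change exteriorPower.ιMulti B' q _ = _
  congr 1
  funext i
  exact KaehlerDifferential.map_D ℂ ℂ B B' (b i)

/-- The Hochschild–Kostant–Rosenberg map is natural. -/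
theorem formsMap_twForm {B B' Q Q' : Type*} [CommRing B] [Algebra ℂ B] [CommRing B'] [Algebra ℂ B']
    [CommRing Q] [Algebra ℂ Q] [CommRing Q'] [Algebra ℂ Q'] {τ : B →ₐ[ℂ] Q} {τ' : B' →ₐ[ℂ] Q'}
    {u : B →ₐ[ℂ] B'} {f : Q →ₐ[ℂ] Q'} (h : ∀ b, f (τ b) = τ' (u b)) {q : ℕ}
    (x : B ⊗[ℂ] TensorPow B q) :
    formsMap f q (twForm τ q x) = twForm τ' q (twMap u q x) := by
  induction x with
  | zero => simp
  | add x y hx hy => simp only [map_add, hx, hy]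
  | tmul z w =>
    refine LinearMap.congr_fun (f := formsMap f q ∘ₗ twForm τ q ∘ₗ TensorProduct.mk ℂ B _ z)
      (g := twForm τ' q ∘ₗ twMap u q ∘ₗ TensorProduct.mk ℂ B _ z)
      (PiTensorProduct.ext (MultilinearMap.ext fun b => ?_)) w
    simp only [LinearMap.compMultilinearMap_apply, LinearMap.comp_apply, TensorProduct.mk_apply,
      TensorProduct.map_tmul, tpow_tprod, twForm_tmul_tprod, map_smul, formsMap_smul_ιMulti, h,
      AlgHom.toLinearMap_apply]

end Equivariance

section Trace

/-- The generalized trace of a tensor all of whose factors but the first are diagonal: only the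
constant loops contribute. -/
theorem genTrace_cons_diagonal {ι B : Type*} [Fintype ι] [DecidableEq ι] [Ring B] [Algebra ℂ B]
    {q : ℕ} (M : Matrix ι ι B) (d : Fin q → ι → B) :
    genTrace ι B (q + 1) (PiTensorProduct.tprod ℂ
        (Fin.cons M fun k => Matrix.diagonal (d k) : Fin (q + 1) → Matrix ι ι B)) =
      ∑ x, PiTensorProduct.tprod ℂ (Fin.cons (M x x) fun k => d k x : Fin (q + 1) → B) := by
  rw [genTrace_tprod]
  symm
  refine Fintype.sum_of_injective (fun x (_ : Fin (q + 1)) => x)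
    (fun x y h => congrFun h 0) _ _ (fun i hi => ?_) (fun x => ?_)
  · -- A loop `i` that is not constant moves at some `k ≥ 1`, where the matrix is diagonal.
    by_contra hne
    have h1 : ∀ k : Fin q, i k.succ = i (finRotate (q + 1) k.succ) := by
      intro k
      by_contra hk
      refine hne (MultilinearMap.map_coord_zero _ k.succ ?_)
      rw [Fin.cons_succ, Matrix.diagonal_apply_ne _ hk]
    refine hi ⟨i 0, funext fun k => ?_⟩
    induction k using Fin.reverseInduction with
    | last =>
      cases q with
      | zero => rfl
      | succ q =>
        have := h1 (Fin.last q)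
        rw [Fin.succ_last, finRotate_last] at this
        exact this.symm
    | cast k ih =>
      rcases Fin.eq_zero_or_eq_succ k.castSucc with h | ⟨j, h⟩
      · rw [h]
      · have hr : finRotate (q + 1) j.succ = k.succ := by
          rw [← h, finRotate_apply, Fin.coeSucc_eq_succ]
        have ih' : i 0 = i k.succ := ih
        change i 0 = i k.castSucc
        rw [ih', h, h1 j, hr]
  · congr 1
    funext k
    refine Fin.cases ?_ (fun k => ?_) k <;> simp

end Trace

section Characters

/-- Orthogonality of the characters of a finite cyclic group. -/
theorem sum_conj_char_mul_char {C : Type*} [Group C] [IsCyclic C] [Finite C] [Fintype (C →* ℂˣ)]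
    [DecidableEq C] (g c : C) :
    ∑ π : C →* ℂˣ, conj (π g : ℂ) * (π c : ℂ) = if c = g then (Nat.card C : ℂ) else 0 := by
  let _ : CommGroup C := IsCyclic.commGroup
  have h1 : ∀ π : C →* ℂˣ, conj (π g : ℂ) * (π c : ℂ) = (π (g⁻¹ * c) : ℂ) := by
    intro π
    have hn : ‖(π g : ℂ)‖ = 1 := by
      refine Complex.norm_eq_one_of_pow_eq_one (n := Nat.card C) ?_ Nat.card_pos.ne'
      rw [← Units.val_pow_eq_pow_val, ← map_pow, pow_card_eq_one', map_one, Units.val_one]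
    rw [map_mul, Units.val_mul, map_inv, Units.val_inv_eq_inv_val, Complex.inv_eq_conj hn]
  simp only [h1]
  have := Fintype.ofFinite C
  split_ifs with h
  · subst h
    simp only [inv_mul_cancel, map_one, Units.val_one, Finset.sum_const, Finset.card_univ,
      nsmul_eq_mul, mul_one]
    rw [← Nat.card_eq_fintype_card, CommGroup.card_monoidHom_of_hasEnoughRootsOfUnity]
  · have hne : g⁻¹ * c ≠ 1 := fun e => h (inv_mul_eq_one.1 e).symm
    obtain ⟨χ, hχ⟩ := CommGroup.exists_apply_ne_one_of_hasEnoughRootsOfUnity C ℂ hne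
    have hs : (χ (g⁻¹ * c) : ℂ) * ∑ π : C →* ℂˣ, (π (g⁻¹ * c) : ℂ) =
        ∑ π : C →* ℂˣ, (π (g⁻¹ * c) : ℂ) := by
      rw [Finset.mul_sum]
      refine Fintype.sum_equiv (Equiv.mulLeft χ) _ _ fun π => ?_
      simp
    have hχ' : (χ (g⁻¹ * c) : ℂ) - 1 ≠ 0 := sub_ne_zero.2 fun e => hχ (Units.ext e)
    refine (mul_eq_zero.1 ?_).resolve_left hχ'
    rw [sub_mul, hs, one_mul, sub_self]

end Characters

section Phi

variable {Γ : Type*} [Group Γ] [Finite Γ] {n : ℕ} (ρ : Representation ℂ Γ (Fin n → ℂ))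

/-- The map `φ_γ` on the level of Hochschild chains. -/
def phiChain (γ : Γ) (s : CosetReps γ) (q : ℕ) :
    TensorPow (CrossedProduct ρ) (q + 1) →ₗ[ℂ] Forms (FixedFun ρ γ) q :=
  ∑ π : Subgroup.zpowers γ →* ℂˣ,
    (conj (π ⟨γ, Subgroup.mem_zpowers γ⟩ : ℂ) / (Nat.card (Subgroup.zpowers γ) : ℂ)) •
      ((1 / (q.factorial : ℂ)) • formChain (FixedFun ρ γ) q ∘ₗ
        genTrace (Γ ⧸ Subgroup.zpowers γ) (FixedFun ρ γ) (q + 1) ∘ₗ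
        tensorMap (psi ρ γ s π) (q + 1))

theorem phi_mk (γ : Γ) (s : CosetReps γ) {q : ℕ} (x : cycles (CrossedProduct ρ) q) :
    phi ρ γ s q (Submodule.Quotient.mk x) = phiChain ρ γ s q x := by
  rw [phi, phiChain, LinearMap.sum_apply, LinearMap.sum_apply]
  rfl

theorem phiChain_hochB (γ : Γ) (s : CosetReps γ) {q : ℕ}
    (y : TensorPow (CrossedProduct ρ) (q + 2)) :
    phiChain ρ γ s q (hochB (CrossedProduct ρ) q y) = 0 := by
  rw [phiChain, LinearMap.sum_apply]
  refine Finset.sum_eq_zero fun π _ => ?_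
  have h1 := LinearMap.congr_fun (tensorMap_hochB (psi ρ γ s π) q) y
  have h2 := LinearMap.congr_fun (genTrace_hochB (ι := Γ ⧸ Subgroup.zpowers γ)
    (B := FixedFun ρ γ) q) (tensorMap (psi ρ γ s π) (q + 2) y)
  have h3 := LinearMap.congr_fun (formChain_hochB (FixedFun ρ γ) q)
    (genTrace (Γ ⧸ Subgroup.zpowers γ) (FixedFun ρ γ) (q + 2)
      (tensorMap (psi ρ γ s π) (q + 2) y))
  simp only [LinearMap.comp_apply, LinearMap.zero_apply] at h1 h2 h3
  simp only [LinearMap.smul_apply, LinearMap.comp_apply, ← h1, ← h2, h3, smul_zero]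

/-- The map `φ_γ` on the chains with coefficients in `O(X) γ'`. The diagonal entries of
`ψ_{γ,π}(f γ')` are indexed by the fixed cosets of `γ'`, and the sum over the characters `π`
selects those cosets `x` whose representative conjugates `γ'` to `γ`. -/
theorem phiChain_inc [DecidableEq Γ] (γ γ' : Γ) (s : CosetReps γ) {q : ℕ}
    (z : RegFun ρ ⊗[ℂ] TensorPow (RegFun ρ) q) :
    phiChain ρ γ s q (inc ρ γ' q z) = ∑ x, if (s.1 x)⁻¹ * γ' * s.1 x = γ then
      twForm (res ρ γ) q (actChain ρ (s.1 x)⁻¹ q z) else 0 := by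
  induction z with
  | zero => simp
  | add x y hx hy =>
    simp only [map_add, hx, hy, ← Finset.sum_add_distrib]
    refine Finset.sum_congr rfl fun x _ => ?_
    split_ifs <;> simp
  | tmul f w =>
    refine LinearMap.congr_fun (f := phiChain ρ γ s q ∘ₗ inc ρ γ' q ∘ₗ TensorProduct.mk ℂ _ _ f)
      (g := ∑ x, if (s.1 x)⁻¹ * γ' * s.1 x = γ then
        twForm (res ρ γ) q ∘ₗ actChain ρ (s.1 x)⁻¹ q ∘ₗ TensorProduct.mk ℂ _ _ f else 0)
      (PiTensorProduct.ext (MultilinearMap.ext fun b => ?_)) w |>.trans ?_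
    swap
    · rw [LinearMap.sum_apply]
      refine Finset.sum_congr rfl fun x _ => ?_
      split_ifs <;> rfl
    simp only [LinearMap.compMultilinearMap_apply, LinearMap.comp_apply, TensorProduct.mk_apply,
      LinearMap.sum_apply]
    set W : Γ ⧸ Subgroup.zpowers γ → Forms (FixedFun ρ γ) q := fun x =>
      twForm (res ρ γ) q (actChain ρ (s.1 x)⁻¹ q (f ⊗ₜ PiTensorProduct.tprod ℂ b)) with hW
    have hWx : ∀ x, W x = (1 / (q.factorial : ℂ)) • res ρ γ ((s.1 x)⁻¹ • f) •
        exteriorPower.ιMulti (FixedFun ρ γ) q fun i =>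
          KaehlerDifferential.D ℂ _ (res ρ γ ((s.1 x)⁻¹ • b i)) := by
      intro x
      simp only [hW, actChain, TensorProduct.map_tmul, tpow_tprod, twForm_tmul_tprod]
      rfl
    have hinc : inc ρ γ' q (f ⊗ₜ PiTensorProduct.tprod ℂ b) = PiTensorProduct.tprod ℂ
        (Fin.cons (SkewMonoidAlgebra.single γ' f) fun i => SkewMonoidAlgebra.single 1 (b i)) := by
      rw [inc, LinearMap.comp_apply, TensorProduct.map_tmul, tpow_tprod, join_tmul, tcons_tprod]
      rfl
    have hterm : ∀ π : Subgroup.zpowers γ →* ℂˣ, (1 / (q.factorial : ℂ)) •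
        formChain (FixedFun ρ γ) q (genTrace (Γ ⧸ Subgroup.zpowers γ) (FixedFun ρ γ) (q + 1)
          (tensorMap (psi ρ γ s π) (q + 1) (inc ρ γ' q (f ⊗ₜ PiTensorProduct.tprod ℂ b)))) =
        ∑ x, (if h : γ' • x = x then
          (π ⟨(s.1 x)⁻¹ * γ' * s.1 x, s.mem h⟩ : ℂ) else 0) • W x := by
      intro π
      have h1 : ∀ i, psi ρ γ s π (SkewMonoidAlgebra.single 1 (b i)) =
          Matrix.diagonal fun x => res ρ γ ((s.1 x)⁻¹ • b i) := by
        intro i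
        ext x y
        rw [psi_single_apply]
        by_cases hxy : y = x
        · subst hxy
          rw [dif_pos (one_smul Γ y), Matrix.diagonal_apply_eq]
          have : (⟨(s.1 y)⁻¹ * 1 * s.1 y, s.mem (one_smul Γ y)⟩ : Subgroup.zpowers γ) = 1 :=
            Subtype.ext (by simp)
          rw [this, map_one, Units.val_one, one_smul]
        · rw [Matrix.diagonal_apply_ne _ (Ne.symm hxy), dif_neg]
          rwa [one_smul]
      have h2 : (fun k => (psi ρ γ s π).toLinearMap ((Fin.cons (SkewMonoidAlgebra.single γ' f)
          fun i => SkewMonoidAlgebra.single 1 (b i) : Fin (q + 1) → CrossedProduct ρ) k)) =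
          Fin.cons (psi ρ γ s π (SkewMonoidAlgebra.single γ' f))
            fun i => Matrix.diagonal fun x => res ρ γ ((s.1 x)⁻¹ • b i) := by
        funext k
        refine Fin.cases ?_ (fun i => ?_) k
        · rfl
        · exact h1 i
      rw [hinc, tensorMap, PiTensorProduct.map_tprod, h2, genTrace_cons_diagonal, map_sum,
        Finset.smul_sum]
      refine Finset.sum_congr rfl fun x _ => ?_
      rw [formChain_tprod, hWx, Fin.cons_zero, psi_single_apply]
      simp only [Fin.cons_succ]
      split_ifs with h
      · rw [smul_assoc, smul_comm]
      · rw [zero_smul, zero_smul, smul_zero]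
    rw [phiChain, LinearMap.sum_apply]
    simp only [LinearMap.smul_apply, LinearMap.comp_apply, hterm]
    simp only [Finset.smul_sum, smul_smul]
    rw [Finset.sum_comm]
    refine Finset.sum_congr rfl fun x _ => ?_
    rw [← Finset.sum_smul]
    have hN : (Nat.card (Subgroup.zpowers γ) : ℂ) ≠ 0 := Nat.cast_ne_zero.2 Nat.card_pos.ne'
    have key : ∑ π : Subgroup.zpowers γ →* ℂˣ, conj (π ⟨γ, Subgroup.mem_zpowers γ⟩ : ℂ) /
        (Nat.card (Subgroup.zpowers γ) : ℂ) * (if h : γ' • x = x then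
          (π ⟨(s.1 x)⁻¹ * γ' * s.1 x, s.mem h⟩ : ℂ) else 0) =
        if (s.1 x)⁻¹ * γ' * s.1 x = γ then 1 else 0 := by
      by_cases h : γ' • x = x
      · simp only [dif_pos h, div_mul_eq_mul_div]
        rw [← Finset.sum_div, sum_conj_char_mul_char]
        simp only [Subtype.mk.injEq]
        split_ifs
        · exact div_self hN
        · exact zero_div _
      · have hne : (s.1 x)⁻¹ * γ' * s.1 x ≠ γ := by
          intro e
          apply h
          have e' : γ' * s.1 x = s.1 x * γ :=
            inv_mul_eq_iff_eq_mul.1 (by rwa [mul_assoc] at e)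
          conv_lhs => rw [← s.2 x]
          change QuotientGroup.mk (γ' * s.1 x) = x
          rw [e', QuotientGroup.mk_mul_of_mem _ (Subgroup.mem_zpowers γ), s.2]
        simp only [dif_neg h, mul_zero, Finset.sum_const_zero, if_neg hne]
    rw [key]
    split_ifs
    · rw [one_smul]; rfl
    · rw [zero_smul]; rfl

end Phi

/-! ### The components of a Hochschild cycle of the crossed product -/

section Components

variable {Γ : Type*} [Group Γ] {n : ℕ} (ρ : Representation ℂ Γ (Fin n → ℂ))

theorem fixedAct_res (γ : Γ) (h : Subgroup.centralizer {γ}) (b : RegFun ρ) :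
    fixedAct ρ γ h (res ρ γ b) = res ρ γ (actHom ρ (h : Γ) b) := rfl

theorem formsMap_fixedAct_twForm (γ : Γ) (h : Subgroup.centralizer {γ}) {q : ℕ}
    (z : RegFun ρ ⊗[ℂ] TensorPow (RegFun ρ) q) :
    formsMap (fixedAct ρ γ h) q (twForm (res ρ γ) q z) =
      twForm (res ρ γ) q (actChain ρ (h : Γ) q z) :=
  formsMap_twForm (τ := res ρ γ) (τ' := res ρ γ) (u := actHom ρ (h : Γ)) (f := fixedAct ρ γ h)
    (fun b => fixedAct_res ρ γ h b) z

theorem actHom_actHom (g h : Γ) (f : RegFun ρ) :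
    actHom ρ g (actHom ρ h f) = actHom ρ (g * h) f :=
  (mul_smul g h f).symm

theorem twAct_actChain (h γ : Γ) {q : ℕ} (y : RegFun ρ ⊗[ℂ] TensorPow (RegFun ρ) (q + 1)) :
    twAct ρ (h * γ * h⁻¹) q (actChain ρ h (q + 1) y) = actChain ρ h q (twAct ρ γ q y) :=
  tw_twMap (u := actHom ρ h) (σ := actHom ρ γ) (σ' := actHom ρ (h * γ * h⁻¹)) (fun b => by
    rw [actHom_actHom, actHom_actHom, inv_mul_cancel_right]) y

theorem sum_inc_mem_cycles {α : Type*} (t : Finset α) (γ : α → Γ) {q : ℕ}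
    (y : α → RegFun ρ ⊗[ℂ] TensorPow (RegFun ρ) q)
    (hy : ∀ i, y i ∈ twCycles (actHom ρ (γ i)) q) :
    ∑ i ∈ t, inc ρ (γ i) q (y i) ∈ cycles (CrossedProduct ρ) q := by
  cases q with
  | zero => exact Submodule.mem_top
  | succ q =>
    refine sum_mem fun i _ => ?_
    have h : twAct ρ (γ i) q (y i) = 0 := hy i
    change hochB (CrossedProduct ρ) q _ = 0
    rw [hochB_inc, h, map_zero]

variable [Fintype Γ] [DecidableEq Γ]

/-- The component at `γ` of a Hochschild chain of the crossed product. -/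
def component (γ : Γ) (q : ℕ) : TensorPow (CrossedProduct ρ) (q + 1) →ₗ[ℂ]
    RegFun ρ ⊗[ℂ] TensorPow (RegFun ρ) q :=
  projChain ρ γ q ∘ₗ regChain ρ q

/-- The components at conjugate elements of the group determine each other. -/
theorem component_conj (h γ : Γ) {q : ℕ} (x : TensorPow (CrossedProduct ρ) (q + 1)) :
    component ρ (h * γ * h⁻¹) q x = actChain ρ h q (component ρ γ q x) :=
  projChain_conj_regChain ρ h γ x

theorem component_mem_twCycles (γ : Γ) : ∀ {q : ℕ} {x : TensorPow (CrossedProduct ρ) (q + 1)},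
    x ∈ cycles (CrossedProduct ρ) q → component ρ γ q x ∈ twCycles (actHom ρ γ) q
  | 0, _, _ => Submodule.mem_top
  | q + 1, x, hx => by
    have hx' : hochB (CrossedProduct ρ) q x = 0 := hx
    change twAct ρ γ q (projChain ρ γ (q + 1) (regChain ρ (q + 1) x)) = 0
    rw [twAct_projChain_regChain, hx', map_zero, map_zero]

/-- Up to a nonzero scalar, `φ_γ` is the Hochschild–Kostant–Rosenberg map of the component at `γ`:
each coset contributes the component at one conjugate of `γ`, transported back to `γ`. -/
theorem card_smul_phiChain (γ : Γ) (s : CosetReps γ) {q : ℕ}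
    {x : TensorPow (CrossedProduct ρ) (q + 1)} (hx : x ∈ cycles (CrossedProduct ρ) q) :
    (Fintype.card Γ : ℂ) • phiChain ρ γ s q x =
      (Fintype.card (Γ ⧸ Subgroup.zpowers γ) : ℂ) • twForm (res ρ γ) q (component ρ γ q x) := by
  obtain ⟨y, hy⟩ := card_smul_sub_regChain_mem ρ hx
  have h1 : (Fintype.card Γ : ℂ) • phiChain ρ γ s q x = phiChain ρ γ s q (regChain ρ q x) := by
    rw [← map_smul, ← sub_eq_zero, ← map_sub, ← hy, phiChain_hochB]
  have h2 : ∀ c : Γ ⧸ Subgroup.zpowers γ, ∑ γ', (if (s.1 c)⁻¹ * γ' * s.1 c = γ then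
      twForm (res ρ γ) q (actChain ρ (s.1 c)⁻¹ q (component ρ γ' q x)) else 0) =
      twForm (res ρ γ) q (component ρ γ q x) := by
    intro c
    rw [Finset.sum_eq_single (s.1 c * γ * (s.1 c)⁻¹)]
    · have e : (s.1 c)⁻¹ * (s.1 c * γ * (s.1 c)⁻¹) * s.1 c = γ := by group
      rw [if_pos e, ← component_conj, inv_inv, e]
    · intro γ' _ hne
      rw [if_neg]
      exact fun e => hne (mul_inv_eq_of_eq_mul (inv_mul_eq_iff_eq_mul.1
        (by rwa [mul_assoc] at e)).symm).symm
    · simp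
  rw [h1, ← sum_inc_projChain_regChain ρ x, map_sum]
  simp only [phiChain_inc]
  rw [Finset.sum_comm]
  refine (Finset.sum_congr rfl fun c _ => h2 c).trans ?_
  rw [Finset.sum_const, Finset.card_univ, Nat.cast_smul_eq_nsmul]

/-- A Hochschild cycle of the crossed product all of whose components are boundaries is a boundary:
it is a multiple of the sum of its components up to a boundary. -/
theorem mem_boundaries_of_component {q : ℕ} {x : TensorPow (CrossedProduct ρ) (q + 1)}
    (hx : x ∈ cycles (CrossedProduct ρ) q)
    (h : ∀ γ, component ρ γ q x ∈ LinearMap.range (twAct ρ γ q)) :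
    x ∈ boundaries (CrossedProduct ρ) q := by
  have h1 : regChain ρ q x ∈ boundaries (CrossedProduct ρ) q := by
    rw [← sum_inc_projChain_regChain ρ x]
    refine sum_mem fun γ _ => ?_
    obtain ⟨y, hy⟩ := h γ
    exact ⟨inc ρ γ (q + 1) y, by rw [hochB_inc, hy]; rfl⟩
  have h2 := add_mem (card_smul_sub_regChain_mem ρ hx) h1
  rw [sub_add_cancel] at h2
  have hc : (Fintype.card Γ : ℂ) ≠ 0 := Nat.cast_ne_zero.2 Fintype.card_ne_zero
  simpa [smul_smul, inv_mul_cancel₀ hc] using Submodule.smul_mem _ (Fintype.card Γ : ℂ)⁻¹ h2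

end Components

section Main

variable {Γ : Type*} [Group Γ] [Finite Γ] {n : ℕ} (ρ : Representation ℂ Γ (Fin n → ℂ))

/-- The map `φ_γ` takes its values in the forms that are invariant under the centralizer. -/
theorem phi_mem_invForms (γ : Γ) (s : CosetReps γ) {q : ℕ} (x : HH (CrossedProduct ρ) q) :
    phi ρ γ s q x ∈ invForms ρ γ q := by
  classical
  have := Fintype.ofFinite Γ
  obtain ⟨x, rfl⟩ := Submodule.Quotient.mk_surjective _ x
  have hc : (Fintype.card Γ : ℂ) ≠ 0 := Nat.cast_ne_zero.2 Fintype.card_ne_zero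
  rw [phi_mk, ← inv_smul_smul₀ hc (phiChain ρ γ s q x), card_smul_phiChain ρ γ s x.2]
  refine Submodule.smul_mem _ _ (Submodule.smul_mem _ _ ?_)
  refine (Submodule.mem_iInf _).2 fun h => ?_
  have e : (h : Γ) * γ * (h : Γ)⁻¹ = γ := by
    rw [Subgroup.mem_centralizer_singleton_iff.1 h.2, mul_inv_cancel_right]
  rw [LinearMap.mem_eqLocus, formsMap_fixedAct_twForm, ← component_conj, e, LinearMap.id_apply]

/-- A class that is killed by `φ_γ` for a representative `γ` of every conjugacy class vanishes. -/
theorem eq_zero_of_phi_eq_zero (rep : ConjClasses Γ → Γ) (hrep : ∀ c, ConjClasses.mk (rep c) = c)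
    (s : ∀ γ : Γ, CosetReps γ) {q : ℕ} (x : HH (CrossedProduct ρ) q)
    (h : ∀ c, phi ρ (rep c) (s (rep c)) q x = 0) : x = 0 := by
  classical
  have := Fintype.ofFinite Γ
  obtain ⟨x, rfl⟩ := Submodule.Quotient.mk_surjective _ x
  refine (Submodule.Quotient.mk_eq_zero _).2 (mem_boundaries_of_component ρ x.2 fun γ => ?_)
  obtain ⟨g, hg⟩ := isConj_iff.1 (ConjClasses.mk_eq_mk_iff_isConj.1 (hrep (ConjClasses.mk γ)))
  set γ₀ := rep (ConjClasses.mk γ)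
  have h1 := card_smul_phiChain ρ γ₀ (s γ₀) x.2
  rw [← phi_mk, h, smul_zero, eq_comm, smul_eq_zero] at h1
  obtain ⟨y, hy⟩ := twForm_res_injective ρ γ₀ (component_mem_twCycles ρ γ₀ x.2)
    (h1.resolve_left (Nat.cast_ne_zero.2 Fintype.card_ne_zero))
  refine ⟨actChain ρ g (q + 1) y, ?_⟩
  rw [← hg, twAct_actChain, component_conj, hy]
  rfl

/-- Every family of invariant forms, one for each conjugacy class, is in the image. -/
theorem exists_phi_eq (rep : ConjClasses Γ → Γ) (hrep : ∀ c, ConjClasses.mk (rep c) = c)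
    (s : ∀ γ : Γ, CosetReps γ) {q : ℕ} (η : ∀ c, invForms ρ (rep c) q) :
    ∃ x : HH (CrossedProduct ρ) q, ∀ c, phi ρ (rep c) (s (rep c)) q x = η c := by
  classical
  have := Fintype.ofFinite (ConjClasses Γ)
  choose y hy hyη using fun c => twForm_res_surjective ρ (rep c) (η c : Forms _ q)
  -- The number of cosets represented by an element of the centralizer.
  let N : ConjClasses Γ → ℕ := fun c => (Finset.univ.filter fun x =>
    ((s (rep c)).1 x)⁻¹ * rep c * (s (rep c)).1 x = rep c).card
  have hN : ∀ c, (N c : ℂ) ≠ 0 := by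
    intro c
    refine Nat.cast_ne_zero.2 (Finset.card_ne_zero_of_mem
      (a := QuotientGroup.mk (1 : Γ)) (Finset.mem_filter.2 ⟨Finset.mem_univ _, ?_⟩))
    have h1 : (s (rep c)).1 (QuotientGroup.mk 1) ∈ Subgroup.zpowers (rep c) := by
      have := QuotientGroup.eq.1 ((s (rep c)).2 (QuotientGroup.mk 1)).symm
      simpa using this
    obtain ⟨k, hk⟩ := Subgroup.mem_zpowers_iff.1 h1
    rw [← hk]
    group
  have hz : ∀ c, (N c : ℂ)⁻¹ • y c ∈ twCycles (actHom ρ (rep c)) q := fun c =>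
    Submodule.smul_mem _ _ (hy c)
  -- By invariance, each of these `N c` cosets contributes the form `η c` to the image of `y c`.
  refine ⟨Submodule.Quotient.mk ⟨_, sum_inc_mem_cycles ρ Finset.univ rep _ hz⟩, fun c => ?_⟩
  rw [phi_mk, map_sum, Finset.sum_eq_single c]
  · have h1 : ∀ x, (if ((s (rep c)).1 x)⁻¹ * rep c * (s (rep c)).1 x = rep c then
        twForm (res ρ (rep c)) q (actChain ρ ((s (rep c)).1 x)⁻¹ q ((N c : ℂ)⁻¹ • y c)) else 0) =
        if ((s (rep c)).1 x)⁻¹ * rep c * (s (rep c)).1 x = rep c then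
          (N c : ℂ)⁻¹ • (η c : Forms (FixedFun ρ (rep c)) q) else 0 := by
      intro x
      split_ifs with h
      · have hmem : ((s (rep c)).1 x)⁻¹ ∈ Subgroup.centralizer {rep c} := by
          rw [Subgroup.mem_centralizer_singleton_iff]
          exact eq_mul_inv_of_mul_eq h
        have hinv := LinearMap.mem_eqLocus.1 ((Submodule.mem_iInf _).1 (η c).2 ⟨_, hmem⟩)
        rw [← hyη, formsMap_fixedAct_twForm, hyη, LinearMap.id_apply] at hinv
        rw [map_smul, map_smul, hinv]
      · rfl
    simp only [phiChain_inc, h1]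
    rw [← Finset.sum_filter, Finset.sum_const, ← Nat.cast_smul_eq_nsmul ℂ, smul_smul,
      mul_inv_cancel₀ (hN c), one_smul]
  · intro c' _ hne
    rw [phiChain_inc]
    refine Finset.sum_eq_zero fun x _ => if_neg fun h => hne ?_
    rw [← hrep c', ← hrep c, ConjClasses.mk_eq_mk_iff_isConj]
    exact isConj_iff.2 ⟨((s (rep c)).1 x)⁻¹, by rw [inv_inv]; exact h⟩
  · simp

end Main

end CrossedHH

end

theorem mainTheorem2 {Γ : Type*} [Group Γ] [Finite Γ] {n : ℕ}
    (ρ : Representation ℂ Γ (Fin n → ℂ))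
    (rep : ConjClasses Γ → Γ) (hrep : ∀ c, ConjClasses.mk (rep c) = c)
    (s : ∀ γ : Γ, CosetReps γ) (q : ℕ) :
    ∃ e : HH (CrossedProduct ρ) q ≃ₗ[ℂ]
        DirectSum (ConjClasses Γ) (fun c => invForms ρ (rep c) q),
      ∀ (x : HH (CrossedProduct ρ) q) (c : ConjClasses Γ),
        ((e x c : invForms ρ (rep c) q) : Forms (FixedFun ρ (rep c)) q) =
          phi ρ (rep c) (s (rep c)) q x := by
  classical
  have := Fintype.ofFinite (ConjClasses Γ)
  let Φ : HH (CrossedProduct ρ) q →ₗ[ℂ] ∀ c, invForms ρ (rep c) q := LinearMap.pi fun c =>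
    (phi ρ (rep c) (s (rep c)) q).codRestrict _ (phi_mem_invForms ρ (rep c) (s (rep c)))
  have hΦ : Function.Bijective Φ := by
    constructor
    · rw [injective_iff_map_eq_zero]
      exact fun x hx => eq_zero_of_phi_eq_zero ρ rep hrep s x fun c =>
        congrArg Subtype.val (congrFun hx c)
    · intro η
      obtain ⟨x, hx⟩ := exists_phi_eq ρ rep hrep s η
      exact ⟨x, funext fun c => Subtype.ext (hx c)⟩
  let E := DirectSum.linearEquivFunOnFintype ℂ (ConjClasses Γ) fun c => invForms ρ (rep c) q
  refine ⟨LinearEquiv.ofBijective Φ hΦ ≪≫ₗ E.symm, fun x c => ?_⟩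
  have h : E (E.symm (Φ x)) c = Φ x c := by rw [LinearEquiv.apply_symm_apply]
  exact congrArg Subtype.val h
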